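/- Let $0<\alpha<\beta<L$, $C_1,C_2,C_3,\delta,T>0$, and put $\mathbb L^2=L^2(0,\alpha)\times L^2(\alpha,\beta)\times L^2(\beta,L)$, $\mathbb H^1=H^1(0,\alpha)\times H^1(\alpha,\beta)\times H^1(\beta,L)$ and $\mathbb H^1_L=\{(u,v,w)\in\mathbb H^1:\ u(0)=w(L)=0,\ u(\alpha)=v(\alpha),\ v(\beta)=w(\beta)\}$. Let $\Phi=(\varphi,\eta,\gamma)\in\mathbb H^1_L$ and $\Psi=(\psi,\zeta,\theta)\in\mathbb H^1$. **Weak solutions.** $U=(u,v,w)$ is a weak solution on $[0,T]$ of the transmission problem $u_{tt}-C_1^2u_{xx}=0$ on $(0,\alpha)$, $v_{tt}-C_2^2v_{xx}-\delta v_{xxt}=0$ on $(\alpha,\beta)$, $w_{tt}-C_3^2w_{xx}=0$ on $(\beta,L)$, with Dirichlet conditions at $0$ and $L$, continuity of the solution and of the flux at $\alpha$ and $\beta$, initial position $\Phi$ and initial velocity $\Psi$, if $U\in L^2(0,T;\mathbb H^1_L)$, $U_t\in L^2(0,T;\mathbb L^2)$, $v_{tx}\in L^2(0,T;L^2(\alpha,\beta))$,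 $U(0)=\Phi$ (for the representative in $C([0,T];\mathbb L^2)$), and $$\begin{aligned} &-\int_0^T\!\!\int_0^\alpha u_tp_t\,dx\,dt+C_1^2\int_0^T\!\!\int_0^\alpha u_xp_x\,dx\,dt-\int_0^\alpha\psi\,p(\cdot,0)\,dx\\ &-\int_0^T\!\!\int_\alpha^\beta v_tq_t\,dx\,dt+C_2^2\int_0^T\!\!\int_\alpha^\beta v_xq_x\,dx\,dt+\delta\int_0^T\!\!\int_\alpha^\beta v_{tx}q_x\,dx\,dt-\int_\alpha^\beta\zeta\,q(\cdot,0)\,dx\\ &-\int_0^T\!\!\int_\beta^L w_tz_t\,dx\,dt+C_3^2\int_0^T\!\!\int_\beta^L w_xz_x\,dx\,dt-\int_\beta^L\theta\,z(\cdot,0)\,dx=0 \end{aligned}$$ for all $(p,q,z)\in L^2(0,T;\mathbb H^1_L)$ with $(p_t,q_t,z_t)\in L^2(0,T;\mathbb L^2)$ and $p(T)=q(T)=z(T)=0$. **Mesh.** A mesh $\mathcal T$ is given by integers $N_\alpha,N,N_\beta\ge1$: the intervals $(0,\alpha)$, $(\alpha,\beta)$, $(\beta,L)$ are divided uniformly into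 $N_\alpha$, $N$, $N_\beta$ cells of lengths $h_\alpha$, $h$, $h_\beta$. The cells are $K_i=(x_{i-1/2},x_{i+1/2})$, $1\le i\le N_{\max}=N_\alpha+N+N_\beta$, numbered from left to right, of length $h_i$ and midpoint $x_i$; $x_0=0$, $x_{N_{\max}+1}=L$, $\mathrm{size}(\mathcal T)=\max_ih_i$. Let $c_i$ be the speed ($C_1$, $C_2$ or $C_3$) on $K_i$, $c_0=C_1$, and let $\ell_{i+1/2}=c_i^2/(x_{i+1}-x_i)$ for $0\le i\le N_{\max}$, except $\ell_{N_\alpha+1/2}=\frac{2C_1^2C_2^2}{C_1^2h+C_2^2h_\alpha}$ and $\ell_{N_\alpha+N+1/2}=\frac{2C_2^2C_3^2}{C_3^2h+C_2^2h_\beta}$. Let $\kappa_{i+1/2}=\delta/h$ for $N_\alpha+1\le i\le N_\alpha+N-1$ and $\kappa_{i+1/2}=0$ otherwise. For a vector $V=(V_i)_{0\le i\le N_{\max}+1}$ put $$(BV)_i=\ell_{i+1/2}(V_{i+1}-V_i)-\ell_{i-1/2}(V_i-V_{i-1}),\qquad (AV)_i=\kappa_{i+1/2}(V_{i+1}-V_i)-\kappa_{i-1/2}(V_i-V_{i-1}).$$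 Let $\Phi_i,\Psi_i$ be the mean values over $K_i$ of the component of $\Phi$, $\Psi$ living there, with $\Psi_0=\Psi_{N_{\max}+1}=0$. **Scheme.** Let $\Delta t=T/\mathcal N$ with an integer $\mathcal N\ge1$. The implicit discrete solution $(U_i^n)_{0\le n\le\mathcal N,\,0\le i\le N_{\max}+1}$ satisfies $U_0^n=U_{N_{\max}+1}^n=0$ and, for $1\le i\le N_{\max}$: $U_i^0=\Phi_i$; $$2h_i\frac{U_i^1-U_i^0}{\Delta t^2}-\frac{2h_i}{\Delta t}\Psi_i-(BU^1)_i+\Delta t\,(B\Psi)_i=(A\Psi)_i;$$ $$h_i\frac{U_i^{n+1}-2U_i^n+U_i^{n-1}}{\Delta t^2}-\tfrac12(BU^{n+1})_i-\tfrac12(BU^{n-1})_i=\frac{(AU^{n+1})_i-(AU^{n-1})_i}{2\Delta t}\qquad(1\le n<\mathcal N).$$ Let $U_{\mathcal T,\Delta t}(x,t)=U_i^n$ for $x\in K_i$, $t\in[n\Delta t,(n+1)\Delta t)$, $0\le n<\mathcal N$, and let $u_{\mathcal T,\Delta t},v_{\mathcal T,\Delta t},w_{\mathcal T,\Delta t}$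 be its restrictions to $x\in(0,\alpha)$, $(\alpha,\beta)$, $(\beta,L)$. **Theorem.** Let $(\mathcal T_m)$ be meshes and $(\Delta t_m)$ time steps as above with $\mathrm{size}(\mathcal T_m)\to0$ and $\Delta t_m\to0$ (with no relation between the two), and let $(u_{\mathcal T_m,\Delta t_m},v_{\mathcal T_m,\Delta t_m},w_{\mathcal T_m,\Delta t_m})$ be the corresponding discrete solutions. Then there are a subsequence and a weak solution $(u,v,w)$ on $[0,T]$ such that, along the subsequence, $u_{\mathcal T_m,\Delta t_m}$, $v_{\mathcal T_m,\Delta t_m}$ and $w_{\mathcal T_m,\Delta t_m}$ converge weakly-$*$ to $u$, $v$ and $w$ in $L^\infty(0,T;L^2(0,\alpha))$, $L^\infty(0,T;L^2(\alpha,\beta))$ and $L^\infty(0,T;L^2(\beta,L))$ respectively (as duals of $L^1(0,T;L^2)$). -/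

import Mathlib

open MeasureTheory Set Filter Topology
open scoped ContDiff

noncomputable section

namespace KelvinVoigt

/-! ### Function spaces on an interval -/

/-- The space `L²(a, b)`. -/
abbrev L2 (a b : ℝ) : Type := Lp ℝ 2 (volume.restrict (Ioo a b))

/-- `g` is the weak derivative of `f` on `(a, b)`; thus `f ∈ H¹(a, b)` iff such a `g ∈ L²(a, b)`
exists. -/
def IsWeakDeriv (a b : ℝ) (f g : L2 a b) : Prop :=
  ∀ φ : ℝ → ℝ, ContDiff ℝ ∞ φ → HasCompactSupport φ → tsupport φ ⊆ Ioo a b →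
    ∫ x in Ioo a b, f x * deriv φ x = -∫ x in Ioo a b, g x * φ x

/-- The continuous representative of `f` on `[a, b]` exists and takes the value `c` at `y`. -/
def HasTrace (a b : ℝ) (f : L2 a b) (y c : ℝ) : Prop :=
  ∃ g : ℝ → ℝ, ContinuousOn g (Icc a b) ∧ (∀ᵐ x ∂(volume.restrict (Ioo a b)), f x = g x) ∧ g y = c

/-- `U'` is the weak derivative on `(0, T)` of the vector-valued function `U`. -/
def IsWeakTimeDeriv {E : Type*} [NormedAddCommGroup E] [NormedSpace ℝ E]
    (T : ℝ) (U U' : ℝ → E) : Prop :=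
  ∀ φ : ℝ → ℝ, ContDiff ℝ ∞ φ → HasCompactSupport φ → tsupport φ ⊆ Ioo 0 T →
    ∫ t in Ioo 0 T, deriv φ t • U t = -∫ t in Ioo 0 T, φ t • U' t

/-! ### The transmission problem -/

/-- The data of the problem: the interfaces `0 < α < β < L`, the wave speeds on the three
subintervals, and the Kelvin-Voigt damping constant on `(α, β)`. -/
structure Problem where
  α : ℝ
  β : ℝ
  L : ℝ
  C₁ : ℝ
  C₂ : ℝ
  C₃ : ℝ
  δ : ℝ
  α_pos : 0 < α
  α_lt_β : α < β
  β_lt_L : β < L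
  C₁_pos : 0 < C₁
  C₂_pos : 0 < C₂
  C₃_pos : 0 < C₃
  δ_pos : 0 < δ

namespace Problem

variable (D : Problem)

/-- `𝕃² = L²(0, α) × L²(α, β) × L²(β, L)`. -/
abbrev L2Triple : Type := L2 0 D.α × L2 D.α D.β × L2 D.β D.L

/-- `G = (u_x, v_x, w_x)` in the weak sense, for `U = (u, v, w)`. -/
def HasGradient (U G : D.L2Triple) : Prop :=
  IsWeakDeriv 0 D.α U.1 G.1 ∧ IsWeakDeriv D.α D.β U.2.1 G.2.1 ∧ IsWeakDeriv D.β D.L U.2.2 G.2.2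

/-- `U ∈ ℍ¹ = H¹(0, α) × H¹(α, β) × H¹(β, L)`. -/
def MemH1 (U : D.L2Triple) : Prop := ∃ G : D.L2Triple, D.HasGradient U G

/-- `u(0) = 0`, `u(α) = v(α)`, `v(β) = w(β)` and `w(L) = 0`, for `U = (u, v, w)`. -/
def BoundaryTransmission (U : D.L2Triple) : Prop :=
  HasTrace 0 D.α U.1 0 0 ∧
  (∃ c : ℝ, HasTrace 0 D.α U.1 D.α c ∧ HasTrace D.α D.β U.2.1 D.α c) ∧
  (∃ c : ℝ, HasTrace D.α D.β U.2.1 D.β c ∧ HasTrace D.β D.L U.2.2 D.β c) ∧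
  HasTrace D.β D.L U.2.2 D.L 0

/-- `U ∈ ℍ¹_L`. -/
def MemH1L (U : D.L2Triple) : Prop := D.MemH1 U ∧ D.BoundaryTransmission U

/-- `U ∈ L²(0, T; ℍ¹_L)` with space gradient `Ux` and with time derivative `Ut ∈ L²(0, T; 𝕃²)`.
Such a `U` has exactly one representative which is continuous from `[0, T]` to `𝕃²`, and `U` is
taken to be this representative, so that its values at `t = 0` and `t = T` have a meaning. -/
structure InEnergySpace (T : ℝ) (U Ux Ut : ℝ → D.L2Triple) : Prop where
  continuousOn : ContinuousOn U (Icc 0 T)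
  memLp : MemLp U 2 (volume.restrict (Ioo 0 T))
  memLp_grad : MemLp Ux 2 (volume.restrict (Ioo 0 T))
  memLp_time : MemLp Ut 2 (volume.restrict (Ioo 0 T))
  memH1L : ∀ᵐ t ∂(volume.restrict (Ioo 0 T)), D.MemH1L (U t)
  grad : ∀ᵐ t ∂(volume.restrict (Ioo 0 T)), D.HasGradient (U t) (Ux t)
  time : IsWeakTimeDeriv T U Ut

/-- `U = (u, v, w)` is a weak solution on `[0, T]` with initial position `Φ = (φ, η, γ)` and initial
velocity `Ψ = (ψ, ζ, θ)`. Here `Vtx` is `v_{tx} ∈ L²(0, T; L²(α, β))`, `P = (p, q, z)` is the test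
function, and `inner ℝ f g` is `∫ f g dx` over the subinterval in question. -/
def IsWeakSolution (T : ℝ) (Φ Ψ : D.L2Triple) (U : ℝ → D.L2Triple) : Prop :=
  ∃ (Ux Ut : ℝ → D.L2Triple) (Vtx : ℝ → L2 D.α D.β),
    D.InEnergySpace T U Ux Ut ∧
    MemLp Vtx 2 (volume.restrict (Ioo 0 T)) ∧
    (∀ᵐ t ∂(volume.restrict (Ioo 0 T)), IsWeakDeriv D.α D.β (Ut t).2.1 (Vtx t)) ∧
    U 0 = Φ ∧
    ∀ P Px Pt : ℝ → D.L2Triple, D.InEnergySpace T P Px Pt → P T = 0 →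
      - (∫ t in Ioo 0 T, inner ℝ (Ut t).1 (Pt t).1)
        + D.C₁ ^ 2 * (∫ t in Ioo 0 T, inner ℝ (Ux t).1 (Px t).1)
        - inner ℝ Ψ.1 (P 0).1
      - (∫ t in Ioo 0 T, inner ℝ (Ut t).2.1 (Pt t).2.1)
        + D.C₂ ^ 2 * (∫ t in Ioo 0 T, inner ℝ (Ux t).2.1 (Px t).2.1)
        + D.δ * (∫ t in Ioo 0 T, inner ℝ (Vtx t) (Px t).2.1)
        - inner ℝ Ψ.2.1 (P 0).2.1
      - (∫ t in Ioo 0 T, inner ℝ (Ut t).2.2 (Pt t).2.2)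
        + D.C₃ ^ 2 * (∫ t in Ioo 0 T, inner ℝ (Ux t).2.2 (Px t).2.2)
        - inner ℝ Ψ.2.2 (P 0).2.2 = 0

end Problem

/-! ### The mesh -/

/-- The numbers of control volumes in `(0, α)`, `(α, β)` and `(β, L)`; each of the three
subintervals is divided uniformly. -/
structure Mesh where
  Nα : ℕ
  N : ℕ
  Nβ : ℕ
  Nα_pos : 0 < Nα
  N_pos : 0 < N
  Nβ_pos : 0 < Nβ

namespace Mesh

variable (M : Mesh) (D : Problem)

/-- The number of control volumes. -/
def Nmax : ℕ := M.Nα + M.N + M.Nβ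

/-- `h_α`. -/
def hα : ℝ := D.α / M.Nα

/-- `h`. -/
def h : ℝ := (D.β - D.α) / M.N

/-- `h_β`. -/
def hβ : ℝ := (D.L - D.β) / M.Nβ

/-- `edge i` is `x_{i+1/2}`, for `0 ≤ i ≤ Nmax`. -/
def edge (i : ℕ) : ℝ :=
  if i ≤ M.Nα then i * M.hα D
  else if i ≤ M.Nα + M.N then D.α + ((i : ℝ) - M.Nα) * M.h D
  else D.β + ((i : ℝ) - M.Nα - M.N) * M.hβ D

/-- The control volume `K_i = (x_{i-1/2}, x_{i+1/2})`, for `1 ≤ i ≤ Nmax`. -/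
def cell (i : ℕ) : Set ℝ := Ioo (M.edge D (i - 1)) (M.edge D i)

/-- `h_i = x_{i+1/2} - x_{i-1/2}`, for `1 ≤ i ≤ Nmax`. -/
def cellSize (i : ℕ) : ℝ := M.edge D i - M.edge D (i - 1)

/-- `x_i`: the midpoint of `K_i` for `1 ≤ i ≤ Nmax`, and `x_0 = 0`, `x_{Nmax+1} = L`. -/
def center (i : ℕ) : ℝ :=
  if i = 0 then 0
  else if i ≤ M.Nmax then (M.edge D (i - 1) + M.edge D i) / 2
  else D.L

lemma cells_nonempty : (Finset.Icc 1 M.Nmax).Nonempty := by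
  have := M.N_pos
  exact Finset.nonempty_Icc.mpr (by unfold Nmax; omega)

/-- The mesh size `max_i h_i`. -/
def size : ℝ := (Finset.Icc 1 M.Nmax).sup' M.cells_nonempty (M.cellSize D)

/-- The discrete speed `c_i` (with `c_0 = C₁`). -/
def speed (i : ℕ) : ℝ :=
  if i ≤ M.Nα then D.C₁ else if i ≤ M.Nα + M.N then D.C₂ else D.C₃

/-- `ell i` is `ℓ_{i+1/2}`, for `0 ≤ i ≤ Nmax`. -/
def ell (i : ℕ) : ℝ :=
  if i = M.Nα then
    2 * D.C₁ ^ 2 * D.C₂ ^ 2 / (D.C₁ ^ 2 * M.h D + D.C₂ ^ 2 * M.hα D)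
  else if i = M.Nα + M.N then
    2 * D.C₂ ^ 2 * D.C₃ ^ 2 / (D.C₃ ^ 2 * M.h D + D.C₂ ^ 2 * M.hβ D)
  else M.speed D i ^ 2 / (M.center D (i + 1) - M.center D i)

/-- `ℓ_{i+1/2} (V_{i+1} - V_i) - ℓ_{i-1/2} (V_i - V_{i-1})`. -/
def diffusion (V : ℕ → ℝ) (i : ℕ) : ℝ :=
  M.ell D i * (V (i + 1) - V i) - M.ell D (i - 1) * (V i - V (i - 1))

/-- The coefficient `δ / h` of the viscous flux at `x_{i+1/2}`; this flux is present only at the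
points `x_{i+1/2}` inside `(α, β)`, that is for `Nα + 1 ≤ i ≤ Nα + N - 1`. -/
def viscosity (i : ℕ) : ℝ :=
  if M.Nα + 1 ≤ i ∧ i < M.Nα + M.N then D.δ / M.h D else 0

/-- `δ [(V_{i+1} - V_i) / h - (V_i - V_{i-1}) / h]`, where the first term is dropped for
`i = Nα + N`, the second one for `i = Nα + 1`, and both outside `(α, β)`. -/
def damping (V : ℕ → ℝ) (i : ℕ) : ℝ :=
  M.viscosity D i * (V (i + 1) - V i) - M.viscosity D (i - 1) * (V i - V (i - 1))

/-- The mean value over `K_i` of `F = (f, g, k)`, for `1 ≤ i ≤ Nmax`, and `0` for other `i`. -/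
def cellMean (F : D.L2Triple) (i : ℕ) : ℝ :=
  if i = 0 then 0
  else if i ≤ M.Nα then (∫ x in M.cell D i, F.1 x) / M.cellSize D i
  else if i ≤ M.Nα + M.N then (∫ x in M.cell D i, F.2.1 x) / M.cellSize D i
  else if i ≤ M.Nmax then (∫ x in M.cell D i, F.2.2 x) / M.cellSize D i
  else 0

/-! ### The implicit scheme -/

/-- `U n i = U_i^n` (`0 ≤ n ≤ 𝒩`, `0 ≤ i ≤ Nmax + 1`) solves the implicit scheme on `[0, T]` with
time step `Δt = T / 𝒩` and initial data `Φ`, `Ψ`. The equation `first` is the scheme at `n = 0`, in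
which the ghost value `U^{-1} = U^1 - 2 Δt Ψ_𝒯` has been substituted. -/
structure IsDiscreteSolution (T : ℝ) (𝒩 : ℕ) (Φ Ψ : D.L2Triple) (U : ℕ → ℕ → ℝ) : Prop where
  left : ∀ n ≤ 𝒩, U n 0 = 0
  right : ∀ n ≤ 𝒩, U n (M.Nmax + 1) = 0
  init : ∀ i ∈ Finset.Icc 1 M.Nmax, U 0 i = M.cellMean D Φ i
  first : ∀ i ∈ Finset.Icc 1 M.Nmax,
    2 * M.cellSize D i * ((U 1 i - U 0 i) / (T / 𝒩) ^ 2)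
      - 2 * M.cellSize D i / (T / 𝒩) * M.cellMean D Ψ i
      - M.diffusion D (U 1) i
      + T / 𝒩 * M.diffusion D (M.cellMean D Ψ) i
    = M.damping D (M.cellMean D Ψ) i
  step : ∀ n : ℕ, 1 ≤ n → n < 𝒩 → ∀ i ∈ Finset.Icc 1 M.Nmax,
    M.cellSize D i * ((U (n + 1) i - 2 * U n i + U (n - 1) i) / (T / 𝒩) ^ 2)
      - 1 / 2 * M.diffusion D (U (n + 1)) i
      - 1 / 2 * M.diffusion D (U (n - 1)) i
    = 1 / (2 * (T / 𝒩)) * (M.damping D (U (n + 1)) i - M.damping D (U (n - 1)) i)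

/-- The reconstruction `U_{𝒯,Δt}(x, t)`: it is `U_i^n` for `t ∈ [t_n, t_{n+1})`, `x ∈ K_i`, where
`t_n = n Δt` and `Δt = T / 𝒩`. Its restrictions to `x` in `(0, α)`, `(α, β)` and `(β, L)` are
`u_{𝒯,Δt}`, `v_{𝒯,Δt}` and `w_{𝒯,Δt}`. -/
def reconstruction (T : ℝ) (𝒩 : ℕ) (U : ℕ → ℕ → ℝ) (t x : ℝ) : ℝ :=
  ∑ n ∈ Finset.range 𝒩, ∑ i ∈ Finset.Icc 1 M.Nmax,
    (Ico (n * (T / 𝒩)) ((n + 1) * (T / 𝒩))).indicator 1 t * (M.cell D i).indicator 1 x * U n i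

end Mesh

/-- Weak-* convergence in `L^∞(0, T; L²(a, b))`, the dual of `L¹(0, T; L²(a, b))`, of the functions
`(t, x) ↦ f m t x` to `u`. -/
def WeakStarTendsto (T a b : ℝ) (f : ℕ → ℝ → ℝ → ℝ) (u : ℝ → L2 a b) : Prop :=
  MemLp u ⊤ (volume.restrict (Ioo 0 T)) ∧
  ∀ g : ℝ → L2 a b, Integrable g (volume.restrict (Ioo 0 T)) →
    Tendsto (fun m => ∫ t in Ioo 0 T, ∫ x in Ioo a b, f m t x * g t x) atTop
      (𝓝 (∫ t in Ioo 0 T, ∫ x in Ioo a b, u t x * g t x))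

end KelvinVoigt

end

namespace KelvinVoigt

/-! ### Weak compactness in a separable Hilbert space -/

/-! The proof is a compactness argument: an energy bound uniform in the mesh and the time step, weak
limits of velocity, elastic flux and viscous flux, and an identification of these limits.

Energy. Write `τ` for the time step and `m`, `b`, `a` for the forms of mass, diffusion and damping.
Tested with a vector `W` vanishing at both ends, a step of the scheme is `2 m(U_{n+2} - 2 U_{n+1} +
U_n, W) + τ² b(U_{n+2} + U_n, W) + τ a(U_{n+2} - U_n, W) = 0`, and `W = U_{n+2} - U_n` gives a
telescoping energy. The obstacle is the initial velocity `Ψ`. It is only piecewise `H¹`: its jumps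
at `α`, `β` and its values at `0`, `L` can make `b(Ψ, Ψ)` blow up under refinement, and since `τ`
and the mesh size are unrelated, `τ² b(Ψ, Ψ)` need not stay bounded. Two devices repair this. By
`exists_memH10_near` the jumps are smoothed in layers of width of order `τ²` lying outside `(α, β)`,
so `Ψ = p + r` with `p ∈ H¹₀(0, L)`, `‖p'‖ = O(1/τ)`, `‖r‖ = O(τ)`, and `r` not seen by the damping.
In `energy_estimate` the vectors `τ χ_n r` with `χ = 0, 1, 0, -1, …` are subtracted from `U_n`.
Because `χ_{n+2} = -χ_n`, the sum `U_{n+2} + U_n`, which is all that the diffusion sees, does not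
change; `r` survives only as a source of size `O(τ²)` in the inertial term, absorbed by
`discrete_gronwall`. What is bounded is therefore `b(U_{n+2} + U_n, U_{n+2} + U_n)` and not the
elastic energy of each `U_n`.

Space. All functions are glued to functions on the line, so that `ℍ¹_L` becomes `H¹₀(0, L)`
(`memH10_glue`). Edge fluxes are interpolated affinely. By `sum_flux_mul_cellAvg` the discrete
equation tested with cell averages of `p ∈ H¹₀` is then exactly an equation in `L²` tested with
`p'`, without consistency error. Consistency is used only to recognize the limits of the fluxes. It
rests on `edgeWeight_mul_ell`: the coefficient `ℓ` at an edge is the inverse of the integral of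
`1/c²` over the adjacent half cells, so the trapezoidal rule for the flux against `φ / c²` returns
the jumps of the discrete solution (`abs_sum_flux_add_le`).

Time. Velocities are interpolated affinely and fluxes are kept piecewise constant; after integration
by parts in time the scheme is an exact identity against every admissible test function
(`integral_inner_eq_of_scheme`), linear in the weakly convergent quantities. Position is the
primitive of the limit velocity, and the discrete solution converges weakly to it at every time
(`tendsto_inner_position`). This gives weak-* convergence by dominated convergence, and it
identifies the limit fluxes as `c² U_x` and `δ v_{tx}`. -/

theorem exists_weakly_convergent_subseq {H : Type*} [NormedAddCommGroup H] [InnerProductSpace ℝ H]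
    [CompleteSpace H] [TopologicalSpace.SeparableSpace H] (x : ℕ → H) (C : ℝ)
    (hx : ∀ n, ‖x n‖ ≤ C) :
    ∃ σ : ℕ → ℕ, StrictMono σ ∧ ∃ y : H, ∀ z : H,
      Tendsto (fun k => inner ℝ (x (σ k)) z) atTop (𝓝 (inner ℝ y z)) := by
  have hc := WeakDual.isSeqCompact_closedBall ℝ H (0 : StrongDual ℝ H) C
  let ξ : ℕ → WeakDual ℝ H := fun n =>
    StrongDual.toWeakDual (InnerProductSpace.toDual ℝ H (x n))
  have hξ : ∀ n, ξ n ∈ WeakDual.toStrongDual ⁻¹' Metric.closedBall (0 : StrongDual ℝ H) C := by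
    intro n
    have : ‖InnerProductSpace.toDual ℝ H (x n)‖ ≤ C := by
      rw [LinearIsometryEquiv.norm_map]; exact hx n
    simpa [ξ] using this
  obtain ⟨y, -, σ, hσ, hlim⟩ := hc hξ
  refine ⟨σ, hσ, (InnerProductSpace.toDual ℝ H).symm (WeakDual.toStrongDual y), fun z => ?_⟩
  have h1 := ((WeakDual.eval_continuous z).tendsto y).comp hlim
  have h2 : inner ℝ ((InnerProductSpace.toDual ℝ H).symm (WeakDual.toStrongDual y)) z = y z := by
    rw [InnerProductSpace.toDual_symm_apply]; rfl
  rw [h2]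
  exact h1

/-! ### Primitives of integrable functions -/

/-- A primitive of an integrable function is absolutely continuous with the expected derivative
almost everywhere, so the product rule integrates. This is the only integration by parts used, in
space and in time alike. -/
theorem integral_mul_add_integral_deriv_mul {a b : ℝ} (hab : a ≤ b) {q p φ φ' : ℝ → ℝ}
    (hq : IntervalIntegrable q volume a b) (hp : ∀ x ∈ Icc a b, p x = p a + ∫ s in a..x, q s)
    (hφ : ∀ x, HasDerivAt φ (φ' x) x) (hφ' : Continuous φ') :
    (∫ x in a..b, φ x * q x) + ∫ x in a..b, φ' x * p x = φ b * p b - φ a * p a := by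
  have hac : AbsolutelyContinuousOnInterval (fun x => p a + ∫ s in a..x, q s) a b := by
    have h1 := hq.absolutelyContinuousOnInterval_intervalIntegral (c := a) (by simp)
    have h2 : AbsolutelyContinuousOnInterval (fun _ : ℝ => p a) a b :=
      (LipschitzWith.const (p a)).lipschitzOnWith.absolutelyContinuousOnInterval (K := 0)
    exact h2.fun_add h1
  have hφd : deriv φ = φ' := funext fun x => (hφ x).deriv
  have hφac : AbsolutelyContinuousOnInterval φ a b := by
    have : ContDiff ℝ 1 φ := by
      rw [contDiff_one_iff_deriv]
      exact ⟨fun x => (hφ x).differentiableAt, by rw [hφd]; exact hφ'⟩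
    exact ContDiffOn.absolutelyContinuousOnInterval this.contDiffOn
  have key := hφac.integral_mul_deriv_eq_deriv_mul hac
  have e1 : ∫ x in a..b, φ x * deriv (fun x => p a + ∫ s in a..x, q s) x
      = ∫ x in a..b, φ x * q x := by
    apply intervalIntegral.integral_congr_ae
    filter_upwards [hq.ae_hasDerivAt_integral] with x hx hx'
    have := (hx (uIoc_subset_uIcc hx') a (by simp)).const_add (p a)
    rw [this.deriv]
  have e2 : ∫ x in a..b, deriv φ x * (p a + ∫ s in a..x, q s) = ∫ x in a..b, φ' x * p x := by
    apply intervalIntegral.integral_congr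
    intro x hx
    rw [uIcc_of_le hab] at hx
    simp only [hφd]
    rw [hp x hx]
  rw [e1, e2] at key
  rw [key, hp b ⟨hab, le_rfl⟩]
  simp

/-- Lebesgue differentiation: both primitives are differentiable almost everywhere, and they agree
near each interior point. -/
theorem ae_eq_of_forall_integral_eq {a b : ℝ} {f g : ℝ → ℝ}
    (hf : IntervalIntegrable f volume a b) (hg : IntervalIntegrable g volume a b)
    (h : ∀ t ∈ Icc a b, ∫ s in a..t, f s = ∫ s in a..t, g s) :
    ∀ᵐ t ∂(volume.restrict (Ioo a b)), f t = g t := by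
  rw [ae_restrict_iff' measurableSet_Ioo]
  filter_upwards [hf.ae_hasDerivAt_integral, hg.ae_hasDerivAt_integral] with x h1 h2 hx
  have hx' : x ∈ uIcc a b := by
    rw [uIcc_of_le (hx.1.trans hx.2).le]; exact Ioo_subset_Icc_self hx
  have d1 := h1 hx' a (by simp)
  have d2 := h2 hx' a (by simp)
  refine d1.unique (d2.congr_of_eventuallyEq ?_)
  filter_upwards [Icc_mem_nhds hx.1 hx.2] with t ht using h t ht

theorem exists_contDiff_hasCompactSupport_primitive {a b : ℝ} {ψ : ℝ → ℝ}
    (hψ : ContDiff ℝ ∞ ψ) (hc : HasCompactSupport ψ) (hs : tsupport ψ ⊆ Ioo a b)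
    (h0 : ∫ x in Ioo a b, ψ x = 0) :
    ∃ φ : ℝ → ℝ, ContDiff ℝ ∞ φ ∧ HasCompactSupport φ ∧ tsupport φ ⊆ Ioo a b ∧ deriv φ = ψ := by
  have hcont := hψ.continuous
  -- The endpoints of the support are taken as its infimum and supremum, which requires a nonempty
  -- support.
  by_cases hne : (tsupport ψ).Nonempty
  swap
  · rw [not_nonempty_iff_eq_empty, tsupport_eq_empty_iff] at hne
    refine ⟨0, contDiff_const, HasCompactSupport.zero, by simp, ?_⟩
    rw [hne]; ext x; simp
  have hK : IsCompact (tsupport ψ) := hc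
  set c := sInf (tsupport ψ)
  set d := sSup (tsupport ψ)
  have hcK : c ∈ tsupport ψ := hK.sInf_mem hne
  have hdK : d ∈ tsupport ψ := hK.sSup_mem hne
  have hsub : tsupport ψ ⊆ Icc c d := fun x hx =>
    ⟨csInf_le hK.bddBelow hx, le_csSup hK.bddAbove hx⟩
  have hcd : c ≤ d := (hsub hcK).2
  have hz : ∀ x, x ∉ Icc c d → ψ x = 0 := fun x hx =>
    image_eq_zero_of_notMem_tsupport fun h => hx (hsub h)
  have hII : ∀ u v : ℝ, IntervalIntegrable ψ volume u v := fun u v => hcont.intervalIntegrable u v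
  have hab : a ≤ b := ((hs hcK).1.trans (hs hcK).2).le
  set φ : ℝ → ℝ := fun x => ∫ s in a..x, ψ s
  have hder : ∀ x, HasDerivAt φ (ψ x) x := fun x =>
    intervalIntegral.integral_hasDerivAt_right (hII _ _)
      hcont.aestronglyMeasurable.stronglyMeasurableAtFilter hcont.continuousAt
  have hd : deriv φ = ψ := funext fun x => (hder x).deriv
  have hφ0 : ∀ x, x ∉ Icc c d → φ x = 0 := by
    intro x hx
    rcases lt_or_ge x c with h | h
    · have : ∫ s in a..x, ψ s = ∫ s in a..x, (0 : ℝ) := by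
        apply intervalIntegral.integral_congr
        intro s hs'
        apply hz
        intro hcd'
        rcases le_total a x with hax | hax
        · rw [uIcc_of_le hax] at hs'; linarith [hs'.2, hcd'.1]
        · rw [uIcc_of_ge hax] at hs'; linarith [hs'.2, hcd'.1, (hs hcK).1]
      simp only [φ]; rw [this]; simp
    · have hdx : d < x := by
        by_contra hh
        exact hx ⟨h, not_lt.mp hh⟩
      have h1 : ∫ s in a..b, ψ s = 0 := by
        rw [intervalIntegral.integral_of_le hab, integral_Ioc_eq_integral_Ioo, h0]
      have h2 : ∫ s in b..x, ψ s = ∫ s in b..x, (0 : ℝ) := by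
        apply intervalIntegral.integral_congr
        intro s hs'
        apply hz
        intro hcd'
        rcases le_total b x with hax | hax
        · rw [uIcc_of_le hax] at hs'; linarith [hs'.1, hcd'.2, (hs hdK).2]
        · rw [uIcc_of_ge hax] at hs'; linarith [hs'.1, hcd'.2]
      have h3 := intervalIntegral.integral_add_adjacent_intervals (hII a b) (hII b x)
      simp only [φ]; rw [← h3, h1, h2]; simp
  have hsupp : tsupport φ ⊆ Icc c d := by
    apply closure_minimal _ isClosed_Icc
    intro x hx
    by_contra h
    exact hx (hφ0 x h)
  refine ⟨φ, ?_, ?_, ?_, hd⟩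
  · rw [contDiff_infty_iff_deriv]
    exact ⟨fun x => (hder x).differentiableAt, by rw [hd]; exact hψ⟩
  · exact HasCompactSupport.of_support_subset_isCompact isCompact_Icc
      ((subset_tsupport φ).trans hsupp)
  · exact hsupp.trans fun x hx => ⟨(hs hcK).1.trans_le hx.1, hx.2.trans_lt (hs hdK).2⟩

/-- The lemma of du Bois-Reymond. A test function is the derivative of a test function once its mean
is zero, which a multiple of a fixed bump arranges; the constant is the average of `F` weighted by
that bump. -/
theorem exists_ae_eq_const_of_integral_mul_deriv_eq_zero {a b : ℝ} (hab : a < b) {F : ℝ → ℝ}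
    (hF : IntegrableOn F (Ioo a b))
    (h : ∀ φ : ℝ → ℝ, ContDiff ℝ ∞ φ → HasCompactSupport φ → tsupport φ ⊆ Ioo a b →
      ∫ x in Ioo a b, F x * deriv φ x = 0) :
    ∃ c : ℝ, ∀ᵐ x ∂(volume.restrict (Ioo a b)), F x = c := by
  obtain ⟨m, hm⟩ : (Ioo a b).Nonempty := nonempty_Ioo.mpr hab
  obtain ⟨η0, hη0s, hη0c, hη0d, hη0r, hη0m⟩ :=
    exists_contDiff_tsupport_subset (n := ⊤) (Ioo_mem_nhds hm.1 hm.2)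
  have hint : ∀ g : ℝ → ℝ, Continuous g → IntegrableOn g (Ioo a b) := fun g hg =>
    (hg.continuousOn.integrableOn_compact isCompact_Icc).mono_set Ioo_subset_Icc_self
  have hFint : ∀ g : ℝ → ℝ, Continuous g → IntegrableOn (fun x => F x * g x) (Ioo a b) :=
    fun g hg => by
      have := ((integrableOn_Icc_iff_integrableOn_Ioo (μ := volume)).mpr hF).mul_continuousOn
        (hg.continuousOn (s := Icc a b)) isCompact_Icc
      exact this.mono_set Ioo_subset_Icc_self
  set I := ∫ x in Ioo a b, η0 x with hI
  have hIpos : 0 < I := by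
    rw [hI, ← integral_Ioc_eq_integral_Ioo, ← intervalIntegral.integral_of_le hab.le]
    apply intervalIntegral.integral_pos hab hη0d.continuous.continuousOn
    · intro x _; exact (hη0r ⟨x, rfl⟩).1
    · exact ⟨m, Ioo_subset_Icc_self hm, by rw [hη0m]; exact one_pos⟩
  set c0 := (∫ x in Ioo a b, F x * η0 x) / I
  have hloc : LocallyIntegrableOn (fun x => F x - c0) (Ioo a b) :=
    (hF.sub (hint (fun _ => c0) continuous_const)).locallyIntegrableOn
  have hae := isOpen_Ioo.ae_eq_zero_of_integral_contDiff_smul_eq_zero (μ := volume) hloc (by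
    intro ψ hψ hψc hψs
    set κ := (∫ x in Ioo a b, ψ x) / I
    have hζ : ContDiff ℝ ∞ (fun x => ψ x - κ * η0 x) := hψ.sub (contDiff_const.mul hη0d)
    have hts : tsupport (fun x => ψ x - κ * η0 x) ⊆ tsupport ψ ∪ tsupport η0 := by
      apply closure_minimal _ ((isClosed_tsupport ψ).union (isClosed_tsupport η0))
      intro x hx
      by_contra hh
      rw [mem_union, not_or] at hh
      apply hx
      simp [image_eq_zero_of_notMem_tsupport hh.1, image_eq_zero_of_notMem_tsupport hh.2]
    have hcs : HasCompactSupport (fun x => ψ x - κ * η0 x) :=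
      HasCompactSupport.of_support_subset_isCompact (hψc.isCompact.union hη0c.isCompact)
        ((subset_tsupport _).trans hts)
    obtain ⟨φ, h1, h2, h3, h4⟩ := exists_contDiff_hasCompactSupport_primitive hζ hcs
      (hts.trans (union_subset hψs hη0s)) (by
        rw [integral_sub (hint _ hψ.continuous) ((hint _ hη0d.continuous).const_mul κ),
          integral_const_mul, ← hI]
        simp only [κ]; field_simp; ring)
    have key := h φ h1 h2 h3
    rw [h4] at key
    have e : ∀ x, F x * (ψ x - κ * η0 x) = F x * ψ x - κ * (F x * η0 x) := fun x => by ring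
    simp only [e] at key
    rw [integral_sub (hFint _ hψ.continuous) ((hFint _ hη0d.continuous).const_mul κ),
      integral_const_mul] at key
    have hz : ∀ x, x ∉ Ioo a b → ψ x • (F x - c0) = 0 := fun x hx => by
      rw [image_eq_zero_of_notMem_tsupport fun hh => hx (hψs hh)]; simp
    rw [← setIntegral_eq_integral_of_forall_compl_eq_zero hz]
    have e' : ∀ x, ψ x • (F x - c0) = F x * ψ x - c0 * ψ x := fun x => by
      rw [smul_eq_mul]; ring
    simp only [e']
    rw [integral_sub (hFint _ hψ.continuous) ((hint _ hψ.continuous).const_mul c0),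
      integral_const_mul, ← key]
    simp only [κ, c0]; ring)
  refine ⟨c0, ?_⟩
  rw [ae_restrict_iff' measurableSet_Ioo]
  filter_upwards [hae] with x hx hx'
  linarith [hx hx']

theorem eqOn_Icc_of_ae_eq {a b : ℝ} (hab : a < b) {f g : ℝ → ℝ} (hf : ContinuousOn f (Icc a b))
    (hg : ContinuousOn g (Icc a b)) (h : ∀ᵐ x ∂(volume.restrict (Ioo a b)), f x = g x) :
    EqOn f g (Icc a b) :=
  (MeasureTheory.Measure.eqOn_open_of_ae_eq h isOpen_Ioo (hf.mono Ioo_subset_Icc_self)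
    (hg.mono Ioo_subset_Icc_self)).of_subset_closure hf hg Ioo_subset_Icc_self
    (closure_Ioo hab.ne).ge

theorem continuousOn_primitive_of_intervalIntegrable {a b : ℝ} (hab : a ≤ b) {g : ℝ → ℝ}
    (hg : IntervalIntegrable g volume a b) :
    ContinuousOn (fun x => ∫ s in a..x, g s) (Icc a b) := by
  have := intervalIntegral.continuousOn_primitive_interval (a := a) (b := b) (f := g) (μ := volume)
    (by rw [uIcc_of_le hab, integrableOn_Icc_iff_integrableOn_Ioc]; exact hg.1)
  rwa [uIcc_of_le hab] at this

/-- A function with an integrable weak derivative is a primitive of this derivative. -/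
theorem exists_ae_eq_add_integral_of_weakDeriv {a b : ℝ} (hab : a < b) {f g : ℝ → ℝ}
    (hf : IntegrableOn f (Ioo a b)) (hg : IntervalIntegrable g volume a b)
    (h : ∀ φ : ℝ → ℝ, ContDiff ℝ ∞ φ → HasCompactSupport φ → tsupport φ ⊆ Ioo a b →
      ∫ x in Ioo a b, f x * deriv φ x = -∫ x in Ioo a b, g x * φ x) :
    ∃ c : ℝ, ∀ᵐ x ∂(volume.restrict (Ioo a b)), f x = c + ∫ s in a..x, g s := by
  have hprim := continuousOn_primitive_of_intervalIntegrable hab.le hg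
  obtain ⟨c, hc⟩ := exists_ae_eq_const_of_integral_mul_deriv_eq_zero hab
    (F := fun x => f x - ∫ s in a..x, g s)
    (hf.sub ((hprim.integrableOn_compact isCompact_Icc).mono_set Ioo_subset_Icc_self)) (by
      intro φ h1 h2 h3
      have hd : Continuous (deriv φ) := h1.continuous_deriv (by simp)
      have e := integral_mul_add_integral_deriv_mul hab.le (q := g) (φ := φ) (φ' := deriv φ)
        (p := fun x => ∫ s in a..x, g s) hg (by intro x _; simp)
        (fun x => (h1.differentiable (by simp) x).hasDerivAt) hd
      have z : ∀ y, y ∉ Ioo a b → φ y = 0 := fun y hy =>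
        image_eq_zero_of_notMem_tsupport fun hh => hy (h3 hh)
      rw [z a (by simp), z b (by simp)] at e
      simp only [intervalIntegral.integral_of_le hab.le, integral_Ioc_eq_integral_Ioo] at e
      have h4 := h φ h1 h2 h3
      have i1 : IntegrableOn (fun x => f x * deriv φ x) (Ioo a b) := by
        have := ((integrableOn_Icc_iff_integrableOn_Ioo (μ := volume)).mpr hf).mul_continuousOn
          (hd.continuousOn (s := Icc a b)) isCompact_Icc
        exact this.mono_set Ioo_subset_Icc_self
      have i2 : IntegrableOn (fun x => (∫ s in a..x, g s) * deriv φ x) (Ioo a b) :=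
        ((hprim.mul hd.continuousOn).integrableOn_compact isCompact_Icc).mono_set
          Ioo_subset_Icc_self
      simp only [sub_mul]
      rw [integral_sub i1 i2, h4]
      have c1 : ∫ x in Ioo a b, g x * φ x = ∫ x in Ioo a b, φ x * g x :=
        integral_congr_ae (by filter_upwards with x; ring)
      have c2 : ∫ x in Ioo a b, (∫ s in a..x, g s) * deriv φ x
          = ∫ x in Ioo a b, deriv φ x * ∫ s in a..x, g s :=
        integral_congr_ae (by filter_upwards with x; ring)
      rw [c1, c2]
      linarith)
  refine ⟨c, ?_⟩
  filter_upwards [hc] with x hx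
  linarith

/-- The continuous representative of a function with an integrable weak derivative is a primitive
of this derivative. -/
theorem eq_add_integral_of_weakDeriv {a b : ℝ} (hab : a < b) {f g : ℝ → ℝ}
    (hf : ContinuousOn f (Icc a b)) (hg : IntervalIntegrable g volume a b)
    (h : ∀ φ : ℝ → ℝ, ContDiff ℝ ∞ φ → HasCompactSupport φ → tsupport φ ⊆ Ioo a b →
      ∫ x in Ioo a b, f x * deriv φ x = -∫ x in Ioo a b, g x * φ x) :
    ∀ x ∈ Icc a b, f x = f a + ∫ s in a..x, g s := by
  obtain ⟨c, hc⟩ := exists_ae_eq_add_integral_of_weakDeriv hab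
    ((hf.integrableOn_compact isCompact_Icc).mono_set Ioo_subset_Icc_self) hg h
  have key := eqOn_Icc_of_ae_eq hab hf
    (continuousOn_const.add (continuousOn_primitive_of_intervalIntegrable hab.le hg)) hc
  intro x hx
  have h1 : f x = c + ∫ s in a..x, g s := key hx
  have h2 : f a = c + ∫ s in a..a, g s := key (left_mem_Icc.mpr hab.le)
  rw [intervalIntegral.integral_same, add_zero] at h2
  rw [h1, h2]

end KelvinVoigt

noncomputable section

namespace KelvinVoigt

/-! ### An abstract energy estimate for the implicit scheme -/

section Energy

variable {V : Type*} [AddCommGroup V] [Module ℝ V]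

/-- A symmetric positive semidefinite bilinear form. -/
structure IsSymmNonneg (B : LinearMap.BilinForm ℝ V) : Prop where
  symm : ∀ x y, B x y = B y x
  nonneg : ∀ x, 0 ≤ B x x

namespace IsSymmNonneg

variable {B : LinearMap.BilinForm ℝ V} (hB : IsSymmNonneg B)
include hB

theorem two_mul_le (x y : V) {s : ℝ} (hs : 0 < s) : 2 * B x y ≤ s * B x x + s⁻¹ * B y y := by
  have h := hB.nonneg (s • x - y)
  simp only [map_sub, map_smul, LinearMap.sub_apply, LinearMap.smul_apply, smul_eq_mul,
    hB.symm y x] at h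
  have h2 : 0 ≤ s⁻¹ * (s * (s * B x x) - s * B x y - (s * B x y - B y y)) :=
    mul_nonneg (inv_nonneg.mpr hs.le) (by linarith)
  have h3 : s⁻¹ * (s * (s * B x x) - s * B x y - (s * B x y - B y y))
      = s * B x x - 2 * B x y + s⁻¹ * B y y := by
    field_simp; ring
  linarith

theorem neg_two_mul_le (x y : V) {s : ℝ} (hs : 0 < s) :
    -(2 * B x y) ≤ s * B x x + s⁻¹ * B y y := by
  have := hB.two_mul_le (-x) y hs
  simp only [map_neg, LinearMap.neg_apply, neg_neg] at this
  linarith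

theorem add_le (x y : V) : B (x + y) (x + y) ≤ 2 * B x x + 2 * B y y := by
  have := hB.two_mul_le x y one_pos
  simp only [map_add, LinearMap.add_apply, hB.symm y x]
  linarith

theorem add_add_le (x y z : V) :
    B (x + y + z) (x + y + z) ≤ 3 * B x x + 3 * B y y + 3 * B z z := by
  have h1 := hB.two_mul_le x y one_pos
  have h2 := hB.two_mul_le x z one_pos
  have h3 := hB.two_mul_le y z one_pos
  simp only [map_add, LinearMap.add_apply, hB.symm y x, hB.symm z x, hB.symm z y]
  linarith

omit hB in
theorem _root_.KelvinVoigt.bilin_smul_self (B : LinearMap.BilinForm ℝ V) (c : ℝ) (x : V) :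
    B (c • x) (c • x) = c ^ 2 * B x x := by
  simp only [map_smul, LinearMap.smul_apply, smul_eq_mul]; ring

end IsSymmNonneg

/-- Sum the inequalities and bound each energy on the right by the largest one, `E p`. Since `N θ ≤
1/4`, the right side contains at most `E p / 2`; taking `n = p` absorbs it and bounds `E p`, which
is put back for the other `n`. -/
theorem discrete_gronwall {N : ℕ} (hN : 0 < N) {E A : ℕ → ℝ} {c θ : ℝ} (hE : ∀ n, 0 ≤ E n)
    (hA : ∀ n, 0 ≤ A n) (hc : 0 ≤ c) (hθ : 0 ≤ θ) (hNθ : N * θ ≤ 1 / 4)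
    (h : ∀ n, n + 1 < N → E (n + 1) + A n ≤ E n + c + θ * (E (n + 1) + E n)) :
    ∀ n < N, E n + ∑ k ∈ Finset.range n, A k ≤ 2 * (E 0 + N * c) := by
  obtain ⟨p, hp, hmax⟩ := Finset.exists_max_image (Finset.range N) E ⟨0, by simpa using hN⟩
  rw [Finset.mem_range] at hp
  have key : ∀ n < N, E n + ∑ k ∈ Finset.range n, A k ≤ E 0 + n * (c + 2 * θ * E p) := by
    intro n
    induction n with
    | zero => intro _; simp
    | succ n ih =>
      intro hn
      have h1 := ih (by omega)
      have h2 := h n hn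
      have h3 : E n ≤ E p := hmax n (Finset.mem_range.mpr (by omega))
      have h4 : E (n + 1) ≤ E p := hmax (n + 1) (Finset.mem_range.mpr hn)
      have h5 : θ * (E (n + 1) + E n) ≤ θ * (2 * E p) :=
        mul_le_mul_of_nonneg_left (by linarith) hθ
      rw [Finset.sum_range_succ]
      push_cast
      linarith
  have key2 : ∀ n < N, E n + ∑ k ∈ Finset.range n, A k ≤ E 0 + N * c + 1 / 2 * E p := by
    intro n hn
    have h1 := key n hn
    have hnN : (n : ℝ) ≤ N := by exact_mod_cast hn.le
    have h2 : (n : ℝ) * (c + 2 * θ * E p) ≤ N * (c + 2 * θ * E p) :=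
      mul_le_mul_of_nonneg_right hnN
        (add_nonneg hc (mul_nonneg (mul_nonneg two_pos.le hθ) (hE p)))
    have h3 : (N * θ) * (2 * E p) ≤ 1 / 4 * (2 * E p) :=
      mul_le_mul_of_nonneg_right hNθ (by linarith [hE p])
    linarith
  have h6 := key2 p hp
  have h7 : 0 ≤ ∑ k ∈ Finset.range p, A k := Finset.sum_nonneg fun k _ => hA k
  intro n hn
  have := key2 n hn
  linarith

/-- The sequence `0, 1, 0, -1, 0, 1, …`. -/
def alternating : ℕ → ℝ
  | 0 => 0
  | 1 => 1
  | n + 2 => -alternating n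

theorem alternating_sq_add_sq (n : ℕ) : alternating (n + 1) ^ 2 + alternating n ^ 2 = 1 := by
  induction n with
  | zero => simp [alternating]
  | succ n ih => simp only [alternating] at ih ⊢; linarith

theorem abs_alternating_le_one (n : ℕ) : |alternating n| ≤ 1 := by
  rw [abs_le_one_iff_mul_self_le_one]
  nlinarith [alternating_sq_add_sq n, sq_nonneg (alternating (n + 1))]

/-- The constant in the energy estimate. -/
def energyBound (T K κ : ℝ) : ℝ :=
  16 * (K * (13 + 6 * κ + 3 * T ^ 2) + 8 * T ^ 2 * K) + 4 * K * T ^ 2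

/-- Here `e` is the deviation of the first difference quotient from `Ψ`, and the equation is the
first step tested with it. After division by `τ`, Young's inequality puts both cross terms under
half of `τ² b(e, e)`, the damping one through `a ≤ κ b`. No bound on `b(Ψ, Ψ)` enters. -/
theorem energy_first_step {m b a : LinearMap.BilinForm ℝ V} (hm : IsSymmNonneg m)
    (hb : IsSymmNonneg b) (ha : IsSymmNonneg a) {κ τ K : ℝ} (hκ : 0 < κ) (hτ : 0 < τ)
    (hab : ∀ v, a v v ≤ κ * b v v) {U0 Ψ e : V}
    (hU0 : b U0 U0 ≤ K) (hΨ : a Ψ Ψ ≤ K)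
    (h : 2 * m (τ • e) e + τ ^ 2 * b (U0 + τ • e) e + τ ^ 2 * a Ψ e = 0) :
    m e e ≤ (1 + κ) * K ∧ τ ^ 2 * b e e ≤ 2 * (1 + κ) * K := by
  simp only [map_smul, map_add, LinearMap.smul_apply, LinearMap.add_apply, smul_eq_mul] at h
  have h0 : 2 * m e e + τ * b U0 e + τ ^ 2 * b e e + τ * a Ψ e = 0 := by
    have : τ * (2 * m e e + τ * b U0 e + τ ^ 2 * b e e + τ * a Ψ e) = 0 := by linarith
    exact (mul_eq_zero.mp this).resolve_left hτ.ne'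
  have h1 := hb.neg_two_mul_le U0 (τ • e) (s := 2) two_pos
  have h2 := ha.neg_two_mul_le Ψ (τ • e) (s := 2 * κ) (by linarith)
  rw [bilin_smul_self] at h1 h2
  simp only [map_smul, smul_eq_mul] at h1 h2
  have h3 : (2 * κ)⁻¹ * (τ ^ 2 * a e e) ≤ (2 * κ)⁻¹ * (τ ^ 2 * (κ * b e e)) := by
    gcongr; exact hab e
  have h4 : (2 * κ)⁻¹ * (τ ^ 2 * (κ * b e e)) = 1 / 2 * (τ ^ 2 * b e e) := by
    field_simp
  have h5 : κ * a Ψ Ψ ≤ κ * K := mul_le_mul_of_nonneg_left hΨ hκ.le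
  have hme := hm.nonneg e
  have hbe := mul_nonneg (sq_nonneg τ) (hb.nonneg e)
  constructor <;> linarith

-- The vector `r` is the part of `Ψ` carrying its jumps: small in mass and invisible to the damping,
-- but with elastic energy that is not assumed bounded. The equation propagates it through `U_{n+2}
-- + U_n`, where it cancels if it changes sign every two steps; removing such an oscillation leaves
-- vectors `G n` for which the usual energy argument works.
set_option maxHeartbeats 800000 in
theorem energy_estimate {m b a : LinearMap.BilinForm ℝ V} (hm : IsSymmNonneg m)
    (hb : IsSymmNonneg b) (ha : IsSymmNonneg a) {κ τ K T : ℝ} {N : ℕ} (hκ : 0 < κ) (hτ : 0 < τ)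
    (hN : 0 < N) (hNτ : N * τ = T) (hab : ∀ v, a v v ≤ κ * b v v)
    (S : Submodule ℝ V) {U : ℕ → V} {Ψ r : V}
    (hUS : ∀ n ≤ N, U n ∈ S) (hΨS : Ψ ∈ S) (hrS : r ∈ S)
    (hU0 : b (U 0) (U 0) ≤ K) (hmΨ : m Ψ Ψ ≤ K) (haΨ : a Ψ Ψ ≤ K) (hr : m r r ≤ K * τ ^ 2)
    (hΨr : τ ^ 2 * b (Ψ - r) (Ψ - r) ≤ K) (har : ∀ v, a r v = 0)
    (first : ∀ W ∈ S, 2 * m (U 1 - U 0 - τ • Ψ) W + τ ^ 2 * b (U 1 - τ • Ψ) W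
      + τ ^ 2 * a Ψ W = 0)
    (step : ∀ n, n + 1 < N → ∀ W ∈ S, 2 * m (U (n + 2) - (2 : ℝ) • U (n + 1) + U n) W
      + τ ^ 2 * b (U (n + 2) + U n) W + τ * a (U (n + 2) - U n) W = 0) :
    (∀ n < N, m (U (n + 1) - U n) (U (n + 1) - U n) ≤ energyBound T K κ * τ ^ 2) ∧
    b (U 1 - τ • Ψ) (U 1 - τ • Ψ) ≤ energyBound T K κ ∧
    (∀ n, n + 1 < N → b (U (n + 2) + U n) (U (n + 2) + U n) ≤ energyBound T K κ) ∧
    ∑ n ∈ Finset.range (N - 1), a (U (n + 2) - U n) (U (n + 2) - U n) ≤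
      energyBound T K κ * τ := by
  have hK : 0 ≤ K := (hm.nonneg Ψ).trans hmΨ
  have hT : 0 < T := by rw [← hNτ]; positivity
  have hτT : τ ≤ T := by
    rw [← hNτ]
    have : (1 : ℝ) ≤ N := by exact_mod_cast hN
    nlinarith
  -- The first step is tested with this `e` because `U 1 - τ • Ψ = U 0 + τ • e`, so that `Ψ`
  -- disappears from the elastic term.
  set e : V := τ⁻¹ • (U 1 - U 0) - Ψ with he
  have he1 : U 1 - U 0 - τ • Ψ = τ • e := by
    rw [he, smul_sub, smul_smul, mul_inv_cancel₀ hτ.ne', one_smul]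
  have he2 : U 1 - τ • Ψ = U 0 + τ • e := by rw [← he1]; abel
  have heS : e ∈ S := S.sub_mem (S.smul_mem _ (S.sub_mem (hUS 1 hN) (hUS 0 (by omega)))) hΨS
  have h1 := first e heS
  rw [he1, he2] at h1
  obtain ⟨hme, hbe⟩ := energy_first_step hm hb ha hκ hτ hab hU0 haΨ h1
  set χ := alternating
  -- With `χ (n + 2) = -χ n`, the sums over two steps are those of `U`. Starting from `χ 0 = 0`, `χ
  -- 1 = 1` leaves `U 0` alone and removes `τ • r` from `U 1`, so that `Ψ` enters `G 1` only as `Ψ -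
  -- r`.
  set G : ℕ → V := fun n => U n - (τ * χ n) • r with hG
  have hGS : ∀ n ≤ N, G n ∈ S := fun n hn => S.sub_mem (hUS n hn) (S.smul_mem _ hrS)
  have hG2 : ∀ n, G (n + 2) = U (n + 2) + (τ * χ n) • r := by
    intro n
    have : χ (n + 2) = -χ n := rfl
    simp only [hG, this]
    module
  have hsum : ∀ n, U (n + 2) + U n = G (n + 2) + G n := by
    intro n
    rw [hG2]; simp only [hG]; module
  have hsecond : ∀ n, U (n + 2) - (2 : ℝ) • U (n + 1) + U n
      = G (n + 2) - (2 : ℝ) • G (n + 1) + G n - (2 * τ * χ (n + 1)) • r := by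
    intro n
    rw [hG2]; simp only [hG]; module
  have hdiff : ∀ n, U (n + 2) - U n = G (n + 2) - G n - (2 * τ * χ n) • r := by
    intro n
    rw [hG2]; simp only [hG]; module
  have har' : ∀ v, a v r = 0 := fun v => by rw [ha.symm, har]
  set Δ : ℕ → V := fun n => G (n + 1) - G n with hΔ
  set E : ℕ → ℝ := fun n => m (Δ n) (Δ n) + τ ^ 2 / 2 * (b (G (n + 1)) (G (n + 1)) + b (G n) (G n))
    with hE
  set A : ℕ → ℝ := fun n => τ / 2 * a (U (n + 2) - U n) (U (n + 2) - U n) with hA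
  have hEn : ∀ n, 0 ≤ E n := fun n => by
    have := hm.nonneg (Δ n)
    have := hb.nonneg (G n)
    have := hb.nonneg (G (n + 1))
    simp only [hE]; positivity
  have hAn : ∀ n, 0 ≤ A n := fun n => mul_nonneg (by positivity) (ha.nonneg _)
  have hmE : ∀ n, m (Δ n) (Δ n) ≤ E n := fun n => by
    have := hb.nonneg (G n)
    have := hb.nonneg (G (n + 1))
    simp only [hE]
    have : 0 ≤ τ ^ 2 / 2 * (b (G (n + 1)) (G (n + 1)) + b (G n) (G n)) := by positivity
    linarith
  have hstep : ∀ n, n + 1 < N →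
      E (n + 1) + A n ≤ E n + 8 * T * K * τ ^ 3 + τ / (4 * T) * (E (n + 1) + E n) := by
    intro n hn
    have hs := step n hn (G (n + 2) - G n) (S.sub_mem (hGS _ (by omega)) (hGS _ (by omega)))
    -- The test vector is `G (n + 2) - G n = Δ (n + 1) + Δ n`: it telescopes the mass and elastic
    -- terms, and it differs from `U (n + 2) - U n` by a multiple of `r`, which `a` ignores. The
    -- right side is the second difference of the removed oscillation.
    have hid : E (n + 1) - E n + A n = 2 * τ * χ (n + 1) * m r (Δ (n + 1) + Δ n) := by
      rw [hsecond, hsum, hdiff] at hs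
      simp only [hE, hA, hΔ]
      rw [hdiff]
      simp only [map_sub, map_add, map_smul, LinearMap.sub_apply, LinearMap.add_apply,
        LinearMap.smul_apply, smul_eq_mul, har, har', mul_zero, sub_zero,
        hm.symm (G (n + 1)) (G n), hm.symm (G (n + 2)) (G n), hm.symm (G (n + 2)) (G (n + 1)),
        hb.symm (G (n + 2)) (G n), ha.symm (G (n + 2)) (G n)] at hs ⊢
      linarith
    have hx : ∀ v, 2 * τ * χ (n + 1) * m r v ≤ 4 * T * K * τ ^ 3 + τ / (4 * T) * m v v := by
      intro v
      -- The weight `4 T` makes the Gronwall factor `θ = τ / (4 T)`, so that `N θ = 1/4`.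
      have h1 := hm.two_mul_le r v (s := 4 * T) (by linarith)
      have h2 := hm.neg_two_mul_le r v (s := 4 * T) (by linarith)
      have h3 : |2 * m r v| ≤ 4 * T * m r r + (4 * T)⁻¹ * m v v := abs_le'.mpr ⟨h1, h2⟩
      have h4 : 2 * τ * χ (n + 1) * m r v ≤ τ * |2 * m r v| := by
        have : χ (n + 1) * (2 * m r v) ≤ |2 * m r v| := by
          refine (le_abs_self _).trans ?_
          rw [abs_mul]
          exact mul_le_of_le_one_left (abs_nonneg _) (abs_alternating_le_one _)
        have := mul_le_mul_of_nonneg_left this hτ.le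
        linarith
      have h5 : τ * |2 * m r v| ≤ τ * (4 * T * (K * τ ^ 2) + (4 * T)⁻¹ * m v v) := by
        gcongr
        refine h3.trans ?_
        gcongr
      have h6 : τ * (4 * T * (K * τ ^ 2) + (4 * T)⁻¹ * m v v)
          = 4 * T * K * τ ^ 3 + τ / (4 * T) * m v v := by
        field_simp
      linarith
    have h7 := hx (Δ (n + 1))
    have h8 := hx (Δ n)
    have h9 : 0 ≤ τ / (4 * T) := by positivity
    have h10 := mul_le_mul_of_nonneg_left (hmE (n + 1)) h9
    have h11 := mul_le_mul_of_nonneg_left (hmE n) h9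
    rw [map_add] at hid
    linarith
  have hgr := discrete_gronwall hN hEn hAn (c := 8 * T * K * τ ^ 3) (θ := τ / (4 * T))
    (by positivity) (by positivity) (by
      have : (N : ℝ) * (τ / (4 * T)) = (N * τ) / (4 * T) := by ring
      rw [this, hNτ]
      apply le_of_eq
      field_simp) hstep
  have hNc : (N : ℝ) * (8 * T * K * τ ^ 3) = 8 * T ^ 2 * K * τ ^ 2 := by
    have : (N : ℝ) * (8 * T * K * τ ^ 3) = (N * τ) * (8 * T * K * τ ^ 2) := by ring
    rw [this, hNτ]; ring
  rw [hNc] at hgr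
  have hG0 : G 0 = U 0 := by simp [hG, χ, alternating]
  -- Each of the three terms has bounded elastic energy: by the data, by the first step, and by the
  -- bound on `τ² b(Ψ - r, Ψ - r)`.
  have hG1 : G 1 = U 0 + τ • e + τ • (Ψ - r) := by
    simp only [hG, χ, alternating, mul_one]
    rw [← he2]; module
  have hΔ0 : Δ 0 = τ • (e + Ψ + (-r)) := by
    simp only [hΔ]
    rw [zero_add, hG0, hG1]; module
  have hE0 : E 0 ≤ K * (13 + 6 * κ + 3 * T ^ 2) * τ ^ 2 := by
    have c1 : m (Δ 0) (Δ 0) ≤ τ ^ 2 * (3 * ((1 + κ) * K) + 3 * K + 3 * (K * T ^ 2)) := by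
      rw [hΔ0, bilin_smul_self]
      have := hm.add_add_le e Ψ (-r)
      have e1 : m (-r) (-r) = m r r := by simp
      have : m r r ≤ K * T ^ 2 := hr.trans (by gcongr)
      gcongr
      linarith
    have c2 : b (G 1) (G 1) ≤ 3 * K + 3 * (2 * (1 + κ) * K) + 3 * K := by
      rw [hG1]
      have := hb.add_add_le (U 0) (τ • e) (τ • (Ψ - r))
      rw [bilin_smul_self, bilin_smul_self] at this
      linarith
    have c3 : τ ^ 2 / 2 * (b (G 1) (G 1) + b (G 0) (G 0)) ≤
        τ ^ 2 / 2 * (3 * K + 3 * (2 * (1 + κ) * K) + 3 * K + K) := by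
      rw [hG0]; gcongr
    have c4 : 0 ≤ K * τ ^ 2 := by positivity
    have c5 : E 0 = m (Δ 0) (Δ 0) + τ ^ 2 / 2 * (b (G 1) (G 1) + b (G 0) (G 0)) := rfl
    rw [c5]
    linarith
  set Q : ℝ := 2 * (K * (13 + 6 * κ + 3 * T ^ 2) + 8 * T ^ 2 * K) with hQ
  have hQ0 : 0 ≤ Q := by positivity
  have hCQ : energyBound T K κ = 8 * Q + 4 * K * T ^ 2 := by
    simp only [energyBound, hQ]; ring
  have hKT : 0 ≤ K * T ^ 2 := by positivity
  have hfin : ∀ n < N, E n + ∑ k ∈ Finset.range n, A k ≤ Q * τ ^ 2 := fun n hn =>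
    (hgr n hn).trans (by rw [hQ]; linarith)
  have hAs : ∀ n, 0 ≤ ∑ k ∈ Finset.range n, A k := fun n => Finset.sum_nonneg fun k _ => hAn k
  have hEQ : ∀ n < N, E n ≤ Q * τ ^ 2 := fun n hn => by linarith [hfin n hn, hAs n]
  have hτ2 : 0 < τ ^ 2 := by positivity
  refine ⟨?_, ?_, ?_, ?_⟩
  · intro n hn
    have e1 : U (n + 1) - U n = Δ n + (τ * (χ (n + 1) - χ n)) • r := by
      simp only [hΔ, hG]; module
    rw [e1]
    refine (hm.add_le _ _).trans ?_
    rw [bilin_smul_self]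
    have e2 : (χ (n + 1) - χ n) ^ 2 ≤ 2 := by
      have := alternating_sq_add_sq n
      change χ (n + 1) ^ 2 + χ n ^ 2 = 1 at this
      nlinarith [sq_nonneg (χ (n + 1) + χ n)]
    have e3 : (τ * (χ (n + 1) - χ n)) ^ 2 * m r r ≤ (τ ^ 2 * 2) * (K * T ^ 2) := by
      rw [mul_pow]
      have : m r r ≤ K * T ^ 2 := hr.trans (by gcongr)
      have := hm.nonneg r
      gcongr
    have e4 := (hmE n).trans (hEQ n hn)
    have e5 : 0 ≤ Q * τ ^ 2 := by positivity
    rw [hCQ]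
    linarith
  · rw [he2]
    have := hb.add_le (U 0) (τ • e)
    rw [bilin_smul_self] at this
    rw [hCQ, hQ]
    have : 0 ≤ κ * K := by positivity
    have : 0 ≤ T ^ 2 * K := by positivity
    linarith
  · intro n hn
    rw [hsum]
    refine (hb.add_le _ _).trans ?_
    have h1 := hEQ (n + 1) hn
    have h2 := hEQ n (by omega)
    -- The energies are of order `τ²`, and so is the factor in front of their elastic part; division
    -- by `τ²` leaves a bound independent of `τ`.
    have k1 : τ ^ 2 * b (G (n + 2)) (G (n + 2)) ≤ τ ^ 2 * (2 * Q) := by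
      have := mul_nonneg hτ2.le (hb.nonneg (G (n + 1)))
      have := hm.nonneg (Δ (n + 1))
      simp only [hE] at h1
      linarith
    have k2 : τ ^ 2 * b (G n) (G n) ≤ τ ^ 2 * (2 * Q) := by
      have := mul_nonneg hτ2.le (hb.nonneg (G (n + 1)))
      have := hm.nonneg (Δ n)
      simp only [hE] at h2
      linarith
    have k3 := le_of_mul_le_mul_left k1 hτ2
    have k4 := le_of_mul_le_mul_left k2 hτ2
    rw [hCQ]
    linarith
  · have h1 := hfin (N - 1) (by omega)
    have h2 := hEn (N - 1)
    simp only [hA, ← Finset.mul_sum] at h1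
    set σ := ∑ n ∈ Finset.range (N - 1), a (U (n + 2) - U n) (U (n + 2) - U n)
    have h3 : τ * σ ≤ τ * (2 * Q * τ) := by
      have : τ * (2 * Q * τ) = 2 * (Q * τ ^ 2) := by ring
      rw [this]; linarith
    have h4 := le_of_mul_le_mul_left h3 hτ
    rw [hCQ]
    have : 0 ≤ (6 * Q + 4 * (K * T ^ 2)) * τ := by positivity
    linarith

end Energy

/-! ### Piecewise constant and piecewise affine functions on a partition -/

/-- The space `L²(ℝ)`. -/
abbrev LineL2 : Type := Lp ℝ 2 (volume : Measure ℝ)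

theorem LineL2.intervalIntegrable (g : LineL2) (a b : ℝ) : IntervalIntegrable g volume a b :=
  intervalIntegrable_iff.mpr ((((Lp.memLp g).locallyIntegrable (by norm_num)).integrableOn_isCompact
    isCompact_uIcc).mono_set uIoc_subset_uIcc)

theorem memLp_indicator_Ioo (a b : ℝ) (φ : C(ℝ, ℝ)) :
    MemLp ((Ioo a b).indicator φ) 2 (volume : Measure ℝ) := by
  rw [memLp_indicator_iff_restrict measurableSet_Ioo]
  have : MemLp φ 2 (volume.restrict (Icc a b)) := by
    obtain ⟨C, hC⟩ := isCompact_Icc.exists_bound_of_continuousOn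
      (φ.continuous.continuousOn (s := Icc a b))
    refine MemLp.of_bound φ.continuous.aestronglyMeasurable C ?_
    rw [ae_restrict_iff' measurableSet_Icc]
    exact ae_of_all _ hC
  exact this.mono_measure (Measure.restrict_mono Ioo_subset_Icc_self le_rfl)

/-- The element of `L²(ℝ)` which is `φ` on `(a, b)` and vanishes elsewhere. -/
def windowLp (a b : ℝ) : C(ℝ, ℝ) →ₗ[ℝ] LineL2 where
  toFun φ := (memLp_indicator_Ioo a b φ).toLp
  map_add' φ ψ := by
    rw [← MemLp.toLp_add]
    exact MemLp.toLp_congr _ _ (by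
      filter_upwards with x
      simp [indicator_apply, Pi.add_apply]
      split_ifs <;> simp)
  map_smul' c φ := by
    rw [RingHom.id_apply, ← MemLp.toLp_const_smul]
    exact MemLp.toLp_congr _ _ (by
      filter_upwards with x
      simp [indicator_apply, Pi.smul_apply])

theorem coeFn_windowLp (a b : ℝ) (φ : C(ℝ, ℝ)) :
    windowLp a b φ =ᵐ[volume] (Ioo a b).indicator φ := MemLp.coeFn_toLp (memLp_indicator_Ioo a b φ)

theorem inner_windowLp {a b : ℝ} (hab : a ≤ b) (φ : C(ℝ, ℝ)) (g : LineL2) :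
    inner ℝ (windowLp a b φ) g = ∫ s in a..b, φ s * g s := by
  rw [L2.inner_def, intervalIntegral.integral_of_le hab, integral_Ioc_eq_integral_Ioo,
    ← integral_indicator measurableSet_Ioo]
  apply integral_congr_ae
  filter_upwards [coeFn_windowLp a b φ] with x hx
  rw [hx]
  by_cases h : x ∈ Ioo a b
  · simp [h, mul_comm]
  · simp [h]

theorem inner_windowLp_of_subset {a b c d : ℝ} (hcd : c ≤ d) (hac : a ≤ c) (hdb : d ≤ b)
    (φ ψ : C(ℝ, ℝ)) :
    inner ℝ (windowLp c d φ) (windowLp a b ψ) = ∫ s in c..d, φ s * ψ s := by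
  rw [inner_windowLp hcd, intervalIntegral.integral_of_le hcd,
    intervalIntegral.integral_of_le hcd, integral_Ioc_eq_integral_Ioo,
    integral_Ioc_eq_integral_Ioo]
  apply setIntegral_congr_ae measurableSet_Ioo
  filter_upwards [coeFn_windowLp a b ψ] with x hx hx'
  rw [hx, indicator_of_mem (Ioo_subset_Ioo hac hdb hx')]

theorem inner_windowLp_of_disjoint {a b c d : ℝ} (hcd : c ≤ d) (h : d ≤ a ∨ b ≤ c)
    (φ ψ : C(ℝ, ℝ)) : inner ℝ (windowLp c d φ) (windowLp a b ψ) = 0 := by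
  rw [inner_windowLp hcd, intervalIntegral.integral_of_le hcd, integral_Ioc_eq_integral_Ioo,
    ← integral_zero ℝ ℝ (μ := volume.restrict (Ioo c d))]
  apply setIntegral_congr_ae measurableSet_Ioo
  filter_upwards [coeFn_windowLp a b ψ] with x hx hx'
  rw [hx, indicator_of_notMem, mul_zero]
  rintro ⟨h1, h2⟩
  rcases h with h | h <;> linarith [hx'.1, hx'.2]

theorem norm_windowLp_one_sq {a b : ℝ} (hab : a ≤ b) : ‖windowLp a b 1‖ ^ 2 = b - a := by
  rw [← real_inner_self_eq_norm_sq, inner_windowLp_of_subset hab le_rfl le_rfl]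
  simp

theorem abs_integral_le_sqrt_mul_norm {a b : ℝ} (hab : a ≤ b) (g : LineL2) :
    |∫ s in a..b, g s| ≤ √(b - a) * ‖g‖ := by
  have h1 := abs_real_inner_le_norm (windowLp a b 1) g
  rw [inner_windowLp hab] at h1
  have h2 : ‖windowLp a b 1‖ = √(b - a) := by
    rw [← norm_windowLp_one_sq hab, Real.sqrt_sq (norm_nonneg _)]
  rw [h2] at h1
  simpa using h1

/-- The mean value of `g` over the `j`-th cell `(x j, x (j + 1))`. -/
def cellAvg (x : ℕ → ℝ) (g : ℝ → ℝ) (j : ℕ) : ℝ :=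
  (∫ s in x j..x (j + 1), g s) / (x (j + 1) - x j)

/-- The function equal to `V (j + 1)` on the cell `(x j, x (j + 1))`. -/
def stepLp (x : ℕ → ℝ) (M : ℕ) : (ℕ → ℝ) →ₗ[ℝ] LineL2 :=
  ∑ j ∈ Finset.range M,
    (LinearMap.proj (j + 1) : (ℕ → ℝ) →ₗ[ℝ] ℝ).smulRight (windowLp (x j) (x (j + 1)) 1)

theorem stepLp_apply (x : ℕ → ℝ) (M : ℕ) (V : ℕ → ℝ) :
    stepLp x M V = ∑ j ∈ Finset.range M, V (j + 1) • windowLp (x j) (x (j + 1)) 1 := by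
  simp [stepLp, LinearMap.sum_apply]

/-- The function on the cell `(x j, x (j + 1))` decreasing linearly from `1` to `0`. -/
def leftHat (x : ℕ → ℝ) (j : ℕ) : C(ℝ, ℝ) :=
  ⟨fun s => (x (j + 1) - s) / (x (j + 1) - x j), by fun_prop⟩

/-- The function on the cell `(x j, x (j + 1))` increasing linearly from `0` to `1`. -/
def rightHat (x : ℕ → ℝ) (j : ℕ) : C(ℝ, ℝ) :=
  ⟨fun s => (s - x j) / (x (j + 1) - x j), by fun_prop⟩

/-- The piecewise affine interpolation of the values `f j` at `x j`. -/
def affineLp (x : ℕ → ℝ) (M : ℕ) : (ℕ → ℝ) →ₗ[ℝ] LineL2 :=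
  ∑ j ∈ Finset.range M,
    ((LinearMap.proj j : (ℕ → ℝ) →ₗ[ℝ] ℝ).smulRight (windowLp (x j) (x (j + 1)) (leftHat x j)) +
      (LinearMap.proj (j + 1) : (ℕ → ℝ) →ₗ[ℝ] ℝ).smulRight
        (windowLp (x j) (x (j + 1)) (rightHat x j)))

theorem affineLp_apply (x : ℕ → ℝ) (M : ℕ) (f : ℕ → ℝ) :
    affineLp x M f = ∑ j ∈ Finset.range M,
      windowLp (x j) (x (j + 1)) (f j • leftHat x j + f (j + 1) • rightHat x j) := by
  simp [affineLp, LinearMap.sum_apply]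

section Partition

variable {x : ℕ → ℝ} (hx : StrictMono x) (M : ℕ)
include hx

theorem inner_stepLp (V : ℕ → ℝ) (g : LineL2) :
    inner ℝ (stepLp x M V) g =
      ∑ j ∈ Finset.range M, V (j + 1) * ∫ s in x j..x (j + 1), g s := by
  rw [stepLp_apply, sum_inner]
  refine Finset.sum_congr rfl fun j _ => ?_
  rw [real_inner_smul_left, inner_windowLp (hx j.lt_succ_self).le]
  simp

theorem inner_stepLp_cellAvg (V : ℕ → ℝ) (g : LineL2) :
    inner ℝ (stepLp x M V) g =
      ∑ j ∈ Finset.range M, (x (j + 1) - x j) * V (j + 1) * cellAvg x g j := by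
  rw [inner_stepLp hx]
  refine Finset.sum_congr rfl fun j _ => ?_
  have := sub_pos.mpr (hx j.lt_succ_self)
  rw [cellAvg]
  field_simp

theorem inner_windowLp_stepLp {j : ℕ} (hj : j < M) (φ : C(ℝ, ℝ)) (V : ℕ → ℝ) :
    inner ℝ (windowLp (x j) (x (j + 1)) φ) (stepLp x M V) =
      (∫ s in x j..x (j + 1), φ s) * V (j + 1) := by
  rw [stepLp_apply, inner_sum, Finset.sum_eq_single j]
  · rw [real_inner_smul_right, inner_windowLp_of_subset (hx j.lt_succ_self).le le_rfl le_rfl]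
    simp [mul_comm]
  · intro k _ hk
    rw [real_inner_smul_right, inner_windowLp_of_disjoint (hx j.lt_succ_self).le, mul_zero]
    rcases lt_or_gt_of_ne hk with h | h
    · right; exact hx.monotone h
    · left; exact hx.monotone h
  · intro h; exact absurd (Finset.mem_range.mpr hj) h

theorem inner_stepLp_stepLp (V W : ℕ → ℝ) :
    inner ℝ (stepLp x M V) (stepLp x M W) =
      ∑ j ∈ Finset.range M, (x (j + 1) - x j) * (V (j + 1) * W (j + 1)) := by
  conv_lhs => rw [stepLp_apply]
  rw [sum_inner]
  refine Finset.sum_congr rfl fun j hj => ?_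
  rw [real_inner_smul_left, inner_windowLp_stepLp hx M (Finset.mem_range.mp hj)]
  simp
  ring

theorem inner_affineLp (f : ℕ → ℝ) (g : LineL2) :
    inner ℝ (affineLp x M f) g = ∑ j ∈ Finset.range M,
      ∫ s in x j..x (j + 1), (f j * leftHat x j s + f (j + 1) * rightHat x j s) * g s := by
  rw [affineLp_apply, sum_inner]
  refine Finset.sum_congr rfl fun j _ => ?_
  rw [inner_windowLp (hx j.lt_succ_self).le]
  simp

theorem inner_affineLp_windowLp {p q : ℕ} (hq : q ≤ M) (f : ℕ → ℝ) (φ : C(ℝ, ℝ)) :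
    inner ℝ (affineLp x M f) (windowLp (x p) (x q) φ) = ∑ j ∈ Finset.Ico p q,
      ∫ s in x j..x (j + 1), (f j * leftHat x j s + f (j + 1) * rightHat x j s) * φ s := by
  rw [affineLp_apply, sum_inner]
  have hsub : Finset.Ico p q ⊆ Finset.range M := fun j hj => by
    rw [Finset.mem_Ico] at hj; rw [Finset.mem_range]; omega
  rw [← Finset.sum_subset hsub]
  · refine Finset.sum_congr rfl fun j hj => ?_
    rw [Finset.mem_Ico] at hj
    rw [inner_windowLp_of_subset (hx j.lt_succ_self).le (hx.monotone hj.1) (hx.monotone hj.2)]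
    simp
  · intro j _ hj
    rw [inner_windowLp_of_disjoint (hx j.lt_succ_self).le]
    rw [Finset.mem_Ico, not_and_or, not_le, not_lt] at hj
    rcases hj with h | h
    · left; exact hx.monotone h
    · right; exact hx.monotone h

/-- By convexity, the square of an affine function on a cell lies below the affine interpolation of
its squared end values, whose integral is given by the trapezoidal rule. -/
theorem norm_affineLp_sq_le (f : ℕ → ℝ) :
    ‖affineLp x M f‖ ^ 2 ≤
      ∑ j ∈ Finset.range M, (x (j + 1) - x j) / 2 * (f j ^ 2 + f (j + 1) ^ 2) := by
  rw [← real_inner_self_eq_norm_sq, affineLp_apply, sum_inner]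
  refine Finset.sum_le_sum fun j hj => ?_
  have hj' := sub_pos.mpr (hx j.lt_succ_self)
  rw [inner_sum, Finset.sum_eq_single j]
  · rw [inner_windowLp_of_subset (hx j.lt_succ_self).le le_rfl le_rfl]
    have hmono : ∫ s in x j..x (j + 1), ((f j • leftHat x j + f (j + 1) • rightHat x j) s *
        (f j • leftHat x j + f (j + 1) • rightHat x j) s) ≤
        ∫ s in x j..x (j + 1), (f j ^ 2 + (f (j + 1) ^ 2 - f j ^ 2) / (x (j + 1) - x j) *
          (s - x j)) := by
      apply intervalIntegral.integral_mono_on (hx j.lt_succ_self).le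
      · exact ((map_continuous _).mul (map_continuous _)).intervalIntegrable _ _
      · exact Continuous.intervalIntegrable (by fun_prop) _ _
      · intro s hs
        have e1 : leftHat x j s = 1 - rightHat x j s := by
          simp only [leftHat, rightHat, ContinuousMap.coe_mk]; field_simp; ring
        have e2 : (f (j + 1) ^ 2 - f j ^ 2) / (x (j + 1) - x j) * (s - x j) =
            (f (j + 1) ^ 2 - f j ^ 2) * rightHat x j s := by
          simp only [rightHat, ContinuousMap.coe_mk]; ring
        have e3 : 0 ≤ rightHat x j s := div_nonneg (sub_nonneg.mpr hs.1) hj'.le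
        have e4 : rightHat x j s ≤ 1 := by
          simp only [rightHat, ContinuousMap.coe_mk]
          rw [div_le_one hj']; linarith [hs.2]
        simp only [ContinuousMap.add_apply, ContinuousMap.smul_apply, smul_eq_mul]
        rw [e1, e2]
        nlinarith [mul_nonneg (mul_nonneg e3 (sub_nonneg.mpr e4)) (sq_nonneg (f (j + 1) - f j))]
    refine hmono.trans (le_of_eq ?_)
    rw [intervalIntegral.integral_add (by simp) (Continuous.intervalIntegrable (by fun_prop) _ _),
      intervalIntegral.integral_const_mul, intervalIntegral.integral_sub (by simp) (by simp)]
    simp only [intervalIntegral.integral_const, integral_id, smul_eq_mul]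
    field_simp
    ring
  · intro k _ hk
    rw [inner_windowLp_of_disjoint (hx j.lt_succ_self).le]
    rcases lt_or_gt_of_ne hk with h | h
    · right; exact hx.monotone h
    · left; exact hx.monotone h
  · intro h; exact absurd hj h

end Partition

/-! ### `H¹₀(0, L)` -/

/-- `f ∈ H¹₀(0, L)`, extended by zero, and `g` is its derivative in `(0, L)`. -/
structure MemH10 (L : ℝ) (f g : LineL2) : Prop where
  ae_eq : ∀ᵐ x ∂(volume : Measure ℝ), f x = (Ioo 0 L).indicator (fun x => ∫ s in 0..x, g s) x
  integral_eq_zero : ∫ s in 0..L, g s = 0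

theorem MemH10.integral_mul_eq {L a b : ℝ} {f g : LineL2} (h : MemH10 L f g) (ha : 0 ≤ a)
    (hab : a ≤ b) (hb : b ≤ L) (φ : ℝ → ℝ) :
    ∫ s in a..b, φ s * f s = ∫ s in a..b, φ s * ∫ r in 0..s, g r := by
  rw [intervalIntegral.integral_of_le hab, intervalIntegral.integral_of_le hab,
    integral_Ioc_eq_integral_Ioo, integral_Ioc_eq_integral_Ioo]
  apply setIntegral_congr_ae measurableSet_Ioo
  filter_upwards [h.ae_eq] with x hx hx'
  have : x ∈ Ioo 0 L := ⟨ha.trans_lt hx'.1, hx'.2.trans_le hb⟩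
  rw [hx, indicator_of_mem this]

/-- On a cell the difference of the edge fluxes is the slope of the interpolated flux times the
length, so each summand is the integral of slope times `p`. Integration by parts moves the
derivative to `p`, and the boundary terms telescope to the values of `p` at `0` and `L`, which
vanish. The identity is exact for every mesh. -/
theorem sum_flux_mul_cellAvg {x : ℕ → ℝ} (hx : StrictMono x) (M : ℕ) {L : ℝ} (hx0 : x 0 = 0)
    (hxM : x M = L) {p q : LineL2} (h : MemH10 L p q) (f : ℕ → ℝ) :
    ∑ j ∈ Finset.range M, (f (j + 1) - f j) * cellAvg x p j = -inner ℝ (affineLp x M f) q := by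
  set P : ℝ → ℝ := fun s => ∫ r in 0..s, q r with hP
  have hx0' : ∀ j, 0 ≤ x j := fun j => hx0 ▸ hx.monotone j.zero_le
  have cell : ∀ j ∈ Finset.range M,
      (f (j + 1) - f j) * cellAvg x p j = (f (j + 1) * P (x (j + 1)) - f j * P (x j)) -
      ∫ s in x j..x (j + 1), (f j * leftHat x j s + f (j + 1) * rightHat x j s) * q s := by
    intro j hj
    have hj' := sub_pos.mpr (hx j.lt_succ_self)
    have hle : x (j + 1) ≤ L := hxM ▸ hx.monotone (Finset.mem_range.mp hj)
    set c := (f (j + 1) - f j) / (x (j + 1) - x j) with hc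
    have e := integral_mul_add_integral_deriv_mul (hx j.lt_succ_self).le (q := q) (p := P)
      (φ := fun s => f j * leftHat x j s + f (j + 1) * rightHat x j s)
      (φ' := fun _ => c) (LineL2.intervalIntegrable q _ _) (by
        intro s hs
        exact (intervalIntegral.integral_add_adjacent_intervals
          (LineL2.intervalIntegrable q _ _) (LineL2.intervalIntegrable q _ _)).symm) (by
        intro s
        simp only [leftHat, rightHat, ContinuousMap.coe_mk]
        have h1 : HasDerivAt (fun s : ℝ => (x (j + 1) - s) / (x (j + 1) - x j))
            (-1 / (x (j + 1) - x j)) s := ((hasDerivAt_id s).const_sub _).div_const _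
        have h2 : HasDerivAt (fun s : ℝ => (s - x j) / (x (j + 1) - x j))
            (1 / (x (j + 1) - x j)) s := ((hasDerivAt_id s).sub_const _).div_const _
        convert! (h1.const_mul (f j)).add (h2.const_mul (f (j + 1))) using 1
        rw [hc]; ring) continuous_const
    have e1 : leftHat x j (x j) = 1 := by
      simp only [leftHat, ContinuousMap.coe_mk]; exact div_self hj'.ne'
    have e2 : rightHat x j (x (j + 1)) = 1 := by
      simp only [rightHat, ContinuousMap.coe_mk]; exact div_self hj'.ne'
    have e3 : leftHat x j (x (j + 1)) = 0 := by simp [leftHat]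
    have e4 : rightHat x j (x j) = 0 := by simp [rightHat]
    simp only [e1, e2, e3, e4, mul_one, mul_zero, zero_add, add_zero] at e
    have e5 : (f (j + 1) - f j) * cellAvg x p j = ∫ s in x j..x (j + 1), c * P s := by
      have := h.integral_mul_eq (hx0' j) (hx j.lt_succ_self).le hle (fun _ => 1)
      simp only [one_mul] at this
      rw [cellAvg, this, intervalIntegral.integral_const_mul, hc]
      ring
    rw [e5]
    linarith
  rw [Finset.sum_congr rfl cell, Finset.sum_sub_distrib, ← inner_affineLp hx,
    Finset.sum_range_sub (fun j => f j * P (x j))]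
  have h0 : P (x 0) = 0 := by simp [hP, hx0]
  have h1 : P (x M) = 0 := by rw [hxM]; exact h.integral_eq_zero
  simp [h0, h1]

/-- By Cauchy-Schwarz the oscillation of a primitive of `q` over a cell of length at most `δ` is at
most `√δ ‖q‖`, and this bounds its distance to the cell average. -/
theorem abs_inner_stepLp_cellAvg_sub_le {x : ℕ → ℝ} (hx : StrictMono x) (M : ℕ) {L : ℝ}
    (hx0 : x 0 = 0) (hxM : x M = L) {δ : ℝ} (hδ : ∀ j < M, x (j + 1) - x j ≤ δ)
    {p q : LineL2} (h : MemH10 L p q) {V : ℕ → ℝ} (hV : ∀ j < M, V (j + 1) = cellAvg x p j)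
    (e : LineL2) :
    |inner ℝ (stepLp x M V) e - inner ℝ p e| ≤ √δ * ‖q‖ * ∫ s in 0..L, |e s| := by
  set P : ℝ → ℝ := fun s => ∫ r in 0..s, q r with hP
  have hx0' : ∀ j, 0 ≤ x j := fun j => hx0 ▸ hx.monotone j.zero_le
  have hL : 0 ≤ L := hxM ▸ hx0' M
  have hII := fun a b => LineL2.intervalIntegrable q a b
  have hPc : Continuous P := intervalIntegral.continuous_primitive hII 0
  have hPe : ∀ a b, IntervalIntegrable (fun s => P s * e s) volume a b := fun a b =>
    (LineL2.intervalIntegrable e a b).continuousOn_mul hPc.continuousOn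
  have hpe : inner ℝ p e = ∑ j ∈ Finset.range M, ∫ s in x j..x (j + 1), P s * e s := by
    rw [intervalIntegral.sum_integral_adjacent_intervals fun j _ => hPe _ _, hx0, hxM,
      intervalIntegral.integral_of_le hL, integral_Ioc_eq_integral_Ioo,
      ← integral_indicator measurableSet_Ioo, L2.inner_def]
    apply integral_congr_ae
    filter_upwards [h.ae_eq] with s hs
    rw [hs]
    by_cases hh : s ∈ Ioo 0 L
    · simp [hh, hP, mul_comm]
    · simp [hh]
  have habs : IntervalIntegrable (fun s => |e s|) volume 0 L :=
    (LineL2.intervalIntegrable e 0 L).abs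
  have hsum : ∫ s in 0..L, |e s| = ∑ j ∈ Finset.range M, ∫ s in x j..x (j + 1), |e s| := by
    rw [intervalIntegral.sum_integral_adjacent_intervals fun j _ =>
      (LineL2.intervalIntegrable e _ _).abs, hx0, hxM]
  rw [inner_stepLp hx, hpe, hsum, ← Finset.sum_sub_distrib, Finset.mul_sum]
  refine (Finset.abs_sum_le_sum_abs _ _).trans (Finset.sum_le_sum fun j hj => ?_)
  rw [Finset.mem_range] at hj
  have hj' := sub_pos.mpr (hx j.lt_succ_self)
  have hle : x (j + 1) ≤ L := hxM ▸ hx.monotone hj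
  have hosc : ∀ s ∈ Icc (x j) (x (j + 1)), |V (j + 1) - P s| ≤ √δ * ‖q‖ := by
    intro s hs
    have hdiff : ∀ r ∈ Icc (x j) (x (j + 1)), |P r - P s| ≤ √δ * ‖q‖ := by
      intro r hr
      rcases le_total s r with hsr | hsr
      · have : P r - P s = ∫ u in s..r, q u :=
          intervalIntegral.integral_interval_sub_left (hII _ _) (hII _ _)
        rw [this]
        refine (abs_integral_le_sqrt_mul_norm hsr q).trans ?_
        gcongr
        linarith [hs.1, hr.2, hδ j hj]
      · have : P s - P r = ∫ u in r..s, q u :=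
          intervalIntegral.integral_interval_sub_left (hII _ _) (hII _ _)
        rw [abs_sub_comm, this]
        refine (abs_integral_le_sqrt_mul_norm hsr q).trans ?_
        gcongr
        linarith [hs.2, hr.1, hδ j hj]
    have e1 : V (j + 1) - P s = (∫ r in x j..x (j + 1), (P r - P s)) / (x (j + 1) - x j) := by
      have := h.integral_mul_eq (hx0' j) (hx j.lt_succ_self).le hle (fun _ => 1)
      simp only [one_mul] at this
      rw [hV j hj, cellAvg, this,
        intervalIntegral.integral_sub (hPc.intervalIntegrable _ _) (by simp)]
      simp only [intervalIntegral.integral_const, smul_eq_mul]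
      simp only [hP]
      field_simp
    rw [e1, abs_div, abs_of_pos hj', div_le_iff₀ hj']
    have := intervalIntegral.norm_integral_le_of_norm_le_const (a := x j) (b := x (j + 1))
      (f := fun r => P r - P s) (C := √δ * ‖q‖) (by
        intro r hr
        rw [uIoc_of_le (hx j.lt_succ_self).le] at hr
        exact hdiff r (Ioc_subset_Icc_self hr))
    rwa [Real.norm_eq_abs, abs_of_pos hj'] at this
  rw [← intervalIntegral.integral_const_mul, ← intervalIntegral.integral_sub
    ((LineL2.intervalIntegrable e _ _).const_mul _) (hPe _ _),
    ← intervalIntegral.integral_const_mul]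
  have := intervalIntegral.norm_integral_le_of_norm_le (μ := volume) (a := x j) (b := x (j + 1))
    (f := fun s => V (j + 1) * e s - P s * e s) (g := fun s => √δ * ‖q‖ * |e s|)
    (hx j.lt_succ_self).le (by
      filter_upwards with s hs
      rw [← sub_mul, norm_mul, Real.norm_eq_abs, Real.norm_eq_abs]
      exact mul_le_mul_of_nonneg_right (hosc s (Ioc_subset_Icc_self hs)) (abs_nonneg _))
    (((LineL2.intervalIntegrable e _ _).abs).const_mul _)
  exact this

/-! ### Consistency of the interpolation of fluxes -/

/-- Each hat function has integral half the cell length, so replacing `φ` by its value at the node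
of the hat produces the trapezoidal expression; the error is the oscillation of `φ` on the cell. -/
theorem abs_integral_hat_sub_le {x : ℕ → ℝ} (hx : StrictMono x) (j : ℕ) (φ : C(ℝ, ℝ)) {K : ℝ}
    (hφ : ∀ s t, |φ s - φ t| ≤ K * |s - t|) (u v : ℝ) :
    |(∫ s in x j..x (j + 1), (u * leftHat x j s + v * rightHat x j s) * φ s) -
      (x (j + 1) - x j) / 2 * (u * φ (x j) + v * φ (x (j + 1)))| ≤
      K * (x (j + 1) - x j) * ((x (j + 1) - x j) / 2 * (|u| + |v|)) := by
  have hj := sub_pos.mpr (hx j.lt_succ_self)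
  have hK : 0 ≤ K := by
    have := (abs_nonneg _).trans (hφ 1 0); simpa using this
  set h := x (j + 1) - x j with hh
  have il : ∫ s in x j..x (j + 1), leftHat x j s = h / 2 := by
    simp only [leftHat, ContinuousMap.coe_mk]
    rw [intervalIntegral.integral_div, intervalIntegral.integral_sub (by simp) (by simp)]
    simp only [intervalIntegral.integral_const, integral_id, smul_eq_mul]
    rw [div_eq_iff hj.ne', hh]; ring
  have ir : ∫ s in x j..x (j + 1), rightHat x j s = h / 2 := by
    simp only [rightHat, ContinuousMap.coe_mk]
    rw [intervalIntegral.integral_div, intervalIntegral.integral_sub (by simp) (by simp)]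
    simp only [intervalIntegral.integral_const, integral_id, smul_eq_mul]
    rw [div_eq_iff hj.ne', hh]; ring
  have ci : ∀ g : C(ℝ, ℝ), IntervalIntegrable (fun s => g s) volume (x j) (x (j + 1)) := fun g =>
    (map_continuous g).intervalIntegrable _ _
  have e : (∫ s in x j..x (j + 1), (u * leftHat x j s + v * rightHat x j s) * φ s) -
      h / 2 * (u * φ (x j) + v * φ (x (j + 1))) =
      ∫ s in x j..x (j + 1), (u * (leftHat x j s * (φ s - φ (x j))) +
        v * (rightHat x j s * (φ s - φ (x (j + 1))))) := by
    have h1 : ∀ s, u * (leftHat x j s * (φ s - φ (x j))) +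
        v * (rightHat x j s * (φ s - φ (x (j + 1)))) =
        (u * leftHat x j s + v * rightHat x j s) * φ s -
        (u * φ (x j) * leftHat x j s + v * φ (x (j + 1)) * rightHat x j s) := fun s => by ring
    simp only [h1]
    rw [intervalIntegral.integral_sub, intervalIntegral.integral_add,
      intervalIntegral.integral_const_mul, intervalIntegral.integral_const_mul, il, ir]
    · ring
    · exact (ci _).const_mul _
    · exact (ci _).const_mul _
    · exact Continuous.intervalIntegrable (by fun_prop) _ _
    · exact Continuous.intervalIntegrable (by fun_prop) _ _
  rw [e]
  have hbound := intervalIntegral.norm_integral_le_of_norm_le (μ := volume)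
    (a := x j) (b := x (j + 1))
    (f := fun s => u * (leftHat x j s * (φ s - φ (x j))) +
        v * (rightHat x j s * (φ s - φ (x (j + 1)))))
    (g := fun s => K * h * |u| * leftHat x j s + K * h * |v| * rightHat x j s)
    (hx j.lt_succ_self).le (by
      filter_upwards with s hs
      have l0 : 0 ≤ leftHat x j s := div_nonneg (by linarith [hs.2]) hj.le
      have r0 : 0 ≤ rightHat x j s := div_nonneg (by linarith [hs.1]) hj.le
      have b1 : |φ s - φ (x j)| ≤ K * h := (hφ _ _).trans (by
        gcongr; rw [abs_of_pos (by linarith [hs.1])]; linarith [hs.2])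
      have b2 : |φ s - φ (x (j + 1))| ≤ K * h := (hφ _ _).trans (by
        gcongr; rw [abs_of_nonpos (by linarith [hs.2])]; linarith [hs.1])
      refine (norm_add_le _ _).trans ?_
      simp only [norm_mul, Real.norm_eq_abs, abs_of_nonneg l0, abs_of_nonneg r0]
      have c1 : |u| * (leftHat x j s * |φ s - φ (x j)|) ≤ |u| * (leftHat x j s * (K * h)) := by
        gcongr
      have c2 : |v| * (rightHat x j s * |φ s - φ (x (j + 1))|) ≤
          |v| * (rightHat x j s * (K * h)) := by
        gcongr
      linarith)
    (Continuous.intervalIntegrable (by fun_prop) _ _)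
  rw [intervalIntegral.integral_add ((ci _).const_mul _) ((ci _).const_mul _),
    intervalIntegral.integral_const_mul, intervalIntegral.integral_const_mul, il, ir] at hbound
  rw [Real.norm_eq_abs] at hbound
  linarith

/-- The sum of the weights of the cells on both sides of the edge `i`. -/
def edgeWeight (w : ℕ → ℝ) (M i : ℕ) : ℝ :=
  (if i = 0 then 0 else w (i - 1)) + if i < M then w i else 0

theorem sum_cells_eq_sum_edges (w a : ℕ → ℝ) (M : ℕ) :
    ∑ j ∈ Finset.range M, w j * (a j + a (j + 1)) =
      ∑ i ∈ Finset.range (M + 1), edgeWeight w M i * a i := by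
  simp only [mul_add, Finset.sum_add_distrib, edgeWeight, add_mul]
  rw [add_comm]
  congr 1
  · rw [Finset.sum_range_succ']
    simp
  · rw [Finset.sum_range_succ]
    simp only [lt_irrefl, if_false, zero_mul, add_zero]
    exact Finset.sum_congr rfl fun j hj => by simp [Finset.mem_range.mp hj]

theorem sum_mul_diff_eq (φ V : ℕ → ℝ) (M : ℕ) (h0 : V 0 = 0) (h1 : V (M + 1) = 0) :
    ∑ i ∈ Finset.range (M + 1), φ i * (V (i + 1) - V i) =
      -∑ j ∈ Finset.range M, V (j + 1) * (φ (j + 1) - φ j) := by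
  have : ∀ m, ∑ i ∈ Finset.range (m + 1), φ i * (V (i + 1) - V i) +
      ∑ j ∈ Finset.range m, V (j + 1) * (φ (j + 1) - φ j) = φ m * V (m + 1) - φ 0 * V 0 := by
    intro m
    induction m with
    | zero => simp; ring
    | succ m ih =>
      rw [Finset.sum_range_succ, Finset.sum_range_succ (fun j => V (j + 1) * (φ (j + 1) - φ j))]
      linarith
  have := this M
  rw [h0, h1] at this
  linarith

theorem sum_diff_mul_eq (f V : ℕ → ℝ) (M : ℕ) (h0 : V 0 = 0) (h1 : V (M + 1) = 0) :
    ∑ j ∈ Finset.range M, (f (j + 1) - f j) * V (j + 1) =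
      -∑ i ∈ Finset.range (M + 1), f i * (V (i + 1) - V i) := by
  rw [sum_mul_diff_eq f V M h0 h1, neg_neg]
  exact Finset.sum_congr rfl fun j _ => by ring

theorem inner_stepLp_windowLp_deriv {x : ℕ → ℝ} (hx : StrictMono x) (M : ℕ) (V : ℕ → ℝ)
    {φ φ' : C(ℝ, ℝ)} (hφ : ∀ s, HasDerivAt φ (φ' s) s) :
    inner ℝ (stepLp x M V) (windowLp (x 0) (x M) φ') =
      ∑ j ∈ Finset.range M, V (j + 1) * (φ (x (j + 1)) - φ (x j)) := by
  rw [stepLp_apply, sum_inner]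
  refine Finset.sum_congr rfl fun j hj => ?_
  rw [real_inner_smul_left, inner_windowLp_of_subset (hx j.lt_succ_self).le
    (hx.monotone j.zero_le) (hx.monotone (Finset.mem_range.mp hj))]
  simp only [ContinuousMap.one_apply, one_mul]
  rw [intervalIntegral.integral_eq_sub_of_hasDerivAt (fun s _ => hφ s)
    (φ'.continuous.intervalIntegrable _ _)]

/-! ### Restriction and extension by zero -/

/-- The restriction `L²(ℝ) → L²(a, b)`. -/
def restrictLp (a b : ℝ) : LineL2 →L[ℝ] L2 a b := LpToLpRestrictCLM ℝ ℝ ℝ volume 2 (Ioo a b)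

theorem coeFn_restrictLp (a b : ℝ) (f : LineL2) :
    restrictLp a b f =ᵐ[volume.restrict (Ioo a b)] f := LpToLpRestrictCLM_coeFn ℝ (Ioo a b) f

/-- The extension by zero `L²(a, b) → L²(ℝ)`. -/
def extendLp (a b : ℝ) : L2 a b →L[ℝ] LineL2 := ContinuousLinearMap.adjoint (restrictLp a b)

theorem inner_extendLp (a b : ℝ) (f : L2 a b) (g : LineL2) :
    inner ℝ g (extendLp a b f) = inner ℝ (restrictLp a b g) f :=
  ContinuousLinearMap.adjoint_inner_right _ _ _

/-- The extension was defined as an adjoint; pairing it with an arbitrary function of `L²(ℝ)` shows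
which function it is. -/
theorem coeFn_extendLp (a b : ℝ) (f : L2 a b) :
    extendLp a b f =ᵐ[volume] (Ioo a b).indicator f := by
  have hmem : MemLp ((Ioo a b).indicator f) 2 (volume : Measure ℝ) := by
    rw [memLp_indicator_iff_restrict measurableSet_Ioo]; exact Lp.memLp f
  have : extendLp a b f = hmem.toLp := by
    refine ext_inner_left ℝ fun g => ?_
    rw [inner_extendLp, L2.inner_def, L2.inner_def, ← integral_indicator measurableSet_Ioo]
    apply integral_congr_ae
    have h1 := coeFn_restrictLp a b g
    rw [EventuallyEq, ae_restrict_iff' measurableSet_Ioo] at h1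
    filter_upwards [hmem.coeFn_toLp, h1] with x hx hx1
    rw [hx]
    by_cases h : x ∈ Ioo a b
    · simp [h, hx1 h]
    · simp [h]
  rw [this]
  exact hmem.coeFn_toLp

theorem integral_Ioo_mul_eq_inner (a b : ℝ) (f : ℝ → ℝ) (F : LineL2) (hF : F =ᵐ[volume] f)
    (g : L2 a b) : ∫ x in Ioo a b, f x * g x = inner ℝ (restrictLp a b F) g := by
  rw [L2.inner_def]
  apply integral_congr_ae
  filter_upwards [coeFn_restrictLp a b F, ae_restrict_of_ae hF] with x h1 h2
  rw [h1, h2]; simp [mul_comm]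

theorem setIntegral_restrictLp (a b : ℝ) (F : LineL2) (φ : ℝ → ℝ) :
    ∫ x in Ioo a b, restrictLp a b F x * φ x = ∫ x in Ioo a b, F x * φ x := by
  apply integral_congr_ae
  filter_upwards [coeFn_restrictLp a b F] with x h1
  rw [h1]

namespace Problem

variable (D : Problem)

/-- The function on the line which is given by the three components of a triple, and vanishes
outside `(0, L)`. -/
def glue : D.L2Triple →L[ℝ] LineL2 :=
  (extendLp 0 D.α).comp (ContinuousLinearMap.fst ℝ _ _) +
    (extendLp D.α D.β).comp
      ((ContinuousLinearMap.fst ℝ _ _).comp (ContinuousLinearMap.snd ℝ _ _)) +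
    (extendLp D.β D.L).comp
      ((ContinuousLinearMap.snd ℝ _ _).comp (ContinuousLinearMap.snd ℝ _ _))

theorem glue_apply (F : D.L2Triple) :
    D.glue F = extendLp 0 D.α F.1 + extendLp D.α D.β F.2.1 + extendLp D.β D.L F.2.2 := rfl

/-- The three restrictions of a function on the line. -/
def split : LineL2 →L[ℝ] D.L2Triple :=
  (restrictLp 0 D.α).prod ((restrictLp D.α D.β).prod (restrictLp D.β D.L))

theorem split_apply (F : LineL2) :
    D.split F = (restrictLp 0 D.α F, restrictLp D.α D.β F, restrictLp D.β D.L F) := rfl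

theorem inner_glue (g : LineL2) (F : D.L2Triple) :
    inner ℝ g (D.glue F) = inner ℝ (restrictLp 0 D.α g) F.1 +
      inner ℝ (restrictLp D.α D.β g) F.2.1 + inner ℝ (restrictLp D.β D.L g) F.2.2 := by
  rw [glue_apply, inner_add_right, inner_add_right, inner_extendLp, inner_extendLp,
    inner_extendLp]

theorem β_pos : 0 < D.β := D.α_pos.trans D.α_lt_β

theorem L_pos : 0 < D.L := D.β_pos.trans D.β_lt_L

theorem coeFn_glue (F : D.L2Triple) : ∀ᵐ x ∂(volume : Measure ℝ),
    (x ∈ Ioo 0 D.α → D.glue F x = F.1 x) ∧ (x ∈ Ioo D.α D.β → D.glue F x = F.2.1 x) ∧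
    (x ∈ Ioo D.β D.L → D.glue F x = F.2.2 x) ∧ (x ∉ Ioo 0 D.L → D.glue F x = 0) := by
  rw [glue_apply]
  have hα := D.α_pos
  have hαβ := D.α_lt_β
  have hβL := D.β_lt_L
  filter_upwards [coeFn_extendLp 0 D.α F.1, coeFn_extendLp D.α D.β F.2.1,
    coeFn_extendLp D.β D.L F.2.2, Lp.coeFn_add (extendLp 0 D.α F.1 + extendLp D.α D.β F.2.1)
      (extendLp D.β D.L F.2.2), Lp.coeFn_add (extendLp 0 D.α F.1) (extendLp D.α D.β F.2.1)]
    with x h1 h2 h3 h4 h5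
  rw [h4, Pi.add_apply, h5, Pi.add_apply, h1, h2, h3]
  have ind : ∀ (a b : ℝ) (f : ℝ → ℝ), (Ioo a b).indicator f x =
      if a < x ∧ x < b then f x else 0 := fun a b f => by
    classical
    simp only [indicator_apply, mem_Ioo]
  simp only [ind, mem_Ioo, not_and, not_lt]
  refine ⟨fun h => ?_, fun h => ?_, fun h => ?_, fun h => ?_⟩
  · rw [if_pos h, if_neg (by intro h'; linarith [h.2, h'.1]),
      if_neg (by intro h'; linarith [h.2, h'.1])]; ring
  · rw [if_neg (by intro h'; linarith [h.1, h'.2]), if_pos h,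
      if_neg (by intro h'; linarith [h.2, h'.1])]; ring
  · rw [if_neg (by intro h'; linarith [h.1, h'.2]), if_neg (by intro h'; linarith [h.1, h'.2]),
      if_pos h]; ring
  · rw [if_neg (by intro h'; linarith [h h'.1, h'.2]),
      if_neg (by intro h'; linarith [h (hα.trans h'.1), h'.2]),
      if_neg (by intro h'; linarith [h (D.β_pos.trans h'.1), h'.2])]; ring

theorem split_glue (F : D.L2Triple) : D.split (D.glue F) = F := by
  have h := D.coeFn_glue F
  rw [split_apply]
  refine Prod.ext ?_ (Prod.ext ?_ ?_)
  · apply Lp.ext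
    refine (coeFn_restrictLp _ _ _).trans ?_
    rw [EventuallyEq, ae_restrict_iff' measurableSet_Ioo]
    filter_upwards [h] with x hx using hx.1
  · apply Lp.ext
    refine (coeFn_restrictLp _ _ _).trans ?_
    rw [EventuallyEq, ae_restrict_iff' measurableSet_Ioo]
    filter_upwards [h] with x hx using hx.2.1
  · apply Lp.ext
    refine (coeFn_restrictLp _ _ _).trans ?_
    rw [EventuallyEq, ae_restrict_iff' measurableSet_Ioo]
    filter_upwards [h] with x hx using hx.2.2.1

/-- Almost every point of the line lies in one of the three open subintervals or outside
`(0, L)`. -/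
theorem ae_mem_or : ∀ᵐ x ∂(volume : Measure ℝ),
    x ∈ Ioo 0 D.α ∨ x ∈ Ioo D.α D.β ∨ x ∈ Ioo D.β D.L ∨ x ∉ Ioo 0 D.L := by
  have h1 : ∀ᵐ x ∂(volume : Measure ℝ), x ≠ D.α := by simp [ae_iff, measure_singleton]
  have h2 : ∀ᵐ x ∂(volume : Measure ℝ), x ≠ D.β := by simp [ae_iff, measure_singleton]
  filter_upwards [h1, h2] with x h1 h2
  simp only [mem_Ioo]
  grind

end Problem

/-! ### Piecewise gradients, traces, and membership in `H¹₀(0, L)`. -/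

theorem setIntegral_eq_of_ae {a b : ℝ} {f g : ℝ → ℝ}
    (h : ∀ᵐ x ∂(volume : Measure ℝ), x ∈ Ioo a b → f x = g x) :
    ∀ {c d : ℝ}, a ≤ c → c ≤ d → d ≤ b → ∫ x in c..d, f x = ∫ x in c..d, g x := by
  intro c d hac hcd hdb
  rw [intervalIntegral.integral_of_le hcd, intervalIntegral.integral_of_le hcd,
    integral_Ioc_eq_integral_Ioo, integral_Ioc_eq_integral_Ioo]
  apply setIntegral_congr_ae measurableSet_Ioo
  filter_upwards [h] with x hx hx' using hx (Ioo_subset_Ioo hac hdb hx')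

theorem L2.intervalIntegrable {a b : ℝ} (hab : a ≤ b) (g : L2 a b) :
    IntervalIntegrable g volume a b := by
  rw [intervalIntegrable_iff_integrableOn_Ioo_of_le hab]
  exact (Lp.memLp g).integrable (by norm_num)

namespace Problem

variable (D : Problem)

/-- The components of `F` are primitives of the glued gradient `γ`, up to constants. -/
structure IsPrimitive (F : D.L2Triple) (γ : LineL2) (c₁ c₂ c₃ : ℝ) : Prop where
  fst : ∀ᵐ x ∂(volume : Measure ℝ), x ∈ Ioo 0 D.α → D.glue F x = c₁ + ∫ s in 0..x, γ s
  snd : ∀ᵐ x ∂(volume : Measure ℝ), x ∈ Ioo D.α D.β → D.glue F x = c₂ + ∫ s in D.α..x, γ s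
  trd : ∀ᵐ x ∂(volume : Measure ℝ), x ∈ Ioo D.β D.L → D.glue F x = c₃ + ∫ s in D.β..x, γ s

theorem exists_isPrimitive {F G : D.L2Triple} (h : D.HasGradient F G) :
    ∃ c₁ c₂ c₃, D.IsPrimitive F (D.glue G) c₁ c₂ c₃ := by
  have aux : ∀ {a b : ℝ} (hab : a < b) (f g : L2 a b), IsWeakDeriv a b f g → ∀ γ : ℝ → ℝ,
      ∀ Φ : ℝ → ℝ, (∀ᵐ x ∂(volume : Measure ℝ), x ∈ Ioo a b → Φ x = f x) →
      (∀ᵐ x ∂(volume : Measure ℝ), x ∈ Ioo a b → γ x = g x) →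
      ∃ c, ∀ᵐ x ∂(volume : Measure ℝ), x ∈ Ioo a b → Φ x = c + ∫ s in a..x, γ s := by
    intro a b hab f g hfg γ Φ hΦ hγ
    obtain ⟨c, hc⟩ := exists_ae_eq_add_integral_of_weakDeriv hab
      ((Lp.memLp f).integrable (by norm_num)) (L2.intervalIntegrable hab.le g) hfg
    rw [ae_restrict_iff' measurableSet_Ioo] at hc
    refine ⟨c, ?_⟩
    filter_upwards [hc, hΦ] with x h1 h2 hx
    rw [h2 hx, h1 hx, setIntegral_eq_of_ae hγ le_rfl hx.1.le hx.2.le]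
  have hF := D.coeFn_glue F
  have hG := D.coeFn_glue G
  obtain ⟨c₁, h1⟩ := aux D.α_pos F.1 G.1 h.1 (D.glue G) (D.glue F)
    (hF.mono fun x hx => hx.1) (hG.mono fun x hx => hx.1)
  obtain ⟨c₂, h2⟩ := aux D.α_lt_β F.2.1 G.2.1 h.2.1 (D.glue G) (D.glue F)
    (hF.mono fun x hx => hx.2.1) (hG.mono fun x hx => hx.2.1)
  obtain ⟨c₃, h3⟩ := aux D.β_lt_L F.2.2 G.2.2 h.2.2 (D.glue G) (D.glue F)
    (hF.mono fun x hx => hx.2.2.1) (hG.mono fun x hx => hx.2.2.1)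
  exact ⟨c₁, c₂, c₃, h1, h2, h3⟩

/-- On each subinterval the function is a constant plus a primitive of the gradient. The six trace
conditions determine the constants so that the three primitives continue one another from the value
`0` at `0` to the value `0` at `L`. -/
theorem memH10_glue {F G : D.L2Triple} (h : D.HasGradient F G) (hb : D.BoundaryTransmission F) :
    MemH10 D.L (D.glue F) (D.glue G) := by
  obtain ⟨c₁, c₂, c₃, hp⟩ := D.exists_isPrimitive h
  set γ := D.glue G
  have hII := fun a b => LineL2.intervalIntegrable γ a b
  have hF := D.coeFn_glue F
  have tr : ∀ {a b : ℝ} (hab : a < b) (f : L2 a b) (c : ℝ),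
      (∀ᵐ x ∂(volume : Measure ℝ), x ∈ Ioo a b → D.glue F x = f x) →
      (∀ᵐ x ∂(volume : Measure ℝ), x ∈ Ioo a b → D.glue F x = c + ∫ s in a..x, γ s) →
      ∀ y ∈ Icc a b, ∀ v, HasTrace a b f y v → v = c + ∫ s in a..y, γ s := by
    intro a b hab f c h1 h2 y hy v ⟨g, hg, hfg, hv⟩
    rw [← hv]
    refine eqOn_Icc_of_ae_eq hab hg (g := fun x => c + ∫ s in a..x, γ s)
      (continuousOn_const.add
        (intervalIntegral.continuous_primitive hII a).continuousOn) ?_ hy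
    rw [ae_restrict_iff' measurableSet_Ioo] at hfg ⊢
    filter_upwards [h1, h2, hfg] with x h1 h2 h3 hx
    rw [← h2 hx, h1 hx, h3 hx]
  have hα := D.α_pos
  have hαβ := D.α_lt_β
  have hβL := D.β_lt_L
  have F1 := hF.mono fun x hx => hx.1
  have F2 := hF.mono fun x hx => hx.2.1
  have F3 := hF.mono fun x hx => hx.2.2.1
  obtain ⟨b1, ⟨d, b2, b3⟩, ⟨e, b4, b5⟩, b6⟩ := hb
  have t1 := tr hα F.1 c₁ F1 hp.fst 0 ⟨le_rfl, hα.le⟩ 0 b1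
  have t2 := tr hα F.1 c₁ F1 hp.fst D.α ⟨hα.le, le_rfl⟩ d b2
  have t3 := tr hαβ F.2.1 c₂ F2 hp.snd D.α ⟨le_rfl, hαβ.le⟩ d b3
  have t4 := tr hαβ F.2.1 c₂ F2 hp.snd D.β ⟨hαβ.le, le_rfl⟩ e b4
  have t5 := tr hβL F.2.2 c₃ F3 hp.trd D.β ⟨le_rfl, hβL.le⟩ e b5
  have t6 := tr hβL F.2.2 c₃ F3 hp.trd D.L ⟨hβL.le, le_rfl⟩ 0 b6
  rw [intervalIntegral.integral_same] at t1 t3 t5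
  have a1 := fun x => intervalIntegral.integral_add_adjacent_intervals (hII 0 D.α) (hII D.α x)
  have a2 := fun x => intervalIntegral.integral_add_adjacent_intervals (hII 0 D.β) (hII D.β x)
  refine ⟨?_, ?_⟩
  · filter_upwards [D.ae_mem_or, hF, hp.fst, hp.snd, hp.trd] with x hx h0 h1 h2 h3
    rcases hx with hx | hx | hx | hx
    · have : x ∈ Ioo 0 D.L := ⟨hx.1, by linarith [hx.2]⟩
      rw [h1 hx, indicator_of_mem this]; linarith
    · have : x ∈ Ioo 0 D.L := ⟨by linarith [hx.1], by linarith [hx.2]⟩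
      rw [h2 hx, indicator_of_mem this, ← a1 x]; linarith
    · have : x ∈ Ioo 0 D.L := ⟨by linarith [hx.1], by linarith [hx.2]⟩
      rw [h3 hx, indicator_of_mem this, ← a2 x, ← a1 D.β]; linarith
    · rw [h0.2.2.2 hx, indicator_of_notMem hx]
  · rw [← a2 D.L, ← a1 D.β]; linarith

end Problem

/-! ### Removal of the jumps by thin layers -/

theorem integral_windowLp_one {a b : ℝ} (ha : 0 ≤ a) {x : ℝ} (hx : 0 ≤ x) :
    ∫ s in 0..x, windowLp a b 1 s = max 0 (min x b - a) := by
  have h := coeFn_windowLp a b 1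
  have e : ∀ c d, ∫ s in c..d, windowLp a b 1 s =
      ∫ s in c..d, (Ioo a b).indicator (1 : C(ℝ, ℝ)) s := fun c d =>
    intervalIntegral.integral_congr_ae (h.mono fun s hs _ => hs)
  rw [e, intervalIntegral.integral_of_le hx, setIntegral_indicator measurableSet_Ioo]
  have : Ioc 0 x ∩ Ioo a b = Ioc a (min x b) \ {b} := by
    ext s
    simp only [mem_inter_iff, mem_Ioc, mem_Ioo, Set.mem_sdiff, mem_singleton_iff, le_min_iff]
    constructor
    · rintro ⟨⟨h1, h2⟩, h3, h4⟩; exact ⟨⟨h3, h2, h4.le⟩, h4.ne⟩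
    · rintro ⟨⟨h1, h2, h3⟩, h4⟩
      exact ⟨⟨ha.trans_lt h1, h2⟩, h1, lt_of_le_of_ne h3 h4⟩
  rw [this]
  simp only [ContinuousMap.one_apply, integral_const, MeasurableSet.univ, measureReal_restrict_apply,
    univ_inter, smul_eq_mul, mul_one]
  rw [measureReal_def, measure_sdiff_null (measure_singleton b), Real.volume_Ioc,
    ENNReal.toReal_ofReal', max_comm]

namespace Problem

variable (D : Problem)

/-- A jump of height `k` is spread linearly over a layer of width `w`: the function changes by at
most `|k|` on a set of measure `w`, which costs `|k| √w` in `L²`, and the derivative gains `k / w`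
there, of norm `|k| / √w`. The layers lie outside `(α, β)`, so nothing changes where the damping
acts. -/
theorem exists_memH10_near {F G : D.L2Triple} (h : D.HasGradient F G) :
    ∃ K : ℝ, 0 ≤ K ∧ ∀ w : ℝ, 0 < w → w ≤ D.α → w ≤ D.L - D.β →
      ∃ p q : LineL2, MemH10 D.L p q ∧
        (∀ᵐ x ∂(volume : Measure ℝ), x ∈ Ioo D.α D.β → D.glue F x = p x) ∧
        ‖D.glue F - p‖ ≤ K * √w ∧ ‖q‖ ≤ ‖D.glue G‖ + K / √w := by
  obtain ⟨c₁, c₂, c₃, hp⟩ := D.exists_isPrimitive h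
  set γ := D.glue G
  have hII := fun a b => LineL2.intervalIntegrable γ a b
  have hα := D.α_pos
  have hαβ := D.α_lt_β
  have hβL := D.β_lt_L
  -- The defects to be removed: the value at `0`, the jumps at `α` and at `β`, and minus the value
  -- at `L`.
  set k₁ := c₁ with hk1
  set k₂ := c₂ - (c₁ + ∫ s in 0..D.α, γ s) with hk2
  set k₃ := c₃ - (c₂ + ∫ s in D.α..D.β, γ s) with hk3
  set k₄ := -(c₃ + ∫ s in D.β..D.L, γ s) with hk4
  set K := |k₁| + |k₂| + |k₃| + |k₄| with hK
  refine ⟨K, by positivity, fun w hw hwα hwL => ?_⟩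
  -- The layers are placed to the right of `0`, to the left of `α`, to the right of `β` and to the
  -- left of `L`. Those inside `(0, α)`, or inside `(β, L)`, may overlap; only the sum of the
  -- corrections matters.
  set q : LineL2 := γ + (k₁ / w) • windowLp 0 w 1 + (k₂ / w) • windowLp (D.α - w) D.α 1 +
    (k₃ / w) • windowLp D.β (D.β + w) 1 + (k₄ / w) • windowLp (D.L - w) D.L 1 with hq
  have hqI : ∀ x, 0 ≤ x → ∫ s in 0..x, q s = (∫ s in 0..x, γ s) +
      (k₁ / w) * max 0 (min x w - 0) + (k₂ / w) * max 0 (min x D.α - (D.α - w)) +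
      (k₃ / w) * max 0 (min x (D.β + w) - D.β) + (k₄ / w) * max 0 (min x D.L - (D.L - w)) := by
    intro x hx
    have lin : ∀ (f g : LineL2), ∫ s in 0..x, (f + g) s =
        (∫ s in 0..x, f s) + ∫ s in 0..x, g s := by
      intro f g
      rw [← intervalIntegral.integral_add (LineL2.intervalIntegrable f _ _)
        (LineL2.intervalIntegrable g _ _)]
      exact intervalIntegral.integral_congr_ae ((Lp.coeFn_add f g).mono fun s hs _ => hs)
    have sm : ∀ (c : ℝ) (g : LineL2), ∫ s in 0..x, (c • g) s = c * ∫ s in 0..x, g s := by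
      intro c g
      rw [← intervalIntegral.integral_const_mul]
      exact intervalIntegral.integral_congr_ae ((Lp.coeFn_smul c g).mono fun s hs _ => hs)
    rw [hq, lin, lin, lin, lin, sm, sm, sm, sm, integral_windowLp_one le_rfl hx,
      integral_windowLp_one (by linarith) hx,
      integral_windowLp_one (by linarith) hx,
      integral_windowLp_one (by linarith) hx]
  have hqII := fun a b => LineL2.intervalIntegrable q a b
  set P : C(ℝ, ℝ) := ⟨fun x => ∫ s in 0..x, q s, intervalIntegral.continuous_primitive hqII 0⟩
    with hP
  have a1 := fun x => intervalIntegral.integral_add_adjacent_intervals (hII 0 D.α) (hII D.α x)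
  have a2 := fun x => intervalIntegral.integral_add_adjacent_intervals (hII 0 D.β) (hII D.β x)
  have hwin := coeFn_windowLp 0 D.L P
  have hF := D.coeFn_glue F
  have hdiv : ∀ k : ℝ, k / w * w = k := fun k => div_mul_cancel₀ k hw.ne'
  have hmid : ∀ x ∈ Ioo D.α D.β, P x = c₂ + ∫ s in D.α..x, γ s := by
    intro x hx
    have : P x = ∫ s in 0..x, q s := rfl
    rw [this, hqI x (hα.trans hx.1).le, min_eq_right (by linarith [hx.1]),
      min_eq_right (by linarith [hx.1]), min_eq_left (by linarith [hx.2]),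
      min_eq_left (by linarith [hx.2]), max_eq_right (by linarith), max_eq_right (by linarith),
      max_eq_left (by linarith [hx.2]), max_eq_left (by linarith [hx.2]), ← a1 x]
    have e1 := hdiv k₁
    have e2 := hdiv k₂
    have e3 : D.α - (D.α - w) = w := by ring
    rw [e3, sub_zero, e1, e2]
    linarith
  have hside : ∀ k t : ℝ, 0 ≤ t → t ≤ w → |k - k / w * t| ≤ |k| := by
    intro k t h0 h1
    have : k - k / w * t = k * (1 - t / w) := by ring
    rw [this, abs_mul]
    apply mul_le_of_le_one_right (abs_nonneg _)
    rw [abs_of_nonneg (by rw [sub_nonneg, div_le_one hw]; exact h1)]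
    have : 0 ≤ t / w := by positivity
    linarith
  have hside' : ∀ k t : ℝ, 0 ≤ t → t ≤ w → |k / w * t| ≤ |k| := by
    intro k t h0 h1
    have : k / w * t = k * (t / w) := by ring
    rw [this, abs_mul]
    apply mul_le_of_le_one_right (abs_nonneg _)
    rw [abs_of_nonneg (by positivity), div_le_one hw]; exact h1
  have hbd : ∀ᵐ x ∂(volume : Measure ℝ), |D.glue F x - windowLp 0 D.L P x| ≤
      |k₁| * (Ioo 0 w).indicator 1 x + |k₂| * (Ioo (D.α - w) D.α).indicator 1 x +
      |k₃| * (Ioo D.β (D.β + w)).indicator 1 x + |k₄| * (Ioo (D.L - w) D.L).indicator 1 x := by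
    filter_upwards [D.ae_mem_or, hF, hp.fst, hp.snd, hp.trd, hwin]
      with x hx h0 h1 h2 h3 h4
    have ipos : ∀ (k a b : ℝ), 0 ≤ |k| * (Ioo a b).indicator (1 : ℝ → ℝ) x := fun k a b =>
      mul_nonneg (abs_nonneg _) (indicator_nonneg (fun _ _ => zero_le_one) _)
    have i1 := ipos k₁ 0 w
    have i2 := ipos k₂ (D.α - w) D.α
    have i3 := ipos k₃ D.β (D.β + w)
    have i4 := ipos k₄ (D.L - w) D.L
    rcases hx with hx | hx | hx | hx
    · have hxL : x ∈ Ioo 0 D.L := ⟨hx.1, by linarith [hx.2]⟩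
      have hPx : P x = ∫ s in 0..x, q s := rfl
      rw [h1 hx, h4, indicator_of_mem hxL, hPx, hqI x hx.1.le,
        min_eq_left (a := x) (b := D.α) hx.2.le,
        min_eq_left (a := x) (b := D.β + w) (by linarith [hx.2]),
        min_eq_left (a := x) (b := D.L) (by linarith [hx.2]),
        max_eq_left (b := x - D.β) (by linarith [hx.2]),
        max_eq_left (b := x - (D.L - w)) (by linarith [hx.2])]
      have e1 : |k₁ - k₁ / w * max 0 (min x w - 0)| ≤
          |k₁| * (Ioo 0 w).indicator (1 : ℝ → ℝ) x := by
        rcases lt_or_ge x w with h | h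
        · rw [indicator_of_mem (show x ∈ Ioo 0 w from ⟨hx.1, h⟩), min_eq_left h.le, sub_zero,
            max_eq_right hx.1.le, Pi.one_apply, mul_one]
          exact hside _ _ hx.1.le h.le
        · rw [min_eq_right h, sub_zero, max_eq_right hw.le, hdiv, sub_self, abs_zero]
          exact i1
      have e2 : |k₂ / w * max 0 (x - (D.α - w))| ≤
          |k₂| * (Ioo (D.α - w) D.α).indicator (1 : ℝ → ℝ) x := by
        rcases lt_or_ge (D.α - w) x with h | h
        · rw [indicator_of_mem (show x ∈ Ioo (D.α - w) D.α from ⟨h, hx.2⟩), max_eq_right (by linarith),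
            Pi.one_apply, mul_one]
          exact hside' _ _ (by linarith) (by linarith [hx.2])
        · rw [max_eq_left (by linarith), mul_zero, abs_zero]
          exact i2
      have e3 := abs_sub (k₁ - k₁ / w * max 0 (min x w - 0)) (k₂ / w * max 0 (x - (D.α - w)))
      refine le_trans (le_of_eq ?_) (e3.trans (by linarith))
      congr 1
      rw [hk1]
      ring
    · have hxL : x ∈ Ioo 0 D.L := ⟨by linarith [hx.1], by linarith [hx.2]⟩
      rw [h2 hx, h4, indicator_of_mem hxL, hmid x hx, sub_self, abs_zero]
      positivity
    · have hxL : x ∈ Ioo 0 D.L := ⟨by linarith [hx.1], by linarith [hx.2]⟩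
      have hPx : P x = ∫ s in 0..x, q s := rfl
      rw [h3 hx, h4, indicator_of_mem hxL, hPx, hqI x hxL.1.le,
        min_eq_right (a := x) (b := w) (by linarith [hx.1]),
        min_eq_right (a := x) (b := D.α) (by linarith [hx.1]),
        min_eq_left (a := x) (b := D.L) hx.2.le,
        max_eq_right (b := w - 0) (by linarith),
        max_eq_right (b := D.α - (D.α - w)) (by linarith)]
      have e1 : |k₃ - k₃ / w * max 0 (min x (D.β + w) - D.β)| ≤
          |k₃| * (Ioo D.β (D.β + w)).indicator (1 : ℝ → ℝ) x := by
        rcases lt_or_ge x (D.β + w) with h | h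
        · rw [indicator_of_mem (show x ∈ Ioo D.β (D.β + w) from ⟨hx.1, h⟩), min_eq_left h.le,
            max_eq_right (by linarith [hx.1]), Pi.one_apply, mul_one]
          exact hside _ _ (by linarith [hx.1]) (by linarith)
        · rw [min_eq_right h, max_eq_right (by linarith), add_sub_cancel_left, hdiv, sub_self,
            abs_zero]
          exact i3
      have e2 : |k₄ / w * max 0 (x - (D.L - w))| ≤
          |k₄| * (Ioo (D.L - w) D.L).indicator (1 : ℝ → ℝ) x := by
        rcases lt_or_ge (D.L - w) x with h | h
        · rw [indicator_of_mem (show x ∈ Ioo (D.L - w) D.L from ⟨h, hx.2⟩), max_eq_right (by linarith),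
            Pi.one_apply, mul_one]
          exact hside' _ _ (by linarith) (by linarith [hx.2])
        · rw [max_eq_left (by linarith), mul_zero, abs_zero]
          exact i4
      have e3 := abs_sub (k₃ - k₃ / w * max 0 (min x (D.β + w) - D.β))
        (k₄ / w * max 0 (x - (D.L - w)))
      refine le_trans (le_of_eq ?_) (e3.trans (by linarith))
      congr 1
      have e4 : D.α - (D.α - w) = w := by ring
      rw [← a2 x, ← a1 D.β, sub_zero, e4, hdiv, hdiv]
      simp only [hk1, hk2, hk3]
      ring
    · rw [h0.2.2.2 hx, h4, indicator_of_notMem hx, sub_self, abs_zero]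
      positivity
  have hwn : ∀ a : ℝ, ‖windowLp a (a + w) 1‖ = √w := by
    intro a
    have := norm_windowLp_one_sq (show a ≤ a + w by linarith)
    rw [add_sub_cancel_left] at this
    exact (Real.sqrt_eq_iff_eq_sq hw.le (norm_nonneg _)).mpr this.symm |>.symm
  have hn1 : ‖windowLp 0 w 1‖ = √w := by simpa using hwn 0
  have hn2 : ‖windowLp (D.α - w) D.α 1‖ = √w := by simpa using hwn (D.α - w)
  have hn3 : ‖windowLp D.β (D.β + w) 1‖ = √w := hwn D.β
  have hn4 : ‖windowLp (D.L - w) D.L 1‖ = √w := by simpa using hwn (D.L - w)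
  have tri : ∀ (u v s t : LineL2), ‖u + v + s + t‖ ≤ ‖u‖ + ‖v‖ + ‖s‖ + ‖t‖ := fun u v s t =>
    (norm_add_le _ _).trans (by linarith [norm_add_le (u + v) s, norm_add_le u v])
  refine ⟨windowLp 0 D.L P, q, ⟨?_, ?_⟩, ?_, ?_, ?_⟩
  · exact hwin
  · rw [hqI D.L D.L_pos.le, min_eq_right (by linarith), min_eq_right (by linarith),
      min_eq_right (by linarith), min_self, max_eq_right (by linarith),
      max_eq_right (by linarith), max_eq_right (by linarith), max_eq_right (by linarith)]
    have e3 : D.α - (D.α - w) = w := by ring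
    have e4 : D.L - (D.L - w) = w := by ring
    rw [sub_zero, e3, e4, add_sub_cancel_left, hdiv, hdiv, hdiv, hdiv, ← a2 D.L, ← a1 D.β]
    simp only [hk1, hk2, hk3, hk4]
    ring
  · filter_upwards [hwin, hp.snd] with x h4 h2 hx
    have hxL : x ∈ Ioo 0 D.L := ⟨by linarith [hx.1], by linarith [hx.2]⟩
    rw [h2 hx, h4, indicator_of_mem hxL, hmid x hx]
  · set R : LineL2 := |k₁| • windowLp 0 w 1 + |k₂| • windowLp (D.α - w) D.α 1 +
      |k₃| • windowLp D.β (D.β + w) 1 + |k₄| • windowLp (D.L - w) D.L 1 with hR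
    have hle : ‖D.glue F - windowLp 0 D.L P‖ ≤ ‖R‖ := by
      apply Lp.norm_le_norm_of_ae_le
      have s1 := Lp.coeFn_add (|k₁| • windowLp 0 w 1 + |k₂| • windowLp (D.α - w) D.α 1 +
        |k₃| • windowLp D.β (D.β + w) 1) (|k₄| • windowLp (D.L - w) D.L 1)
      have s2 := Lp.coeFn_add (|k₁| • windowLp 0 w 1 + |k₂| • windowLp (D.α - w) D.α 1)
        (|k₃| • windowLp D.β (D.β + w) 1)
      have s3 := Lp.coeFn_add (|k₁| • windowLp 0 w 1) (|k₂| • windowLp (D.α - w) D.α 1)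
      filter_upwards [hbd, Lp.coeFn_sub (D.glue F) (windowLp 0 D.L P), s1, s2, s3,
        Lp.coeFn_smul |k₁| (windowLp 0 w 1), Lp.coeFn_smul |k₂| (windowLp (D.α - w) D.α 1),
        Lp.coeFn_smul |k₃| (windowLp D.β (D.β + w) 1),
        Lp.coeFn_smul |k₄| (windowLp (D.L - w) D.L 1), coeFn_windowLp 0 w 1,
        coeFn_windowLp (D.α - w) D.α 1, coeFn_windowLp D.β (D.β + w) 1,
        coeFn_windowLp (D.L - w) D.L 1]
        with x hb e0 e1 e2 e3 e4 e5 e6 e7 e8 e9 e10 e11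
      rw [e0, hR, e1, Pi.add_apply, e2, Pi.add_apply, e3, Pi.add_apply, e4, e5, e6, e7,
        Pi.smul_apply, Pi.smul_apply, Pi.smul_apply, Pi.smul_apply, e8, e9, e10, e11]
      exact hb.trans (le_abs_self _)
    refine hle.trans ((tri _ _ _ _).trans (le_of_eq ?_))
    rw [norm_smul, norm_smul, norm_smul, norm_smul, hn1, hn2, hn3, hn4, hK]
    simp only [Real.norm_eq_abs, abs_abs]
    ring
  · have e : q = γ + ((k₁ / w) • windowLp 0 w 1 + (k₂ / w) • windowLp (D.α - w) D.α 1 +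
      (k₃ / w) • windowLp D.β (D.β + w) 1 + (k₄ / w) • windowLp (D.L - w) D.L 1) := by
      rw [hq]; abel
    rw [e]
    refine (norm_add_le _ _).trans (add_le_add_right ((tri _ _ _ _).trans (le_of_eq ?_)) _)
    rw [norm_smul, norm_smul, norm_smul, norm_smul, hn1, hn2, hn3, hn4, hK]
    simp only [Real.norm_eq_abs, abs_div, abs_of_pos hw]
    have : √w ≠ 0 := (Real.sqrt_pos.mpr hw).ne'
    field_simp
    rw [Real.sq_sqrt hw.le]

end Problem

namespace Mesh

variable (M : Mesh) (D : Problem)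

/-! ### Geometry of the mesh -/

theorem hα_pos : 0 < M.hα D := div_pos D.α_pos (by exact_mod_cast M.Nα_pos)

theorem h_pos : 0 < M.h D := div_pos (sub_pos.mpr D.α_lt_β) (by exact_mod_cast M.N_pos)

theorem hβ_pos : 0 < M.hβ D := div_pos (sub_pos.mpr D.β_lt_L) (by exact_mod_cast M.Nβ_pos)

theorem Nα_mul_hα : M.Nα * M.hα D = D.α :=
  mul_div_cancel₀ _ (by exact_mod_cast M.Nα_pos.ne')

theorem N_mul_h : M.N * M.h D = D.β - D.α :=
  mul_div_cancel₀ _ (by exact_mod_cast M.N_pos.ne')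

theorem Nβ_mul_hβ : M.Nβ * M.hβ D = D.L - D.β :=
  mul_div_cancel₀ _ (by exact_mod_cast M.Nβ_pos.ne')

theorem edge_zero : M.edge D 0 = 0 := by simp [edge]

theorem edge_Nα : M.edge D M.Nα = D.α := by simp [edge, Nα_mul_hα]

theorem edge_Nα_add_N : M.edge D (M.Nα + M.N) = D.β := by
  have := M.N_pos
  rw [edge, if_neg (by omega), if_pos le_rfl]
  push_cast
  rw [add_sub_cancel_left, N_mul_h]
  ring

theorem edge_Nmax : M.edge D M.Nmax = D.L := by
  have := M.N_pos
  have := M.Nβ_pos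
  rw [edge, if_neg (by unfold Nmax; omega), if_neg (by unfold Nmax; omega), Nmax]
  push_cast
  have := M.Nβ_mul_hβ D
  linear_combination this

theorem edge_of_mid {i : ℕ} (h1 : M.Nα ≤ i) (h2 : i ≤ M.Nα + M.N) :
    M.edge D i = D.α + ((i : ℝ) - M.Nα) * M.h D := by
  rcases h1.eq_or_lt with h | h
  · rw [← h, edge_Nα]; ring
  · rw [edge, if_neg (by omega), if_pos h2]

theorem edge_of_right {i : ℕ} (h1 : M.Nα + M.N ≤ i) :
    M.edge D i = D.β + ((i : ℝ) - M.Nα - M.N) * M.hβ D := by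
  rcases h1.eq_or_lt with h | h
  · rw [← h, edge_Nα_add_N]; push_cast; ring
  · rw [edge, if_neg (by omega), if_neg (by omega)]

theorem edge_succ_sub_of_left {j : ℕ} (h : j < M.Nα) :
    M.edge D (j + 1) - M.edge D j = M.hα D := by
  rw [edge, edge, if_pos (Nat.succ_le_of_lt h), if_pos h.le]; push_cast; ring

theorem edge_succ_sub_of_mid {j : ℕ} (h1 : M.Nα ≤ j) (h2 : j < M.Nα + M.N) :
    M.edge D (j + 1) - M.edge D j = M.h D := by
  rw [edge_of_mid M D (by omega) h2, edge_of_mid M D h1 h2.le]; push_cast; ring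

theorem edge_succ_sub_of_right {j : ℕ} (h1 : M.Nα + M.N ≤ j) :
    M.edge D (j + 1) - M.edge D j = M.hβ D := by
  rw [edge_of_right M D (by omega), edge_of_right M D h1]; push_cast; ring

theorem edge_strictMono : StrictMono (M.edge D) := by
  refine strictMono_nat_of_lt_succ fun j => ?_
  rw [← sub_pos]
  rcases lt_or_ge j M.Nα with h | h
  · rw [edge_succ_sub_of_left M D h]; exact M.hα_pos D
  · rcases lt_or_ge j (M.Nα + M.N) with h' | h'
    · rw [edge_succ_sub_of_mid M D h h']; exact M.h_pos D
    · rw [edge_succ_sub_of_right M D h']; exact M.hβ_pos D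

theorem cellSize_succ (j : ℕ) : M.cellSize D (j + 1) = M.edge D (j + 1) - M.edge D j := rfl

theorem edge_succ_sub_le_size {j : ℕ} (hj : j < M.Nmax) :
    M.edge D (j + 1) - M.edge D j ≤ M.size D :=
  Finset.le_sup' (M.cellSize D) (Finset.mem_Icc.mpr ⟨by omega, hj⟩)

theorem Nmax_pos : 0 < M.Nmax := by have := M.N_pos; unfold Nmax; omega

theorem size_pos : 0 < M.size D :=
  (sub_pos.mpr (M.edge_strictMono D (Nat.lt_succ_self 0))).trans_le
    (M.edge_succ_sub_le_size D M.Nmax_pos)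

/-- The weight `h_j / (2 c_j²)` of the `j`-th cell. -/
def cellWeight (j : ℕ) : ℝ := (M.edge D (j + 1) - M.edge D j) / 2 / M.speed D (j + 1) ^ 2

theorem speed_pos (i : ℕ) : 0 < M.speed D i := by
  have := D.C₁_pos
  have := D.C₂_pos
  have := D.C₃_pos
  unfold speed; split_ifs <;> assumption

theorem cellWeight_pos (j : ℕ) : 0 < M.cellWeight D j :=
  div_pos (div_pos (sub_pos.mpr (M.edge_strictMono D j.lt_succ_self)) two_pos)
    (pow_pos (M.speed_pos D _) 2)

theorem cellWeight_of_left {j : ℕ} (h : j < M.Nα) :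
    M.cellWeight D j = M.hα D / 2 / D.C₁ ^ 2 := by
  rw [cellWeight, edge_succ_sub_of_left M D h, speed, if_pos (Nat.succ_le_of_lt h)]

theorem cellWeight_of_mid {j : ℕ} (h1 : M.Nα ≤ j) (h2 : j < M.Nα + M.N) :
    M.cellWeight D j = M.h D / 2 / D.C₂ ^ 2 := by
  rw [cellWeight, edge_succ_sub_of_mid M D h1 h2, speed, if_neg (by omega), if_pos (Nat.succ_le_of_lt h2)]

theorem cellWeight_of_right {j : ℕ} (h1 : M.Nα + M.N ≤ j) :
    M.cellWeight D j = M.hβ D / 2 / D.C₃ ^ 2 := by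
  rw [cellWeight, edge_succ_sub_of_right M D h1, speed, if_neg (by omega), if_neg (by omega)]

theorem center_succ {j : ℕ} (hj : j < M.Nmax) :
    M.center D (j + 1) = (M.edge D j + M.edge D (j + 1)) / 2 := by
  rw [center, if_neg (by omega), if_pos (Nat.succ_le_of_lt hj)]; rfl

theorem center_succ_succ_sub {j : ℕ} (hj : j + 1 < M.Nmax) :
    M.center D (j + 1 + 1) - M.center D (j + 1) =
      (M.edge D (j + 1 + 1) - M.edge D (j + 1)) / 2 + (M.edge D (j + 1) - M.edge D j) / 2 := by
  rw [center_succ M D hj, center_succ M D (by omega)]; ring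

/-- The weight is `∫ dx / c²` over the half cells adjacent to the edge, a resistance, and `ℓ` is the
corresponding conductance; at the interfaces this is the harmonic mean. At `0` and `L` there is only
one half cell. -/
theorem edgeWeight_mul_ell {i : ℕ} (hi : i ≤ M.Nmax) :
    edgeWeight (M.cellWeight D) M.Nmax i * M.ell D i = 1 := by
  have pα := M.Nα_pos
  have pN := M.N_pos
  have pβ := M.Nβ_pos
  have c1 := D.C₁_pos
  have c2 := D.C₂_pos
  have c3 := D.C₃_pos
  have a1 := M.hα_pos D
  have a2 := M.h_pos D
  have a3 := M.hβ_pos D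
  have hN : M.Nmax = M.Nα + M.N + M.Nβ := rfl
  rcases Nat.eq_zero_or_pos i with h0 | h0
  · subst h0
    have e : M.ell D 0 = D.C₁ ^ 2 / (M.hα D / 2) := by
      rw [ell, if_neg (by omega), if_neg (by omega), center_succ M D M.Nmax_pos, speed,
        if_pos (by omega), center, if_pos rfl, edge_zero, sub_zero, zero_add]
      have := M.edge_succ_sub_of_left D pα
      rw [edge_zero, sub_zero] at this
      rw [← this]
    rw [edgeWeight, if_pos rfl, if_pos M.Nmax_pos, cellWeight_of_left M D pα, e]
    field_simp
    ring
  obtain ⟨k, rfl⟩ : ∃ k, i = k + 1 := ⟨i - 1, by omega⟩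
  rw [edgeWeight, if_neg (by omega), Nat.add_sub_cancel]
  rcases hi.eq_or_lt with h | h
  · rw [if_neg (by omega), cellWeight_of_right M D (by omega), ell, if_neg (by omega),
      if_neg (by omega), speed, if_neg (by omega), if_neg (by omega), center,
      if_neg (by omega), if_neg (by omega), center_succ M D (by omega), h, edge_Nmax]
    have e1 := M.edge_succ_sub_of_right D (j := k) (by omega)
    rw [h, edge_Nmax] at e1
    have e2 : D.L - (M.edge D k + D.L) / 2 = M.hβ D / 2 := by rw [← e1]; ring
    rw [e2]
    field_simp
    ring
  rw [if_pos h]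
  rcases lt_trichotomy (k + 1) M.Nα with h1 | h1 | h1
  · rw [cellWeight_of_left M D (by omega), cellWeight_of_left M D (by omega), ell,
      if_neg (by omega), if_neg (by omega), speed, if_pos (by omega), center_succ_succ_sub M D h,
      edge_succ_sub_of_left M D (by omega), edge_succ_sub_of_left M D (by omega)]
    field_simp
  · rw [cellWeight_of_left M D (by omega), cellWeight_of_mid M D (by omega) (by omega), ell,
      if_pos h1]
    field_simp
    ring
  rcases lt_trichotomy (k + 1) (M.Nα + M.N) with h2 | h2 | h2
  · rw [cellWeight_of_mid M D (by omega) (by omega), cellWeight_of_mid M D (by omega) (by omega),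
      ell, if_neg (by omega), if_neg (by omega), speed, if_neg (by omega), if_pos (by omega),
      center_succ_succ_sub M D h, edge_succ_sub_of_mid M D (by omega) (by omega),
      edge_succ_sub_of_mid M D (by omega) (by omega)]
    field_simp
  · rw [cellWeight_of_mid M D (by omega) (by omega), cellWeight_of_right M D (by omega),
      ell, if_neg (by omega), if_pos h2]
    field_simp
  · rw [cellWeight_of_right M D (by omega), cellWeight_of_right M D (by omega),
      ell, if_neg (by omega), if_neg (by omega), speed, if_neg (by omega), if_neg (by omega),
      center_succ_succ_sub M D h, edge_succ_sub_of_right M D (by omega),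
      edge_succ_sub_of_right M D (by omega)]
    field_simp

theorem edgeWeight_pos {i : ℕ} (hi : i ≤ M.Nmax) :
    0 < edgeWeight (M.cellWeight D) M.Nmax i := by
  have p := M.Nmax_pos
  unfold edgeWeight
  rcases Nat.eq_zero_or_pos i with h0 | h0
  · rw [if_pos h0, if_pos (by omega), zero_add]; exact M.cellWeight_pos D _
  · rw [if_neg (by omega)]
    have := M.cellWeight_pos D (i - 1)
    have := M.cellWeight_pos D i
    split_ifs <;> linarith

theorem ell_pos {i : ℕ} (hi : i ≤ M.Nmax) : 0 < M.ell D i := by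
  have h1 := M.edgeWeight_mul_ell D hi
  have h2 := M.edgeWeight_pos D hi
  by_contra h
  have := mul_nonpos_of_nonneg_of_nonpos h2.le (not_lt.mp h)
  linarith

theorem viscosity_nonneg (i : ℕ) : 0 ≤ M.viscosity D i := by
  unfold viscosity
  split_ifs
  · exact (div_pos D.δ_pos (M.h_pos D)).le
  · exact le_rfl

/-- At an edge inside `(α, β)` one has `ℓ = C₂² / h`, so that equality holds; elsewhere the
viscosity is zero. Hence the damping form is dominated by the elastic one, uniformly in the mesh. -/
theorem viscosity_mul_C₂_sq_le {i : ℕ} (hi : i ≤ M.Nmax) :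
    M.viscosity D i ≤ D.δ / D.C₂ ^ 2 * M.ell D i := by
  have c2 := D.C₂_pos
  have cδ := D.δ_pos
  have a2 := M.h_pos D
  unfold viscosity
  split_ifs with h
  · have e := M.edgeWeight_mul_ell D hi
    obtain ⟨k, rfl⟩ : ∃ k, i = k + 1 := ⟨i - 1, by omega⟩
    rw [edgeWeight, if_neg (by omega), Nat.add_sub_cancel,
      if_pos (by unfold Nmax; have := M.Nβ_pos; omega),
      cellWeight_of_mid M D (by omega) (by omega), cellWeight_of_mid M D (by omega) (by omega)] at e
    have e2 : M.h D / D.C₂ ^ 2 * M.ell D (k + 1) = 1 := by rw [← e]; ring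
    apply le_of_eq
    have e3 : D.δ / D.C₂ ^ 2 * M.ell D (k + 1) =
        D.δ / M.h D * (M.h D / D.C₂ ^ 2 * M.ell D (k + 1)) := by field_simp
    rw [e3, e2, mul_one]
  · exact mul_nonneg (by positivity) (M.ell_pos D hi).le

theorem halfSize_edgeWeight_of_viscosity_ne_zero {i : ℕ} (h : M.viscosity D i ≠ 0) :
    edgeWeight (fun j => (M.edge D (j + 1) - M.edge D j) / 2) M.Nmax i * M.viscosity D i = D.δ := by
  have a2 := M.h_pos D
  have h' : M.Nα + 1 ≤ i ∧ i < M.Nα + M.N := by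
    by_contra hc
    exact h (if_neg hc)
  obtain ⟨k, rfl⟩ : ∃ k, i = k + 1 := ⟨i - 1, by omega⟩
  rw [viscosity, if_pos h', edgeWeight, if_neg (by omega), Nat.add_sub_cancel,
    if_pos (by unfold Nmax; omega), edge_succ_sub_of_mid M D (by omega) (by omega),
    edge_succ_sub_of_mid M D (by omega) (by omega)]
  field_simp
  ring

end Mesh

/-! ### The bilinear forms of the scheme -/

/-- The bilinear form `∑ i ∈ s, w i * T i V * T i W`. -/
def weightedForm (s : Finset ℕ) (w : ℕ → ℝ) (T : ℕ → (ℕ → ℝ) →ₗ[ℝ] ℝ) :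
    LinearMap.BilinForm ℝ (ℕ → ℝ) :=
  ∑ i ∈ s, w i • LinearMap.BilinForm.linMulLin (T i) (T i)

theorem weightedForm_apply (s : Finset ℕ) (w : ℕ → ℝ) (T : ℕ → (ℕ → ℝ) →ₗ[ℝ] ℝ) (V W : ℕ → ℝ) :
    weightedForm s w T V W = ∑ i ∈ s, w i * (T i V * T i W) := by
  simp [weightedForm, LinearMap.sum_apply]

theorem isSymmNonneg_weightedForm {s : Finset ℕ} {w : ℕ → ℝ} (T : ℕ → (ℕ → ℝ) →ₗ[ℝ] ℝ)
    (hw : ∀ i ∈ s, 0 ≤ w i) : IsSymmNonneg (weightedForm s w T) where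
  symm V W := by
    rw [weightedForm_apply, weightedForm_apply]
    exact Finset.sum_congr rfl fun i _ => by ring
  nonneg V := by
    rw [weightedForm_apply]
    exact Finset.sum_nonneg fun i hi => mul_nonneg (hw i hi) (mul_self_nonneg _)

/-- The jump `V (i + 1) - V i`. -/
def jump (i : ℕ) : (ℕ → ℝ) →ₗ[ℝ] ℝ :=
  (LinearMap.proj (i + 1) : (ℕ → ℝ) →ₗ[ℝ] ℝ) - LinearMap.proj i

namespace Mesh

variable (M : Mesh) (D : Problem)

/-- The discrete `L²` inner product. -/
def massForm : LinearMap.BilinForm ℝ (ℕ → ℝ) :=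
  weightedForm (Finset.range M.Nmax) (fun j => M.edge D (j + 1) - M.edge D j)
    fun j => LinearMap.proj (j + 1)

/-- The bilinear form of the discrete diffusion. -/
def stiffForm : LinearMap.BilinForm ℝ (ℕ → ℝ) :=
  weightedForm (Finset.range (M.Nmax + 1)) (M.ell D) jump

/-- The bilinear form of the discrete damping. -/
def dampForm : LinearMap.BilinForm ℝ (ℕ → ℝ) :=
  weightedForm (Finset.range (M.Nmax + 1)) (M.viscosity D) jump

theorem massForm_apply (V W : ℕ → ℝ) : M.massForm D V W =
    ∑ j ∈ Finset.range M.Nmax, (M.edge D (j + 1) - M.edge D j) * (V (j + 1) * W (j + 1)) :=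
  weightedForm_apply _ _ _ _ _

theorem stiffForm_apply (V W : ℕ → ℝ) : M.stiffForm D V W =
    ∑ i ∈ Finset.range (M.Nmax + 1), M.ell D i * ((V (i + 1) - V i) * (W (i + 1) - W i)) :=
  weightedForm_apply _ _ _ _ _

theorem dampForm_apply (V W : ℕ → ℝ) : M.dampForm D V W =
    ∑ i ∈ Finset.range (M.Nmax + 1), M.viscosity D i * ((V (i + 1) - V i) * (W (i + 1) - W i)) :=
  weightedForm_apply _ _ _ _ _

theorem isSymmNonneg_massForm : IsSymmNonneg (M.massForm D) :=
  isSymmNonneg_weightedForm _ fun j _ => (sub_pos.mpr (M.edge_strictMono D j.lt_succ_self)).le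

theorem isSymmNonneg_stiffForm : IsSymmNonneg (M.stiffForm D) :=
  isSymmNonneg_weightedForm _ fun i hi =>
    (M.ell_pos D (Nat.lt_succ_iff.mp (Finset.mem_range.mp hi))).le

theorem isSymmNonneg_dampForm : IsSymmNonneg (M.dampForm D) :=
  isSymmNonneg_weightedForm _ fun _ _ => M.viscosity_nonneg D _

theorem dampForm_le (V : ℕ → ℝ) :
    M.dampForm D V V ≤ D.δ / D.C₂ ^ 2 * M.stiffForm D V V := by
  rw [dampForm_apply, stiffForm_apply, Finset.mul_sum]
  refine Finset.sum_le_sum fun i hi => ?_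
  have := mul_le_mul_of_nonneg_right
    (M.viscosity_mul_C₂_sq_le D (Nat.lt_succ_iff.mp (Finset.mem_range.mp hi)))
    (mul_self_nonneg (V (i + 1) - V i))
  linarith

/-- The step function of a vector of cell values. -/
abbrev step : (ℕ → ℝ) →ₗ[ℝ] LineL2 := stepLp (M.edge D) M.Nmax

/-- The flux `ℓ (V (i + 1) - V i)`. -/
def stiffFlux : (ℕ → ℝ) →ₗ[ℝ] (ℕ → ℝ) := LinearMap.pi fun i => M.ell D i • jump i

/-- The viscous flux. -/
def dampFlux : (ℕ → ℝ) →ₗ[ℝ] (ℕ → ℝ) := LinearMap.pi fun i => M.viscosity D i • jump i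

theorem stiffFlux_apply (V : ℕ → ℝ) (i : ℕ) :
    M.stiffFlux D V i = M.ell D i * (V (i + 1) - V i) := rfl

theorem dampFlux_apply (V : ℕ → ℝ) (i : ℕ) :
    M.dampFlux D V i = M.viscosity D i * (V (i + 1) - V i) := rfl

/-- The interpolated flux of the diffusion. -/
def stiffLp : (ℕ → ℝ) →ₗ[ℝ] LineL2 := (affineLp (M.edge D) M.Nmax).comp (M.stiffFlux D)

/-- The interpolated viscous flux. -/
def dampLp : (ℕ → ℝ) →ₗ[ℝ] LineL2 := (affineLp (M.edge D) M.Nmax).comp (M.dampFlux D)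

theorem diffusion_succ (V : ℕ → ℝ) (j : ℕ) :
    M.diffusion D V (j + 1) = M.stiffFlux D V (j + 1) - M.stiffFlux D V j := rfl

theorem damping_succ (V : ℕ → ℝ) (j : ℕ) :
    M.damping D V (j + 1) = M.dampFlux D V (j + 1) - M.dampFlux D V j := rfl

/-- The vectors vanishing at both ends. -/
def ends : Submodule ℝ (ℕ → ℝ) :=
  LinearMap.ker (LinearMap.proj 0 : (ℕ → ℝ) →ₗ[ℝ] ℝ) ⊓
    LinearMap.ker (LinearMap.proj (M.Nmax + 1) : (ℕ → ℝ) →ₗ[ℝ] ℝ)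

theorem sum_diffusion_mul (V : ℕ → ℝ) {W : ℕ → ℝ} (hW : W ∈ M.ends) :
    ∑ j ∈ Finset.range M.Nmax, M.diffusion D V (j + 1) * W (j + 1) = -M.stiffForm D V W := by
  simp only [diffusion_succ]
  rw [sum_diff_mul_eq _ _ _ hW.1 hW.2, stiffForm_apply]
  simp only [stiffFlux_apply, mul_assoc]

theorem sum_damping_mul (V : ℕ → ℝ) {W : ℕ → ℝ} (hW : W ∈ M.ends) :
    ∑ j ∈ Finset.range M.Nmax, M.damping D V (j + 1) * W (j + 1) = -M.dampForm D V W := by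
  simp only [damping_succ]
  rw [sum_diff_mul_eq _ _ _ hW.1 hW.2, dampForm_apply]
  simp only [dampFlux_apply, mul_assoc]

theorem norm_step_sq (V : ℕ → ℝ) : ‖M.step D V‖ ^ 2 = M.massForm D V V := by
  rw [← real_inner_self_eq_norm_sq, inner_stepLp_stepLp (M.edge_strictMono D), massForm_apply]

end Mesh

/-! ### Norms of the interpolated fluxes. -/

namespace Problem

variable (D : Problem)

/-- An upper bound for the squares of the speeds. -/
def maxSpeedSq : ℝ := D.C₁ ^ 2 + D.C₂ ^ 2 + D.C₃ ^ 2

theorem maxSpeedSq_pos : 0 < D.maxSpeedSq := by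
  have := D.C₁_pos
  unfold maxSpeedSq; positivity

end Problem

namespace Mesh

variable (M : Mesh) (D : Problem)

theorem speed_sq_le (i : ℕ) : M.speed D i ^ 2 ≤ D.maxSpeedSq := by
  have := sq_nonneg D.C₁
  have := sq_nonneg D.C₂
  have := sq_nonneg D.C₃
  unfold speed Problem.maxSpeedSq; split_ifs <;> linarith

/-- The trapezoidal bound carries the weights `h_j / 2`. At the cost of the squared speed they
become the cell weights, whose sum at an edge times `ℓ` is `1`; one factor `ℓ` of the squared flux
cancels and the form remains. -/
theorem norm_stiffLp_sq_le (V : ℕ → ℝ) :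
    ‖M.stiffLp D V‖ ^ 2 ≤ D.maxSpeedSq * M.stiffForm D V V := by
  refine (norm_affineLp_sq_le (M.edge_strictMono D) M.Nmax _).trans ?_
  have h1 : ∀ j ∈ Finset.range M.Nmax, (M.edge D (j + 1) - M.edge D j) / 2 *
      (M.stiffFlux D V j ^ 2 + M.stiffFlux D V (j + 1) ^ 2) ≤
      D.maxSpeedSq * (M.cellWeight D j * (M.stiffFlux D V j ^ 2 + M.stiffFlux D V (j + 1) ^ 2)) := by
    intro j _
    rw [← mul_assoc]
    refine mul_le_mul_of_nonneg_right ?_ (by positivity)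
    have hs := (M.speed_pos D (j + 1)).ne'
    have : (M.edge D (j + 1) - M.edge D j) / 2 = M.speed D (j + 1) ^ 2 * M.cellWeight D j := by
      rw [cellWeight]; field_simp
    rw [this]
    exact mul_le_mul_of_nonneg_right (M.speed_sq_le D _) (M.cellWeight_pos D j).le
  refine (Finset.sum_le_sum h1).trans (le_of_eq ?_)
  rw [← Finset.mul_sum, sum_cells_eq_sum_edges (M.cellWeight D) (fun i => M.stiffFlux D V i ^ 2),
    stiffForm_apply]
  congr 1
  refine Finset.sum_congr rfl fun i hi => ?_
  have := M.edgeWeight_mul_ell D (Nat.lt_succ_iff.mp (Finset.mem_range.mp hi))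
  rw [stiffFlux_apply]
  linear_combination (M.ell D i * (V (i + 1) - V i) ^ 2) * this

theorem norm_dampLp_sq_le (V : ℕ → ℝ) :
    ‖M.dampLp D V‖ ^ 2 ≤ D.δ * M.dampForm D V V := by
  refine (norm_affineLp_sq_le (M.edge_strictMono D) M.Nmax _).trans (le_of_eq ?_)
  have := sum_cells_eq_sum_edges (fun j => (M.edge D (j + 1) - M.edge D j) / 2)
    (fun i => M.dampFlux D V i ^ 2) M.Nmax
  change ∑ j ∈ Finset.range M.Nmax, (M.edge D (j + 1) - M.edge D j) / 2 *
    (M.dampFlux D V j ^ 2 + M.dampFlux D V (j + 1) ^ 2) = _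
  rw [this, dampForm_apply, Finset.mul_sum]
  refine Finset.sum_congr rfl fun i hi => ?_
  rw [dampFlux_apply]
  by_cases h : M.viscosity D i = 0
  · simp [h]
  · have := M.halfSize_edgeWeight_of_viscosity_ne_zero D h
    linear_combination (M.viscosity D i * (V (i + 1) - V i) ^ 2) * this

/-! ### Bounds for the discrete data -/

/-- For cell averages `m(V, V)` is the inner product of the step function with `g`, so averaging is
a contraction by Cauchy-Schwarz. -/
theorem massForm_le_of_cellAvg {V : ℕ → ℝ} {g : LineL2}
    (hV : ∀ j < M.Nmax, V (j + 1) = cellAvg (M.edge D) g j) : M.massForm D V V ≤ ‖g‖ ^ 2 := by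
  have h1 : M.massForm D V V = inner ℝ (M.step D V) g := by
    rw [inner_stepLp_cellAvg (M.edge_strictMono D), massForm_apply]
    refine Finset.sum_congr rfl fun j hj => ?_
    rw [← hV j (Finset.mem_range.mp hj)]; ring
  have h2 := real_inner_le_norm (M.step D V) g
  rw [← M.norm_step_sq D] at h1 ⊢
  have h3 := norm_nonneg (M.step D V)
  have h4 := norm_nonneg g
  nlinarith [sq_nonneg (‖M.step D V‖ - ‖g‖)]

/-- Duality: testing the flux with `V` itself gives `b(V, V) = ⟨flux, q⟩ ≤ ‖flux‖ ‖q‖`, and the norm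
of the flux is controlled by the square root of `b(V, V)`, which can then be cancelled. -/
theorem stiffForm_le_of_cellAvg {V : ℕ → ℝ} (hV0 : V ∈ M.ends) {p q : LineL2}
    (h : MemH10 D.L p q) (hV : ∀ j < M.Nmax, V (j + 1) = cellAvg (M.edge D) p j) :
    M.stiffForm D V V ≤ D.maxSpeedSq * ‖q‖ ^ 2 := by
  have h1 := M.sum_diffusion_mul D V hV0
  have h2 : ∑ j ∈ Finset.range M.Nmax, M.diffusion D V (j + 1) * V (j + 1) =
      -inner ℝ (M.stiffLp D V) q := by
    have := sum_flux_mul_cellAvg (M.edge_strictMono D) M.Nmax (M.edge_zero D) (M.edge_Nmax D) h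
      (M.stiffFlux D V)
    refine Eq.trans (Finset.sum_congr rfl fun j hj => ?_) this
    rw [hV j (Finset.mem_range.mp hj), diffusion_succ]
  have h3 := real_inner_le_norm (M.stiffLp D V) q
  have h4 := M.norm_stiffLp_sq_le D V
  have h5 : M.stiffForm D V V = inner ℝ (M.stiffLp D V) q := by linarith
  have h6 := D.maxSpeedSq_pos
  have h7 := norm_nonneg (M.stiffLp D V)
  have h8 := norm_nonneg q
  have h9 := (M.isSymmNonneg_stiffForm D).nonneg V
  have h10 : M.stiffForm D V V ^ 2 ≤
      (D.maxSpeedSq * ‖q‖ ^ 2) * M.stiffForm D V V := by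
    calc M.stiffForm D V V ^ 2 ≤ (‖M.stiffLp D V‖ * ‖q‖) ^ 2 := by
          rw [h5] at h9 ⊢
          exact pow_le_pow_left₀ h9 h3 2
      _ = ‖M.stiffLp D V‖ ^ 2 * ‖q‖ ^ 2 := by ring
      _ ≤ (D.maxSpeedSq * M.stiffForm D V V) * ‖q‖ ^ 2 := by gcongr
      _ = _ := by ring
  rcases h9.eq_or_lt with h0 | h0
  · rw [← h0]; positivity
  · rw [sq] at h10
    exact le_of_mul_le_mul_right h10 h0

theorem cellMean_mem_ends (F : D.L2Triple) : M.cellMean D F ∈ M.ends := by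
  have := M.Nβ_pos
  refine ⟨by simp [cellMean], ?_⟩
  change M.cellMean D F (M.Nmax + 1) = 0
  rw [cellMean, if_neg (by omega), if_neg (by unfold Nmax; omega), if_neg (by unfold Nmax; omega),
    if_neg (by omega)]

theorem cellMean_succ (F : D.L2Triple) {j : ℕ} (hj : j < M.Nmax) :
    M.cellMean D F (j + 1) = cellAvg (M.edge D) (D.glue F) j := by
  have hmono := (M.edge_strictMono D).monotone
  have hlt := M.edge_strictMono D j.lt_succ_self
  have hF := D.coeFn_glue F
  have key : ∀ f : ℝ → ℝ, ∫ s in M.cell D (j + 1), f s =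
      ∫ s in M.edge D j..M.edge D (j + 1), f s := by
    intro f
    rw [intervalIntegral.integral_of_le hlt.le, integral_Ioc_eq_integral_Ioo]
    rfl
  rw [cellAvg, cellMean, if_neg (by omega)]
  simp only [key, cellSize_succ]
  split_ifs with h1 h2 h3
  · rw [setIntegral_eq_of_ae (hF.mono fun x hx => hx.1) (by rw [← M.edge_zero D]; exact hmono j.zero_le)
      hlt.le (by rw [← M.edge_Nα D]; exact hmono h1)]
  · rw [setIntegral_eq_of_ae (hF.mono fun x hx => hx.2.1)
      (by rw [← M.edge_Nα D]; exact hmono (by omega))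
      hlt.le (by rw [← M.edge_Nα_add_N D]; exact hmono h2)]
  · rw [setIntegral_eq_of_ae (hF.mono fun x hx => hx.2.2.1)
      (by rw [← M.edge_Nα_add_N D]; exact hmono (by omega))
      hlt.le (by rw [← M.edge_Nmax D]; exact hmono h3)]
  · omega

/-- The vector of cell averages of a function on the line, extended by zero. -/
def averages (g : LineL2) (i : ℕ) : ℝ :=
  if i = 0 then 0 else if i ≤ M.Nmax then cellAvg (M.edge D) g (i - 1) else 0

theorem averages_mem_ends (g : LineL2) : M.averages D g ∈ M.ends := by
  refine ⟨by simp [averages], ?_⟩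
  change M.averages D g (M.Nmax + 1) = 0
  simp [averages]

theorem averages_succ (g : LineL2) {j : ℕ} (hj : j < M.Nmax) :
    M.averages D g (j + 1) = cellAvg (M.edge D) g j := by
  rw [averages, if_neg (by omega), if_pos (Nat.succ_le_of_lt hj)]; rfl

end Mesh

theorem cellAvg_sub (x : ℕ → ℝ) (f g : LineL2) (j : ℕ) :
    cellAvg x (f - g : LineL2) j = cellAvg x f j - cellAvg x g j := by
  rw [cellAvg, cellAvg, cellAvg, ← sub_div, ← intervalIntegral.integral_sub
    (LineL2.intervalIntegrable f _ _) (LineL2.intervalIntegrable g _ _)]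
  congr 1
  exact intervalIntegral.integral_congr_ae ((Lp.coeFn_sub f g).mono fun s hs _ => hs)

/-! ### The energy bound for the discrete solutions -/

namespace Mesh

variable {M : Mesh} {D : Problem} {T : ℝ} {N : ℕ} {Φ Ψ : D.L2Triple} {U : ℕ → ℕ → ℝ}

theorem sum_range_eq_of_forall {f g : ℕ → ℝ} (M : Mesh)
    (h : ∀ i ∈ Finset.Icc 1 M.Nmax, f i = g i) (W : ℕ → ℝ) :
    ∑ j ∈ Finset.range M.Nmax, f (j + 1) * W (j + 1) =
      ∑ j ∈ Finset.range M.Nmax, g (j + 1) * W (j + 1) :=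
  Finset.sum_congr rfl fun j hj => by
    rw [h (j + 1) (Finset.mem_Icc.mpr ⟨by omega, Finset.mem_range.mp hj⟩)]

theorem IsDiscreteSolution.mem_ends (hU : M.IsDiscreteSolution D T N Φ Ψ U) {n : ℕ} (hn : n ≤ N) :
    U n ∈ M.ends := ⟨hU.left n hn, hU.right n hn⟩

theorem IsDiscreteSolution.first_weak (hU : M.IsDiscreteSolution D T N Φ Ψ U) {τ : ℝ}
    (hτ : 0 < τ) (hτ' : T / N = τ) {W : ℕ → ℝ} (hW : W ∈ M.ends) :
    2 * M.massForm D (U 1 - U 0 - τ • M.cellMean D Ψ) W +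
      τ ^ 2 * M.stiffForm D (U 1 - τ • M.cellMean D Ψ) W +
      τ ^ 2 * M.dampForm D (M.cellMean D Ψ) W = 0 := by
  set ψ := M.cellMean D Ψ
  have h := sum_range_eq_of_forall M hU.first W
  rw [hτ', sum_damping_mul M D ψ hW] at h
  have e : ∑ j ∈ Finset.range M.Nmax, (2 * M.cellSize D (j + 1) * ((U 1 (j + 1) - U 0 (j + 1)) / τ ^ 2)
      - 2 * M.cellSize D (j + 1) / τ * ψ (j + 1) - M.diffusion D (U 1) (j + 1)
      + τ * M.diffusion D ψ (j + 1)) * W (j + 1) =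
      2 / τ ^ 2 * M.massForm D (U 1 - U 0 - τ • ψ) W + M.stiffForm D (U 1 - τ • ψ) W := by
    have h1 := M.sum_diffusion_mul D (U 1) hW
    have h2 := M.sum_diffusion_mul D ψ hW
    simp only [map_sub, map_smul, LinearMap.sub_apply, LinearMap.smul_apply, smul_eq_mul]
    have h3 : M.stiffForm D (U 1) W - τ * M.stiffForm D ψ W =
        ∑ j ∈ Finset.range M.Nmax, (-(M.diffusion D (U 1) (j + 1) * W (j + 1)) +
          τ * (M.diffusion D ψ (j + 1) * W (j + 1))) := by
      rw [Finset.sum_add_distrib, Finset.sum_neg_distrib, ← Finset.mul_sum, h1, h2]; ring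
    rw [h3, massForm_apply, massForm_apply, massForm_apply, Finset.mul_sum,
      ← Finset.sum_sub_distrib, ← Finset.sum_sub_distrib, Finset.mul_sum,
      ← Finset.sum_add_distrib]
    refine Finset.sum_congr rfl fun j _ => ?_
    rw [cellSize_succ]
    field_simp
    ring
  rw [e] at h
  have : τ ^ 2 * (2 / τ ^ 2 * M.massForm D (U 1 - U 0 - τ • ψ) W +
      M.stiffForm D (U 1 - τ • ψ) W + M.dampForm D ψ W) = 0 := by rw [h]; ring
  rw [← this]
  field_simp

theorem IsDiscreteSolution.step_weak (hU : M.IsDiscreteSolution D T N Φ Ψ U) {τ : ℝ}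
    (hτ : 0 < τ) (hτ' : T / N = τ) {n : ℕ} (hn : n + 1 < N) {W : ℕ → ℝ} (hW : W ∈ M.ends) :
    2 * M.massForm D (U (n + 2) - (2 : ℝ) • U (n + 1) + U n) W +
      τ ^ 2 * M.stiffForm D (U (n + 2) + U n) W +
      τ * M.dampForm D (U (n + 2) - U n) W = 0 := by
  have h := sum_range_eq_of_forall M (hU.step (n + 1) (by omega) hn) W
  rw [hτ'] at h
  have hn1 : n + 1 - 1 = n := rfl
  have hn2 : n + 1 + 1 = n + 2 := rfl
  rw [hn1, hn2] at h
  have h1 := M.sum_diffusion_mul D (U (n + 2)) hW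
  have h2 := M.sum_diffusion_mul D (U n) hW
  have h3 := M.sum_damping_mul D (U (n + 2)) hW
  have h4 := M.sum_damping_mul D (U n) hW
  have e1 : ∑ j ∈ Finset.range M.Nmax, (M.cellSize D (j + 1) *
      ((U (n + 2) (j + 1) - 2 * U (n + 1) (j + 1) + U n (j + 1)) / τ ^ 2)
      - 1 / 2 * M.diffusion D (U (n + 2)) (j + 1) - 1 / 2 * M.diffusion D (U n) (j + 1)) * W (j + 1)
      = 1 / τ ^ 2 * M.massForm D (U (n + 2) - (2 : ℝ) • U (n + 1) + U n) W +
        1 / 2 * M.stiffForm D (U (n + 2) + U n) W := by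
    simp only [map_sub, map_add, map_smul, LinearMap.sub_apply, LinearMap.add_apply,
      LinearMap.smul_apply, smul_eq_mul]
    have h5 : M.stiffForm D (U (n + 2)) W + M.stiffForm D (U n) W =
        ∑ j ∈ Finset.range M.Nmax, (-(M.diffusion D (U (n + 2)) (j + 1) * W (j + 1)) -
          (M.diffusion D (U n) (j + 1) * W (j + 1))) := by
      rw [Finset.sum_sub_distrib, Finset.sum_neg_distrib, h1, h2]; ring
    rw [h5, massForm_apply, massForm_apply, massForm_apply, Finset.mul_sum,
      ← Finset.sum_sub_distrib, ← Finset.sum_add_distrib, Finset.mul_sum, Finset.mul_sum,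
      ← Finset.sum_add_distrib]
    refine Finset.sum_congr rfl fun j _ => ?_
    rw [cellSize_succ]
    field_simp
    ring
  have e2 : ∑ j ∈ Finset.range M.Nmax, (1 / (2 * τ) * (M.damping D (U (n + 2)) (j + 1) -
      M.damping D (U n) (j + 1))) * W (j + 1) =
      -(1 / (2 * τ)) * M.dampForm D (U (n + 2) - U n) W := by
    simp only [map_sub, LinearMap.sub_apply]
    have h5 : M.dampForm D (U (n + 2)) W - M.dampForm D (U n) W =
        ∑ j ∈ Finset.range M.Nmax, (-(M.damping D (U (n + 2)) (j + 1) * W (j + 1)) +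
          (M.damping D (U n) (j + 1) * W (j + 1))) := by
      rw [Finset.sum_add_distrib, Finset.sum_neg_distrib, h3, h4]; ring
    rw [h5, Finset.mul_sum]
    refine Finset.sum_congr rfl fun j _ => ?_
    ring
  rw [e1, e2] at h
  have : 2 * τ ^ 2 * (1 / τ ^ 2 * M.massForm D (U (n + 2) - (2 : ℝ) • U (n + 1) + U n) W +
      1 / 2 * M.stiffForm D (U (n + 2) + U n) W +
      (1 / (2 * τ)) * M.dampForm D (U (n + 2) - U n) W) = 0 := by rw [h]; ring
  rw [← this]
  field_simp

end Mesh

/-- The bounds, uniform in the mesh and in the time step, which are satisfied by the discrete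
solutions. -/
structure EnergyBounds (D : Problem) (M : Mesh) (N : ℕ) (τ C : ℝ) (ψ : ℕ → ℝ) (U : ℕ → ℕ → ℝ) :
    Prop where
  velocity : ∀ n < N, M.massForm D (U (n + 1) - U n) (U (n + 1) - U n) ≤ C * τ ^ 2
  stiff_zero : M.stiffForm D (U 1 - τ • ψ) (U 1 - τ • ψ) ≤ C
  stiff : ∀ n, n + 1 < N → M.stiffForm D (U (n + 2) + U n) (U (n + 2) + U n) ≤ C
  damp : ∑ n ∈ Finset.range (N - 1), M.dampForm D (U (n + 2) - U n) (U (n + 2) - U n) ≤ C * τ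
  mass_init : M.massForm D ψ ψ ≤ C
  damp_init : M.dampForm D ψ ψ ≤ C

/-- The hypotheses of `energy_estimate` are checked with a constant depending only on the problem,
`T` and the data. Smoothing in layers of fixed width bounds the damping form of the initial
velocity; smoothing in layers of width proportional to `τ²` provides `r`. -/
theorem exists_energyBounds (D : Problem) {T : ℝ} (hT : 0 < T) {Φ Ψ : D.L2Triple}
    (hΦ : D.MemH1L Φ) (hΨ : D.MemH1 Ψ) :
    ∃ C : ℝ, 0 ≤ C ∧ ∀ (M : Mesh) (N : ℕ) (U : ℕ → ℕ → ℝ), 0 < N →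
      M.IsDiscreteSolution D T N Φ Ψ U →
      EnergyBounds D M N (T / N) C (M.cellMean D Ψ) U := by
  obtain ⟨⟨Φx, hΦx⟩, hΦb⟩ := hΦ
  obtain ⟨Ψx, hΨx⟩ := hΨ
  have hΦ10 := D.memH10_glue hΦx hΦb
  obtain ⟨K₀, hK₀, hnear⟩ := D.exists_memH10_near hΨx
  set c := D.maxSpeedSq
  have hc : 0 < c := D.maxSpeedSq_pos
  set κ := D.δ / D.C₂ ^ 2 with hκ
  have hκ0 : 0 < κ := div_pos D.δ_pos (pow_pos D.C₂_pos 2)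
  set w₀ := min D.α (D.L - D.β) with hw₀
  have hw₀pos : 0 < w₀ := lt_min D.α_pos (sub_pos.mpr D.β_lt_L)
  set s := √w₀ with hs
  have hspos : 0 < s := Real.sqrt_pos.mpr hw₀pos
  set g := ‖D.glue Ψx‖ with hg
  set G₀ := g + K₀ / s
  -- The five terms bound, in this order, `b(U 0, U 0)`, `m(ψ, ψ)`, `a(ψ, ψ)`, `m(r, r) / τ²` and
  -- `τ² b(ψ - r, ψ - r)`.
  set K := c * ‖D.glue Φx‖ ^ 2 + ‖D.glue Ψ‖ ^ 2 + κ * (c * G₀ ^ 2) + (K₀ * s / T) ^ 2 +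
    c * (T * g + K₀ * T / s) ^ 2 with hK
  have k1 : 0 ≤ c * ‖D.glue Φx‖ ^ 2 := by positivity
  have k2 : 0 ≤ ‖D.glue Ψ‖ ^ 2 := by positivity
  have k3 : 0 ≤ κ * (c * G₀ ^ 2) := by positivity
  have k4 : 0 ≤ (K₀ * s / T) ^ 2 := by positivity
  have k5 : 0 ≤ c * (T * g + K₀ * T / s) ^ 2 := by positivity
  have hK0 : 0 ≤ K := by positivity
  have hCK : K ≤ energyBound T K κ := by
    have : energyBound T K κ = K + (207 * K + 16 * (K * (6 * κ + 3 * T ^ 2)) +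
      128 * (T ^ 2 * K) + 4 * K * T ^ 2) := by unfold energyBound; ring
    rw [this]
    have : 0 ≤ 207 * K + 16 * (K * (6 * κ + 3 * T ^ 2)) + 128 * (T ^ 2 * K) + 4 * K * T ^ 2 := by
      positivity
    linarith
  refine ⟨energyBound T K κ, hK0.trans hCK, fun M N U hN hU => ?_⟩
  set τ := T / N with hτ
  have hNr : (0 : ℝ) < N := by exact_mod_cast hN
  have hτ0 : 0 < τ := div_pos hT hNr
  have hNτ : N * τ = T := mul_div_cancel₀ _ hNr.ne'
  have hτT : τ ≤ T := by
    have : (1 : ℝ) ≤ N := by exact_mod_cast hN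
    exact div_le_self hT.le this
  set ψ := M.cellMean D Ψ with hψ
  have hψe : ψ ∈ M.ends := M.cellMean_mem_ends D Ψ
  -- The viscosity is nonzero only at edges both of whose neighbouring cells lie in `(α, β)`; there
  -- the cell averages of `Ψ` and of its smoothing coincide.
  have damp_congr : ∀ p : LineL2,
      (∀ᵐ x ∂(volume : Measure ℝ), x ∈ Ioo D.α D.β → D.glue Ψ x = p x) →
      ∀ i, M.viscosity D i ≠ 0 →
        (ψ - M.averages D p) (i + 1) = 0 ∧ (ψ - M.averages D p) i = 0 := by
    intro p hp i hi
    have hi' : M.Nα + 1 ≤ i ∧ i < M.Nα + M.N := by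
      by_contra hcon
      exact hi (if_neg hcon)
    have key : ∀ j, M.Nα ≤ j → j < M.Nα + M.N → (ψ - M.averages D p) (j + 1) = 0 := by
      intro j h1 h2
      have hj : j < M.Nmax := by unfold Mesh.Nmax; omega
      rw [Pi.sub_apply, hψ, M.cellMean_succ D Ψ hj, M.averages_succ D p hj, cellAvg, cellAvg,
        setIntegral_eq_of_ae hp (by rw [← M.edge_Nα D]; exact (M.edge_strictMono D).monotone h1)
        (M.edge_strictMono D j.lt_succ_self).le
        (by rw [← M.edge_Nα_add_N D]; exact (M.edge_strictMono D).monotone h2), sub_self]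
    obtain ⟨k, rfl⟩ : ∃ k, i = k + 1 := ⟨i - 1, by omega⟩
    exact ⟨key (k + 1) (by omega) hi'.2, key k (by omega) (by omega)⟩
  have damp_zero : ∀ p : LineL2,
      (∀ᵐ x ∂(volume : Measure ℝ), x ∈ Ioo D.α D.β → D.glue Ψ x = p x) →
      ∀ V, M.dampForm D (ψ - M.averages D p) V = 0 := by
    intro p hp V
    rw [Mesh.dampForm_apply]
    refine Finset.sum_eq_zero fun i _ => ?_
    by_cases hi : M.viscosity D i = 0
    · rw [hi, zero_mul]
    · obtain ⟨h1, h2⟩ := damp_congr p hp i hi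
      rw [h1, h2]; ring
  have stiff_avg : ∀ p q : LineL2, MemH10 D.L p q →
      M.stiffForm D (M.averages D p) (M.averages D p) ≤ c * ‖q‖ ^ 2 := fun p q hpq =>
    M.stiffForm_le_of_cellAvg D (M.averages_mem_ends D p) hpq fun j hj => M.averages_succ D p hj
  -- The damping does not distinguish `ψ` from the averages of a fixed `p ∈ H¹₀`, for which `a ≤ κ
  -- b` and the elastic form is bounded by `‖p'‖²`.
  have damp_init : M.dampForm D ψ ψ ≤ K := by
    obtain ⟨p, q, hpq, hp, -, hq⟩ := hnear w₀ hw₀pos (min_le_left _ _) (min_le_right _ _)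
    have e1 : ψ = (ψ - M.averages D p) + M.averages D p := by abel
    have e2 : M.dampForm D ψ ψ = M.dampForm D (M.averages D p) (M.averages D p) := by
      have := damp_zero p hp
      rw [e1]
      simp only [map_add, LinearMap.add_apply, this]
      rw [(M.isSymmNonneg_dampForm D).symm _ (ψ - M.averages D p), this]
      ring
    rw [e2]
    calc M.dampForm D (M.averages D p) (M.averages D p)
        ≤ κ * M.stiffForm D (M.averages D p) (M.averages D p) := M.dampForm_le D _
      _ ≤ κ * (c * ‖q‖ ^ 2) := by gcongr; exact stiff_avg p q hpq
      _ ≤ κ * (c * G₀ ^ 2) := by gcongr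
      _ ≤ K := by rw [hK]; linarith
  have mass_init : M.massForm D ψ ψ ≤ K :=
    (M.massForm_le_of_cellAvg D fun j hj => M.cellMean_succ D Ψ hj).trans (by rw [hK]; linarith)
  have stiff_init : M.stiffForm D (U 0) (U 0) ≤ K := by
    have : M.stiffForm D (U 0) (U 0) ≤ c * ‖D.glue Φx‖ ^ 2 :=
      M.stiffForm_le_of_cellAvg D (hU.mem_ends (Nat.zero_le _)) hΦ10 fun j hj => by
        rw [hU.init (j + 1) (Finset.mem_Icc.mpr ⟨by omega, hj⟩), M.cellMean_succ D Φ hj]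
    exact this.trans (by rw [hK]; linarith)
  -- The width balancing both requirements: `√w` is of order `τ`, so the removed part has norm
  -- `O(τ)` and `τ ‖p'‖` stays bounded. The factor `w₀` and `τ ≤ T` keep the layers inside `(0, α)`
  -- and `(β, L)`.
  set w := w₀ * (τ / T) ^ 2 with hw
  have hwpos : 0 < w := by positivity
  have hww₀ : w ≤ w₀ := by
    apply mul_le_of_le_one_right hw₀pos.le
    apply pow_le_one₀ (by positivity)
    rw [div_le_one hT]; exact hτT
  have hsw : √w = s * (τ / T) := by
    rw [hw, Real.sqrt_mul hw₀pos.le, Real.sqrt_sq (by positivity)]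
  obtain ⟨p, q, hpq, hp, hp2, hq⟩ := hnear w hwpos (hww₀.trans (min_le_left _ _))
    (hww₀.trans (min_le_right _ _))
  rw [hsw] at hp2 hq
  set r := ψ - M.averages D p with hr
  have hψr : ψ - r = M.averages D p := by rw [hr]; abel
  have hmr : M.massForm D r r ≤ K * τ ^ 2 := by
    have h1 : M.massForm D r r ≤ ‖D.glue Ψ - p‖ ^ 2 :=
      M.massForm_le_of_cellAvg D fun j hj => by
        rw [cellAvg_sub, hr, Pi.sub_apply, M.averages_succ D p hj, hψ, M.cellMean_succ D Ψ hj]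
    calc M.massForm D r r ≤ ‖D.glue Ψ - p‖ ^ 2 := h1
      _ ≤ (K₀ * (s * (τ / T))) ^ 2 := by gcongr
      _ = (K₀ * s / T) ^ 2 * τ ^ 2 := by ring
      _ ≤ K * τ ^ 2 := by gcongr; rw [hK]; linarith
  have hbr : τ ^ 2 * M.stiffForm D (ψ - r) (ψ - r) ≤ K := by
    rw [hψr]
    calc τ ^ 2 * M.stiffForm D (M.averages D p) (M.averages D p)
        ≤ τ ^ 2 * (c * ‖q‖ ^ 2) := by gcongr; exact stiff_avg p q hpq
      _ = c * (τ * ‖q‖) ^ 2 := by ring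
      _ ≤ c * (τ * (g + K₀ / (s * (τ / T)))) ^ 2 := by gcongr
      _ = c * (τ * g + K₀ * T / s) ^ 2 := by congr 2; field_simp
      _ ≤ c * (T * g + K₀ * T / s) ^ 2 := by gcongr
      _ ≤ K := by rw [hK]; linarith
  obtain ⟨h1, h2, h3, h4⟩ := energy_estimate (M.isSymmNonneg_massForm D)
    (M.isSymmNonneg_stiffForm D) (M.isSymmNonneg_dampForm D) hκ0 hτ0 hN hNτ (M.dampForm_le D)
    M.ends (fun n hn => hU.mem_ends hn) hψe (M.ends.sub_mem hψe (M.averages_mem_ends D p))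
    stiff_init mass_init damp_init hmr hbr (damp_zero p hp)
    (fun W hW => hU.first_weak hτ0 rfl hW) (fun n hn W hW => hU.step_weak hτ0 rfl hn hW)
  exact ⟨h1, h2, h3, h4, mass_init.trans hCK, damp_init.trans hCK⟩

/-! ### Consistency of the discrete fluxes -/

/-- Up to the error of the trapezoidal rule, the flux `k (V (i + 1) - V i)` tested with `ρ φ` equals
the sum over edges of weight times flux times `φ`. As weight times `k` is `1` wherever `φ` does not
vanish, this is the sum of the jumps of `V` times `φ`, which summation by parts turns into the
pairing of the step function with `-φ'`. The coefficients are left general to serve diffusion and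
damping together. -/
theorem abs_sum_flux_add_le {x : ℕ → ℝ} (hx : StrictMono x) (M : ℕ) {δ : ℝ}
    (hδ : ∀ j < M, x (j + 1) - x j ≤ δ) {ρ k V : ℕ → ℝ} (hρ : ∀ j, 0 ≤ ρ j)
    (hV0 : V 0 = 0) (hV1 : V (M + 1) = 0) {φ φ' : C(ℝ, ℝ)} (hφ : ∀ s, HasDerivAt φ (φ' s) s)
    {K : ℝ} (hK : ∀ s, |φ' s| ≤ K) (hk0 : ∀ i, 0 ≤ k i)
    (hk1 : ∀ i ≤ M, edgeWeight (fun j => (x (j + 1) - x j) / 2 * ρ j) M i * k i ≤ 1)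
    (hk : ∀ i ≤ M, φ (x i) ≠ 0 → edgeWeight (fun j => (x (j + 1) - x j) / 2 * ρ j) M i * k i = 1) :
    |∑ j ∈ Finset.range M, ρ j * (∫ s in x j..x (j + 1),
        (k j * (V (j + 1) - V j) * leftHat x j s +
          k (j + 1) * (V (j + 1 + 1) - V (j + 1)) * rightHat x j s) * φ s) +
      inner ℝ (stepLp x M V) (windowLp (x 0) (x M) φ')| ≤
      K * δ * (1 / 2 * (∑ j ∈ Finset.range M, (x (j + 1) - x j) * ρ j +
        ∑ i ∈ Finset.range (M + 1), k i * ((V (i + 1) - V i) * (V (i + 1) - V i)))) := by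
  set w : ℕ → ℝ := fun j => (x (j + 1) - x j) / 2 * ρ j with hw
  set f : ℕ → ℝ := fun i => k i * (V (i + 1) - V i) with hf
  have hlip : ∀ s t, |φ s - φ t| ≤ K * |s - t| := by
    intro s t
    have := Convex.norm_image_sub_le_of_norm_hasDerivWithin_le (f := φ) (f' := φ') (s := univ)
      (C := K) (x := t) (y := s) (fun s _ => (hφ s).hasDerivWithinAt) (fun s _ => hK s)
      convex_univ (mem_univ _) (mem_univ _)
    simpa [Real.norm_eq_abs] using this
  have hK0 : 0 ≤ K := (abs_nonneg _).trans (hK 0)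
  have hh : ∀ j, 0 < x (j + 1) - x j := fun j => sub_pos.mpr (hx j.lt_succ_self)
  have hw0 : ∀ j, 0 ≤ w j := fun j => mul_nonneg (half_pos (hh j)).le (hρ j)
  have hew : ∀ i, 0 ≤ edgeWeight w M i := by
    intro i
    have := hw0 (i - 1)
    have := hw0 i
    unfold edgeWeight
    split_ifs <;> linarith
  have e1 : inner ℝ (stepLp x M V) (windowLp (x 0) (x M) φ') =
      -∑ j ∈ Finset.range M, ρ j * ((x (j + 1) - x j) / 2 *
        (f j * φ (x j) + f (j + 1) * φ (x (j + 1)))) := by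
    rw [inner_stepLp_windowLp_deriv hx M V hφ, ← neg_eq_iff_eq_neg,
      ← sum_mul_diff_eq (fun i => φ (x i)) V M hV0 hV1]
    have := sum_cells_eq_sum_edges w (fun i => f i * φ (x i)) M
    calc ∑ i ∈ Finset.range (M + 1), φ (x i) * (V (i + 1) - V i)
        = ∑ i ∈ Finset.range (M + 1), edgeWeight w M i * (f i * φ (x i)) := by
          refine Finset.sum_congr rfl fun i hi => ?_
          by_cases h : φ (x i) = 0
          · rw [h]; ring
          · have := hk i (Nat.lt_succ_iff.mp (Finset.mem_range.mp hi)) h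
            rw [hf]
            linear_combination -(V (i + 1) - V i) * φ (x i) * this
      _ = _ := by
          rw [← this]
          refine Finset.sum_congr rfl fun j _ => ?_
          rw [hw]; ring
  rw [e1, ← sub_eq_add_neg, ← Finset.sum_sub_distrib]
  calc |∑ j ∈ Finset.range M, (ρ j * (∫ s in x j..x (j + 1),
        (k j * (V (j + 1) - V j) * leftHat x j s +
          k (j + 1) * (V (j + 1 + 1) - V (j + 1)) * rightHat x j s) * φ s) -
          ρ j * ((x (j + 1) - x j) / 2 * (f j * φ (x j) + f (j + 1) * φ (x (j + 1)))))|
      ≤ ∑ j ∈ Finset.range M, K * δ * (w j * (|f j| + |f (j + 1)|)) := by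
        refine (Finset.abs_sum_le_sum_abs _ _).trans (Finset.sum_le_sum fun j hj => ?_)
        rw [← mul_sub, abs_mul, abs_of_nonneg (hρ j)]
        have h1 := abs_integral_hat_sub_le hx j φ hlip (f j) (f (j + 1))
        have h2 : 0 ≤ w j * (|f j| + |f (j + 1)|) := mul_nonneg (hw0 j) (by positivity)
        calc _ ≤ ρ j * (K * (x (j + 1) - x j) *
              ((x (j + 1) - x j) / 2 * (|f j| + |f (j + 1)|))) :=
              mul_le_mul_of_nonneg_left h1 (hρ j)
          _ = K * (x (j + 1) - x j) * (w j * (|f j| + |f (j + 1)|)) := by rw [hw]; ring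
          _ ≤ _ := by
              gcongr
              exact hδ j (Finset.mem_range.mp hj)
    _ = K * δ * ∑ i ∈ Finset.range (M + 1), edgeWeight w M i * |f i| := by
        rw [← Finset.mul_sum, sum_cells_eq_sum_edges w (fun i => |f i|)]
    _ ≤ _ := by
        -- Without cells nothing fixes the sign of `δ`, but then the only jump is zero by the
        -- boundary values.
        rcases Nat.eq_zero_or_pos M with hM | hM
        · subst hM
          have : edgeWeight w 0 0 = 0 := by simp [edgeWeight]
          have h0 : V 1 = 0 := hV1
          simp [this, h0, hV0]
        have hδ0 : 0 ≤ δ := (hh 0).le.trans (hδ 0 hM)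
        refine mul_le_mul_of_nonneg_left ?_ (mul_nonneg hK0 hδ0)
        have e2 : ∑ j ∈ Finset.range M, (x (j + 1) - x j) * ρ j =
            ∑ i ∈ Finset.range (M + 1), edgeWeight w M i := by
          have := sum_cells_eq_sum_edges w (fun _ => 1) M
          simp only [mul_one] at this
          rw [← this]
          refine Finset.sum_congr rfl fun j _ => ?_
          rw [hw]; ring
        rw [e2, ← Finset.sum_add_distrib, Finset.mul_sum]
        refine Finset.sum_le_sum fun i hi => ?_
        have h1 := hk1 i (Nat.lt_succ_iff.mp (Finset.mem_range.mp hi))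
        have h2 := hew i
        have h3 : edgeWeight w M i * f i ^ 2 ≤ k i * ((V (i + 1) - V i) * (V (i + 1) - V i)) := by
          calc edgeWeight w M i * f i ^ 2
              = edgeWeight w M i * k i * (k i * ((V (i + 1) - V i) * (V (i + 1) - V i))) := by
                rw [hf]; ring
            _ ≤ 1 * (k i * ((V (i + 1) - V i) * (V (i + 1) - V i))) :=
                mul_le_mul_of_nonneg_right h1 (mul_nonneg (hk0 i) (mul_self_nonneg _))
            _ = _ := one_mul _
        -- The error is linear in the flux; this makes it quadratic, so that the energy form
        -- controls it.
        have h4 : |f i| ≤ 1 / 2 * (1 + f i ^ 2) := by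
          rw [← sq_abs]; nlinarith [sq_nonneg (|f i| - 1)]
        have h5 := mul_le_mul_of_nonneg_left h4 h2
        linarith

namespace Problem

variable (D : Problem)

/-- The function `φ / c²` on `(0, L)`. -/
def slowness (φ : C(ℝ, ℝ)) : LineL2 :=
  (D.C₁ ^ 2)⁻¹ • windowLp 0 D.α φ + (D.C₂ ^ 2)⁻¹ • windowLp D.α D.β φ +
    (D.C₃ ^ 2)⁻¹ • windowLp D.β D.L φ

end Problem

namespace Mesh

variable (M : Mesh) (D : Problem)

theorem sum_edge_sub : ∑ j ∈ Finset.range M.Nmax, (M.edge D (j + 1) - M.edge D j) = D.L := by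
  rw [Finset.sum_range_sub, edge_zero, edge_Nmax, sub_zero]

theorem inner_affineLp_slowness (f : ℕ → ℝ) (φ : C(ℝ, ℝ)) :
    inner ℝ (affineLp (M.edge D) M.Nmax f) (D.slowness φ) = ∑ j ∈ Finset.range M.Nmax,
      (M.speed D (j + 1) ^ 2)⁻¹ * ∫ s in M.edge D j..M.edge D (j + 1),
        (f j * leftHat (M.edge D) j s + f (j + 1) * rightHat (M.edge D) j s) * φ s := by
  set I : ℕ → ℝ := fun j => ∫ s in M.edge D j..M.edge D (j + 1),
        (f j * leftHat (M.edge D) j s + f (j + 1) * rightHat (M.edge D) j s) * φ s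
  have hm := M.edge_strictMono D
  have h1 := inner_affineLp_windowLp hm M.Nmax (p := 0) (q := M.Nα) (by unfold Nmax; omega) f φ
  have h2 := inner_affineLp_windowLp hm M.Nmax (p := M.Nα) (q := M.Nα + M.N)
    (by unfold Nmax; omega) f φ
  have h3 := inner_affineLp_windowLp hm M.Nmax (p := M.Nα + M.N) (q := M.Nmax) le_rfl f φ
  rw [edge_zero, edge_Nα] at h1
  rw [edge_Nα, edge_Nα_add_N] at h2
  rw [edge_Nmax, edge_Nα_add_N] at h3
  rw [Problem.slowness, inner_add_right, inner_add_right, inner_smul_right, inner_smul_right,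
    inner_smul_right, h1, h2, h3, Finset.range_eq_Ico, ← Finset.sum_Ico_consecutive _ (Nat.zero_le (M.Nα + M.N))
      (show M.Nα + M.N ≤ M.Nmax by unfold Nmax; omega),
    ← Finset.sum_Ico_consecutive _ (Nat.zero_le M.Nα) (Nat.le_add_right M.Nα M.N),
    Finset.mul_sum, Finset.mul_sum, Finset.mul_sum]
  congr 1
  · congr 1
    · refine Finset.sum_congr rfl fun j hj => ?_
      have := Finset.mem_Ico.mp hj
      rw [speed, if_pos (by omega)]
    · refine Finset.sum_congr rfl fun j hj => ?_
      have := Finset.mem_Ico.mp hj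
      rw [speed, if_neg (by omega), if_pos (by omega)]
  · refine Finset.sum_congr rfl fun j hj => ?_
    have := Finset.mem_Ico.mp hj
    rw [speed, if_neg (by omega), if_neg (by omega)]

/-- This will give the weak relation between elastic flux and gradient in the limit. No boundary
condition is imposed on `φ`, so the relation also carries the Dirichlet conditions and the absence
of jumps. -/
theorem exists_consistency_stiffLp {φ φ' : C(ℝ, ℝ)} (hφ : ∀ s, HasDerivAt φ (φ' s) s)
    {K : ℝ} (hK : ∀ s, |φ' s| ≤ K) (D : Problem) :
    ∃ C, 0 ≤ C ∧ ∀ (M : Mesh), ∀ V ∈ M.ends,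
      |inner ℝ (M.stiffLp D V) (D.slowness φ) + inner ℝ (M.step D V) (windowLp 0 D.L φ')| ≤
        C * M.size D * (1 + M.stiffForm D V V) := by
  have hK0 : 0 ≤ K := (abs_nonneg _).trans (hK 0)
  set r := (D.C₁ ^ 2)⁻¹ + (D.C₂ ^ 2)⁻¹ + (D.C₃ ^ 2)⁻¹ with hr
  have r1 : 0 ≤ (D.C₁ ^ 2)⁻¹ := by positivity
  have r2 : 0 ≤ (D.C₂ ^ 2)⁻¹ := by positivity
  have r3 : 0 ≤ (D.C₃ ^ 2)⁻¹ := by positivity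
  have hL := D.L_pos
  refine ⟨K * (1 / 2 * (D.L * r + 1)), by positivity, fun M V hV => ?_⟩
  have h := abs_sum_flux_add_le (M.edge_strictMono D) M.Nmax (δ := M.size D)
    (fun j hj => M.edge_succ_sub_le_size D hj) (ρ := fun j => (M.speed D (j + 1) ^ 2)⁻¹)
    -- Nonnegativity is required for all indices, whereas positivity of `ell` is available up to
    -- `Nmax`; larger indices do not enter the sums.
    (k := fun i => if i ≤ M.Nmax then M.ell D i else 0) (V := V)
    (fun j => by positivity) hV.1 hV.2 hφ hK
    (fun i => by
      split_ifs with hi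
      · exact (M.ell_pos D hi).le
      · exact le_rfl)
    (fun i hi => by rw [if_pos hi]; exact (M.edgeWeight_mul_ell D hi).le)
    (fun i hi _ => by rw [if_pos hi]; exact M.edgeWeight_mul_ell D hi)
  rw [stiffLp, LinearMap.comp_apply, inner_affineLp_slowness]
  rw [edge_zero, edge_Nmax] at h
  have e1 : ∑ i ∈ Finset.range (M.Nmax + 1), (if i ≤ M.Nmax then M.ell D i else 0) *
      ((V (i + 1) - V i) * (V (i + 1) - V i)) = M.stiffForm D V V := by
    rw [stiffForm_apply]
    refine Finset.sum_congr rfl fun i hi => ?_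
    rw [if_pos (Nat.lt_succ_iff.mp (Finset.mem_range.mp hi))]
  have e2 : ∑ j ∈ Finset.range M.Nmax, (M.edge D (j + 1) - M.edge D j) *
      (M.speed D (j + 1) ^ 2)⁻¹ ≤ D.L * r := by
    rw [← M.sum_edge_sub D, Finset.sum_mul]
    refine Finset.sum_le_sum fun j _ => mul_le_mul_of_nonneg_left ?_
      (sub_pos.mpr (M.edge_strictMono D j.lt_succ_self)).le
    unfold speed
    split_ifs <;> linarith
  have e3 : ∑ j ∈ Finset.range M.Nmax, (M.speed D (j + 1) ^ 2)⁻¹ *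
      (∫ s in M.edge D j..M.edge D (j + 1), (M.stiffFlux D V j * leftHat (M.edge D) j s +
        M.stiffFlux D V (j + 1) * rightHat (M.edge D) j s) * φ s) =
      ∑ j ∈ Finset.range M.Nmax, (M.speed D (j + 1) ^ 2)⁻¹ *
      (∫ s in M.edge D j..M.edge D (j + 1),
        ((if j ≤ M.Nmax then M.ell D j else 0) * (V (j + 1) - V j) * leftHat (M.edge D) j s +
        (if j + 1 ≤ M.Nmax then M.ell D (j + 1) else 0) * (V (j + 1 + 1) - V (j + 1)) *
          rightHat (M.edge D) j s) * φ s) := by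
    refine Finset.sum_congr rfl fun j hj => ?_
    have hj := Finset.mem_range.mp hj
    rw [if_pos hj.le, if_pos (Nat.succ_le_of_lt hj), stiffFlux_apply, stiffFlux_apply]
  rw [e3]
  refine h.trans ?_
  rw [e1]
  have hs := (M.size_pos D).le
  have hf := (M.isSymmNonneg_stiffForm D).nonneg V
  have hLr : 0 ≤ D.L * r := by positivity
  calc _ ≤ K * M.size D * (1 / 2 * ((D.L * r + 1) * (1 + M.stiffForm D V V))) := by
        gcongr
        nlinarith
    _ = _ := by ring

/-- At the edges `α`, `β` and outside `(α, β)` the viscosity vanishes, so weight times coefficient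
is not `1` there. The support condition makes `φ` zero at those edges. -/
theorem exists_consistency_dampLp {φ φ' : C(ℝ, ℝ)} (hφ : ∀ s, HasDerivAt φ (φ' s) s)
    {K : ℝ} (hK : ∀ s, |φ' s| ≤ K) (D : Problem) (hsupp : ∀ s, φ s ≠ 0 → s ∈ Ioo D.α D.β) :
    ∃ C, 0 ≤ C ∧ ∀ (M : Mesh), ∀ V ∈ M.ends,
      |inner ℝ (M.dampLp D V) (D.δ⁻¹ • windowLp 0 D.L φ) +
        inner ℝ (M.step D V) (windowLp 0 D.L φ')| ≤
        C * M.size D * (1 + M.dampForm D V V) := by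
  have hK0 : 0 ≤ K := (abs_nonneg _).trans (hK 0)
  have hδ := D.δ_pos
  have hL := D.L_pos
  refine ⟨K * (1 / 2 * (D.L * D.δ⁻¹ + 1)), by positivity, fun M V hV => ?_⟩
  have hew : ∀ i, edgeWeight (fun j => (M.edge D (j + 1) - M.edge D j) / 2 * D.δ⁻¹) M.Nmax i =
      D.δ⁻¹ * edgeWeight (fun j => (M.edge D (j + 1) - M.edge D j) / 2) M.Nmax i := by
    intro i
    unfold edgeWeight
    split_ifs <;> ring
  have hone : ∀ i, M.viscosity D i ≠ 0 →
      edgeWeight (fun j => (M.edge D (j + 1) - M.edge D j) / 2 * D.δ⁻¹) M.Nmax i *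
        M.viscosity D i = 1 := by
    intro i hi
    rw [hew, mul_assoc, M.halfSize_edgeWeight_of_viscosity_ne_zero D hi, inv_mul_cancel₀ hδ.ne']
  have h := abs_sum_flux_add_le (M.edge_strictMono D) M.Nmax (δ := M.size D)
    (fun j hj => M.edge_succ_sub_le_size D hj) (ρ := fun _ => D.δ⁻¹)
    (k := M.viscosity D) (V := V)
    (fun j => by positivity) hV.1 hV.2 hφ hK (M.viscosity_nonneg D)
    (fun i _ => by
      by_cases hi : M.viscosity D i = 0
      · rw [hi]; simp
      · exact (hone i hi).le)
    (fun i _ hi => by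
      refine hone i ?_
      have h1 := hsupp _ hi
      rw [← M.edge_Nα D, ← M.edge_Nα_add_N D, mem_Ioo, (M.edge_strictMono D).lt_iff_lt,
        (M.edge_strictMono D).lt_iff_lt] at h1
      rw [viscosity, if_pos ⟨h1.1, h1.2⟩]
      exact (div_pos hδ (M.h_pos D)).ne')
  have e0 := inner_affineLp_windowLp (M.edge_strictMono D) M.Nmax (p := 0) le_rfl
    (M.dampFlux D V) φ
  rw [edge_zero, edge_Nmax] at e0
  rw [dampLp, LinearMap.comp_apply, inner_smul_right, e0, Finset.mul_sum, ← Finset.range_eq_Ico]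
  rw [edge_zero, edge_Nmax, ← dampForm_apply, ← Finset.sum_mul, sum_edge_sub] at h
  refine h.trans ?_
  have hs := (M.size_pos D).le
  have hf := (M.isSymmNonneg_dampForm D).nonneg V
  have hLr : 0 ≤ D.L * D.δ⁻¹ := by positivity
  calc _ ≤ K * M.size D * (1 / 2 * ((D.L * D.δ⁻¹ + 1) * (1 + M.dampForm D V V))) := by
        gcongr
        nlinarith
    _ = _ := by ring

/-! ### The scheme in `L²` -/

theorem inner_step_eq_massForm (V : ℕ → ℝ) (p : LineL2) :
    inner ℝ (M.step D V) p = M.massForm D V (M.averages D p) := by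
  rw [inner_stepLp_cellAvg (M.edge_strictMono D), massForm_apply]
  refine Finset.sum_congr rfl fun j hj => ?_
  rw [M.averages_succ D p (Finset.mem_range.mp hj)]; ring

/-- Summation by parts on the mesh combined with the exact identity `sum_flux_mul_cellAvg`. -/
theorem stiffForm_averages (V : ℕ → ℝ) {p q : LineL2} (h : MemH10 D.L p q) :
    M.stiffForm D V (M.averages D p) = inner ℝ (M.stiffLp D V) q := by
  have h1 := M.sum_diffusion_mul D V (M.averages_mem_ends D p)
  have h2 := sum_flux_mul_cellAvg (M.edge_strictMono D) M.Nmax (M.edge_zero D) (M.edge_Nmax D) h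
      (M.stiffFlux D V)
  rw [stiffLp, LinearMap.comp_apply, ← neg_inj, ← h1, ← h2]
  refine Finset.sum_congr rfl fun j hj => ?_
  rw [M.averages_succ D p (Finset.mem_range.mp hj), diffusion_succ]

theorem dampForm_averages (V : ℕ → ℝ) {p q : LineL2} (h : MemH10 D.L p q) :
    M.dampForm D V (M.averages D p) = inner ℝ (M.dampLp D V) q := by
  have h1 := M.sum_damping_mul D V (M.averages_mem_ends D p)
  have h2 := sum_flux_mul_cellAvg (M.edge_strictMono D) M.Nmax (M.edge_zero D) (M.edge_Nmax D) h
      (M.dampFlux D V)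
  rw [dampLp, LinearMap.comp_apply, ← neg_inj, ← h1, ← h2]
  refine Finset.sum_congr rfl fun j hj => ?_
  rw [M.averages_succ D p (Finset.mem_range.mp hj), damping_succ]

end Mesh

/-! ### The arguments of inertia, diffusion and damping along the time steps. -/

section Sequences

variable (τ : ℝ) (ψ : ℕ → ℝ) (U : ℕ → ℕ → ℝ)

/-- The difference quotients in time, preceded by the initial velocity. -/
def velocity : ℕ → ℕ → ℝ
  | 0 => ψ
  | n + 1 => τ⁻¹ • (U (n + 1) - U n)

/-- Twice the vector which the diffusion is applied to in the `n`-th step. -/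
def stiffArg : ℕ → ℕ → ℝ
  | 0 => U 1 - τ • ψ
  | n + 1 => U (n + 2) + U n

/-- The vector which the damping is applied to in the `n`-th step, times `2 τ`. -/
def dampArg : ℕ → ℕ → ℝ
  | 0 => τ • ψ
  | n + 1 => U (n + 2) - U n

variable {τ}

theorem smul_velocity_succ (hτ : τ ≠ 0) (n : ℕ) :
    τ • velocity τ ψ U (n + 1) = U (n + 1) - U n := by
  rw [velocity, smul_inv_smul₀ hτ]

theorem sum_dampArg (n : ℕ) : ∑ k ∈ Finset.range (n + 1), dampArg τ ψ U k =
    τ • ψ + (U (n + 1) + U n - U 1 - U 0) := by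
  induction n with
  | zero => simp [dampArg]
  | succ n ih => rw [Finset.sum_range_succ, ih, dampArg]; abel

end Sequences

namespace Mesh

variable {M : Mesh} {D : Problem} {T : ℝ} {N : ℕ} {Φ Ψ : D.L2Triple} {U : ℕ → ℕ → ℝ} {τ : ℝ}

/-- The velocities as functions on the line. -/
def velLp (M : Mesh) (D : Problem) (τ : ℝ) (ψ : ℕ → ℝ) (U : ℕ → ℕ → ℝ) (n : ℕ) : LineL2 :=
  M.step D (velocity τ ψ U n)

/-- The elastic flux in the `n`-th step. -/
def elasticLp (M : Mesh) (D : Problem) (τ : ℝ) (ψ : ℕ → ℝ) (U : ℕ → ℕ → ℝ) (n : ℕ) : LineL2 :=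
  (2⁻¹ : ℝ) • M.stiffLp D (stiffArg τ ψ U n)

/-- The viscous flux in the `n`-th step. -/
def viscousLp (M : Mesh) (D : Problem) (τ : ℝ) (ψ : ℕ → ℝ) (U : ℕ → ℕ → ℝ) (n : ℕ) : LineL2 :=
  (2 * τ)⁻¹ • M.dampLp D (dampArg τ ψ U n)

/-- The first step and the later ones take the same form once the initial velocity is put in front
of the difference quotients and the arguments of the fluxes are chosen accordingly at `n = 0`.
Testing with cell averages makes the identity exact. -/
theorem IsDiscreteSolution.inner_velLp_sub (hU : M.IsDiscreteSolution D T N Φ Ψ U)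
    (hτ : 0 < τ) (hτ' : T / N = τ) {n : ℕ} (hn : n < N) {p q : LineL2} (h : MemH10 D.L p q) :
    inner ℝ (M.velLp D τ (M.cellMean D Ψ) U (n + 1) - M.velLp D τ (M.cellMean D Ψ) U n) p =
      -τ * inner ℝ (M.elasticLp D τ (M.cellMean D Ψ) U n + M.viscousLp D τ (M.cellMean D Ψ) U n)
        q := by
  set ψ := M.cellMean D Ψ with hψ
  have hW := M.averages_mem_ends D p
  have e1 : τ * inner ℝ (M.velLp D τ ψ U (n + 1) - M.velLp D τ ψ U n) p =
      M.massForm D (U (n + 1) - U n - τ • velocity τ ψ U n) (M.averages D p) := by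
    rw [velLp, velLp, ← map_sub, inner_step_eq_massForm, ← smul_eq_mul, ← LinearMap.smul_apply,
      ← map_smul, smul_sub, smul_velocity_succ ψ U hτ.ne']
  have e2 : inner ℝ (M.elasticLp D τ ψ U n + M.viscousLp D τ ψ U n) q =
      2⁻¹ * M.stiffForm D (stiffArg τ ψ U n) (M.averages D p) +
      (2 * τ)⁻¹ * M.dampForm D (dampArg τ ψ U n) (M.averages D p) := by
    rw [elasticLp, viscousLp, inner_add_left, real_inner_smul_left, real_inner_smul_left,
      M.stiffForm_averages D _ h, M.dampForm_averages D _ h]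
  apply mul_left_cancel₀ hτ.ne'
  rw [e1, e2]
  cases n with
  | zero =>
    have := hU.first_weak hτ hτ' hW
    rw [← hψ] at this
    simp only [velocity, stiffArg, dampArg, map_smul, LinearMap.smul_apply, smul_eq_mul]
    rw [zero_add]
    field_simp
    linear_combination this
  | succ n =>
    have := hU.step_weak hτ hτ' (n := n) (by omega) hW
    rw [smul_velocity_succ ψ U hτ.ne']
    simp only [stiffArg, dampArg]
    have e3 : U (n + 1 + 1) - U (n + 1) - (U (n + 1) - U n) =
        U (n + 2) - (2 : ℝ) • U (n + 1) + U n := by rw [two_smul]; abel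
    rw [e3]
    field_simp
    linear_combination this

theorem stiffArg_mem_ends {ψ : ℕ → ℝ} (hψ : ψ ∈ M.ends) (hU : ∀ n ≤ N, U n ∈ M.ends) {n : ℕ}
    (hn : n < N) : stiffArg τ ψ U n ∈ M.ends := by
  cases n with
  | zero => exact M.ends.sub_mem (hU 1 hn) (M.ends.smul_mem τ hψ)
  | succ n => exact M.ends.add_mem (hU _ (by omega)) (hU _ (by omega))

theorem dampArg_mem_ends {ψ : ℕ → ℝ} (hψ : ψ ∈ M.ends) (hU : ∀ n ≤ N, U n ∈ M.ends) {n : ℕ}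
    (hn : n < N) : dampArg τ ψ U n ∈ M.ends := by
  cases n with
  | zero => exact M.ends.smul_mem τ hψ
  | succ n => exact M.ends.sub_mem (hU _ (by omega)) (hU _ (by omega))

end Mesh

/-! ### Bounds for velocities and fluxes in `L²`. -/

namespace EnergyBounds

variable {M : Mesh} {D : Problem} {N : ℕ} {τ C : ℝ} {ψ : ℕ → ℝ} {U : ℕ → ℕ → ℝ}

theorem norm_velLp_sq_le (h : EnergyBounds D M N τ C ψ U) (hτ : 0 < τ) {n : ℕ} (hn : n ≤ N) :
    ‖M.velLp D τ ψ U n‖ ^ 2 ≤ C := by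
  rw [Mesh.velLp, Mesh.norm_step_sq]
  cases n with
  | zero => exact h.mass_init
  | succ n =>
    have := h.velocity n hn
    simp only [KelvinVoigt.velocity, map_smul, LinearMap.smul_apply, smul_eq_mul]
    rw [← mul_assoc, ← sq, inv_pow, inv_mul_le_iff₀ (by positivity)]
    linarith

theorem stiffForm_stiffArg_le (h : EnergyBounds D M N τ C ψ U) {n : ℕ} (hn : n < N) :
    M.stiffForm D (stiffArg τ ψ U n) (stiffArg τ ψ U n) ≤ C := by
  cases n with
  | zero => exact h.stiff_zero
  | succ n => exact h.stiff n hn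

theorem norm_elasticLp_sq_le (h : EnergyBounds D M N τ C ψ U) {n : ℕ} (hn : n < N) :
    ‖M.elasticLp D τ ψ U n‖ ^ 2 ≤ D.maxSpeedSq * C := by
  have h1 := h.stiffForm_stiffArg_le hn
  have h2 := M.norm_stiffLp_sq_le D (stiffArg τ ψ U n)
  have h3 := D.maxSpeedSq_pos
  have h4 := mul_le_mul_of_nonneg_left h1 h3.le
  rw [Mesh.elasticLp, norm_smul, mul_pow]
  norm_num
  nlinarith [sq_nonneg ‖M.stiffLp D (stiffArg τ ψ U n)‖]

theorem sum_dampForm_dampArg_le (h : EnergyBounds D M N τ C ψ U) (hN : 0 < N) :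
    ∑ n ∈ Finset.range N, M.dampForm D (dampArg τ ψ U n) (dampArg τ ψ U n) ≤
      C * τ + C * τ ^ 2 := by
  obtain ⟨k, rfl⟩ : ∃ k, N = k + 1 := ⟨N - 1, by omega⟩
  rw [Finset.sum_range_succ']
  have h1 := h.damp
  rw [Nat.add_sub_cancel] at h1
  have h2 : M.dampForm D (dampArg τ ψ U 0) (dampArg τ ψ U 0) ≤ C * τ ^ 2 := by
    simp only [dampArg, map_smul, LinearMap.smul_apply, smul_eq_mul]
    nlinarith [mul_le_mul_of_nonneg_left h.damp_init (sq_nonneg τ)]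
  exact add_le_add h1 h2

/-- Dissipation controls the viscous flux only after summation in time, that is in `L²(0, T; L²)`;
the elastic flux, in contrast, is bounded at each step. -/
theorem sum_norm_viscousLp_sq_le (h : EnergyBounds D M N τ C ψ U) (hτ : 0 < τ) (hN : 0 < N) :
    ∑ n ∈ Finset.range N, τ * ‖M.viscousLp D τ ψ U n‖ ^ 2 ≤ D.δ * (C + C * τ) := by
  have hδ := D.δ_pos
  calc ∑ n ∈ Finset.range N, τ * ‖M.viscousLp D τ ψ U n‖ ^ 2
      ≤ ∑ n ∈ Finset.range N, D.δ * τ⁻¹ * M.dampForm D (dampArg τ ψ U n) (dampArg τ ψ U n) := by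
        refine Finset.sum_le_sum fun n _ => ?_
        have h1 := M.norm_dampLp_sq_le D (dampArg τ ψ U n)
        have h2 := (M.isSymmNonneg_dampForm D).nonneg (dampArg τ ψ U n)
        rw [Mesh.viscousLp, norm_smul, mul_pow, norm_inv, Real.norm_eq_abs, inv_pow, sq_abs]
        calc τ * (((2 * τ) ^ 2)⁻¹ * ‖M.dampLp D (dampArg τ ψ U n)‖ ^ 2)
            = τ⁻¹ * (4⁻¹ * ‖M.dampLp D (dampArg τ ψ U n)‖ ^ 2) := by field_simp; ring
          _ ≤ τ⁻¹ * (1 * (D.δ * M.dampForm D (dampArg τ ψ U n) (dampArg τ ψ U n))) := by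
              gcongr; norm_num
          _ = _ := by ring
    _ ≤ D.δ * τ⁻¹ * (C * τ + C * τ ^ 2) := by
        rw [← Finset.mul_sum]
        exact mul_le_mul_of_nonneg_left (h.sum_dampForm_dampArg_le hN) (by positivity)
    _ = _ := by field_simp

end EnergyBounds

/-! ### Weak convergence in `L²(0, T; H)` -/

/-- Finiteness of the exponent makes the `L²` spaces separable, as the extraction of weakly
convergent subsequences demands. -/
instance : Fact ((2 : ENNReal) ≠ ⊤) := ⟨by norm_num⟩

section WeakConvergence

variable {H : Type*} [NormedAddCommGroup H] [InnerProductSpace ℝ H] {T : ℝ}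

/-- Weak convergence in `L²(0, T; H)`. -/
def WeakL2Tendsto (T : ℝ) (F : ℕ → ℝ → H) (f : ℝ → H) : Prop :=
  ∀ g : ℝ → H, MemLp g 2 (volume.restrict (Ioo 0 T)) →
    Tendsto (fun m => ∫ t in Ioo 0 T, inner ℝ (F m t) (g t)) atTop
      (𝓝 (∫ t in Ioo 0 T, inner ℝ (f t) (g t)))

theorem WeakL2Tendsto.comp {F : ℕ → ℝ → H} {f : ℝ → H} (h : WeakL2Tendsto T F f) {σ : ℕ → ℕ}
    (hσ : StrictMono σ) : WeakL2Tendsto T (fun k => F (σ k)) f :=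
  fun g hg => (h g hg).comp hσ.tendsto_atTop

theorem inner_toLp_toLp {F G : ℝ → H} (hF : MemLp F 2 (volume.restrict (Ioo 0 T)))
    (hG : MemLp G 2 (volume.restrict (Ioo 0 T))) :
    inner ℝ hF.toLp hG.toLp = ∫ t in Ioo 0 T, inner ℝ (F t) (G t) := by
  rw [L2.inner_def]
  apply integral_congr_ae
  filter_upwards [hF.coeFn_toLp, hG.coeFn_toLp] with t h1 h2
  rw [h1, h2]

theorem norm_toLp_le {F : ℝ → H} (hF : MemLp F 2 (volume.restrict (Ioo 0 T))) {C : ℝ} (hC : 0 ≤ C)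
    (h : ∫ t in Ioo 0 T, ‖F t‖ ^ 2 ≤ C ^ 2) : ‖hF.toLp‖ ≤ C := by
  apply le_of_sq_le_sq _ hC
  rw [← real_inner_self_eq_norm_sq, inner_toLp_toLp]
  simpa only [real_inner_self_eq_norm_sq] using h

theorem abs_integral_inner_le {F G : ℝ → H} (hF : MemLp F 2 (volume.restrict (Ioo 0 T)))
    (hG : MemLp G 2 (volume.restrict (Ioo 0 T))) {A B : ℝ} (hA : 0 ≤ A) (hB : 0 ≤ B)
    (hFA : ∫ t in Ioo 0 T, ‖F t‖ ^ 2 ≤ A ^ 2) (hGB : ∫ t in Ioo 0 T, ‖G t‖ ^ 2 ≤ B ^ 2) :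
    |∫ t in Ioo 0 T, inner ℝ (F t) (G t)| ≤ A * B := by
  rw [← inner_toLp_toLp hF hG]
  exact (abs_real_inner_le_norm _ _).trans
    (mul_le_mul (norm_toLp_le hF hA hFA) (norm_toLp_le hG hB hGB) (norm_nonneg _) hA)

theorem exists_weakL2Tendsto [CompleteSpace H] [TopologicalSpace.SeparableSpace H]
    {F : ℕ → ℝ → H} (hF : ∀ m, MemLp (F m) 2 (volume.restrict (Ioo 0 T))) {C : ℝ} (hC : 0 ≤ C)
    (hFC : ∀ m, ∫ t in Ioo 0 T, ‖F m t‖ ^ 2 ≤ C ^ 2) :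
    ∃ σ : ℕ → ℕ, StrictMono σ ∧ ∃ f : ℝ → H, MemLp f 2 (volume.restrict (Ioo 0 T)) ∧
      WeakL2Tendsto T (fun k => F (σ k)) f := by
  obtain ⟨σ, hσ, f, hf⟩ := exists_weakly_convergent_subseq (fun m => (hF m).toLp) C
    fun m => norm_toLp_le (hF m) hC (hFC m)
  refine ⟨σ, hσ, f, Lp.memLp f, fun g hg => ?_⟩
  have h := hf hg.toLp
  have e : inner ℝ f hg.toLp = ∫ t in Ioo 0 T, inner ℝ (f t) (g t) := by
    rw [← inner_toLp_toLp (Lp.memLp f) hg, Lp.toLp_coeFn]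
  rw [e] at h
  exact h.congr fun k => inner_toLp_toLp (hF (σ k)) hg

omit [InnerProductSpace ℝ H] in
theorem memLp_window (a b : ℝ) (e : H) :
    MemLp ((Ioo a b).indicator fun _ => e) 2 (volume.restrict (Ioo 0 T)) :=
  (memLp_const e).indicator measurableSet_Ioo

theorem integral_window {a b : ℝ} (ha : 0 ≤ a) (hab : a ≤ b) (hb : b ≤ T) (F : ℝ → H) (e : H) :
    ∫ t in Ioo 0 T, inner ℝ (F t) ((Ioo a b).indicator (fun _ => e) t) =
      ∫ t in a..b, inner ℝ (F t) e := by
  rw [intervalIntegral.integral_of_le hab, integral_Ioc_eq_integral_Ioo,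
    ← Measure.restrict_restrict_of_subset (Ioo_subset_Ioo ha hb),
    ← integral_indicator (μ := volume.restrict (Ioo 0 T)) measurableSet_Ioo]
  refine integral_congr_ae (Eventually.of_forall fun t => ?_)
  by_cases h : t ∈ Ioo a b <;> simp [h]

theorem WeakL2Tendsto.integral_inner {F : ℕ → ℝ → H} {f : ℝ → H} (h : WeakL2Tendsto T F f)
    {t : ℝ} (ht : t ∈ Icc 0 T) (e : H) :
    Tendsto (fun m => ∫ s in 0..t, inner ℝ (F m s) e) atTop (𝓝 (∫ s in 0..t, inner ℝ (f s) e)) := by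
  have := h _ (memLp_window 0 t e)
  simpa only [integral_window le_rfl ht.1 ht.2] using this

/-- Cauchy-Schwarz against a window in time. It makes the error from rounding `t` down to a time
node negligible, uniformly along the sequence. -/
theorem abs_integral_inner_window_le {F : ℝ → H} (hF : MemLp F 2 (volume.restrict (Ioo 0 T)))
    {C : ℝ} (hC : 0 ≤ C) (hFC : ∫ t in Ioo 0 T, ‖F t‖ ^ 2 ≤ C ^ 2) {a b : ℝ} (ha : 0 ≤ a)
    (hab : a ≤ b) (hb : b ≤ T) (e : H) :
    |∫ t in a..b, inner ℝ (F t) e| ≤ C * (√(b - a) * ‖e‖) := by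
  rw [← integral_window ha hab hb]
  refine abs_integral_inner_le hF (memLp_window a b e) hC (by positivity) hFC (le_of_eq ?_)
  have h := integral_window ha hab hb (fun _ => e) e
  simp only [real_inner_self_eq_norm_sq, intervalIntegral.integral_const, smul_eq_mul] at h
  rw [mul_pow, Real.sq_sqrt (sub_nonneg.mpr hab), ← h]
  refine integral_congr_ae (Eventually.of_forall fun t => ?_)
  by_cases h : t ∈ Ioo a b <;> simp [h]

omit [InnerProductSpace ℝ H] in
theorem intervalIntegrable_of_memLp {F : ℝ → H} (hF : MemLp F 2 (volume.restrict (Ioo 0 T)))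
    {a b : ℝ} (ha : 0 ≤ a) (hab : a ≤ b) (hb : b ≤ T) : IntervalIntegrable F volume a b := by
  rw [intervalIntegrable_iff_integrableOn_Ioo_of_le hab]
  exact IntegrableOn.mono_set (hF.integrable (by norm_num)) (Ioo_subset_Ioo ha hb)

theorem memLp_inner_const {F : ℝ → H} (hF : MemLp F 2 (volume.restrict (Ioo 0 T))) (e : H) :
    MemLp (fun t => inner ℝ (F t) e) 2 (volume.restrict (Ioo 0 T)) := by
  have := (innerSL ℝ e).comp_memLp' hF
  refine this.ae_eq (Eventually.of_forall fun t => ?_)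
  simp [real_inner_comm]

theorem integrable_inner {F G : ℝ → H} (hF : MemLp F 2 (volume.restrict (Ioo 0 T)))
    (hG : MemLp G 2 (volume.restrict (Ioo 0 T))) :
    Integrable (fun t => inner ℝ (F t) (G t)) (volume.restrict (Ioo 0 T)) := by
  refine (L2.integrable_inner (𝕜 := ℝ) hF.toLp hG.toLp).congr ?_
  filter_upwards [hF.coeFn_toLp, hG.coeFn_toLp] with t h1 h2
  rw [h1, h2]

end WeakConvergence

/-! ### Functions of time which are piecewise constant or piecewise affine -/

section Time

variable {H : Type*} [NormedAddCommGroup H] [InnerProductSpace ℝ H] {T τ : ℝ} {N : ℕ}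

theorem floor_div_eq (hτ : 0 < τ) {n : ℕ} {t : ℝ} (ht : t ∈ Ico (n * τ) ((n + 1) * τ)) :
    ⌊t / τ⌋₊ = n := by
  have h0 : 0 ≤ t := (by positivity : (0 : ℝ) ≤ n * τ).trans ht.1
  rw [Nat.floor_eq_iff (div_nonneg h0 hτ.le), le_div_iff₀ hτ, div_lt_iff₀ hτ]
  exact ht

theorem floor_div_lt (hτ : 0 < τ) (hN : N * τ = T) {t : ℝ} (ht : t ∈ Ioo 0 T) :
    ⌊t / τ⌋₊ < N := by
  rw [Nat.floor_lt (div_nonneg ht.1.le hτ.le), div_lt_iff₀ hτ, hN]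
  exact ht.2

theorem floor_div_le (hτ : 0 < τ) (hN : N * τ = T) {t : ℝ} (ht : t ≤ T) :
    ⌊t / τ⌋₊ ≤ N := by
  apply Nat.floor_le_of_le
  rw [div_le_iff₀ hτ, hN]
  exact ht

theorem floor_mul_le (hτ : 0 < τ) {t : ℝ} (ht : 0 ≤ t) : ⌊t / τ⌋₊ * τ ≤ t := by
  rw [← le_div_iff₀ hτ]
  exact Nat.floor_le (div_nonneg ht hτ.le)

theorem sub_floor_mul_le (hτ : 0 < τ) (t : ℝ) : t - ⌊t / τ⌋₊ * τ ≤ τ := by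
  have := (Nat.lt_floor_add_one (t / τ)).le
  rw [div_le_iff₀ hτ] at this
  linarith

/-- The function equal to `G n` on `[n τ, (n + 1) τ)`. -/
def stepTime (τ : ℝ) (G : ℕ → H) (t : ℝ) : H := G ⌊t / τ⌋₊

/-- The continuous function which takes the value `d n` at `n τ` and is affine in between. -/
def affineTime (τ : ℝ) (d : ℕ → H) (t : ℝ) : H :=
  (1 - (t / τ - ⌊t / τ⌋₊)) • d ⌊t / τ⌋₊ + (t / τ - ⌊t / τ⌋₊) • d (⌊t / τ⌋₊ + 1)

omit [InnerProductSpace ℝ H] in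
theorem stronglyMeasurable_stepTime (τ : ℝ) (G : ℕ → H) : StronglyMeasurable (stepTime τ G) :=
  (StronglyMeasurable.of_discrete (f := G)).comp_measurable
    (Nat.measurable_floor.comp (measurable_id.div_const τ))

theorem stronglyMeasurable_affineTime (τ : ℝ) (d : ℕ → H) :
    StronglyMeasurable (affineTime τ d) := by
  have h1 : Measurable fun t : ℝ => t / τ - (⌊t / τ⌋₊ : ℝ) :=
    (measurable_id.div_const τ).sub (measurable_from_nat.comp
      (Nat.measurable_floor.comp (measurable_id.div_const τ)))
  exact ((measurable_const.sub h1).stronglyMeasurable.smul (stronglyMeasurable_stepTime τ d)).add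
    (h1.stronglyMeasurable.smul (stronglyMeasurable_stepTime τ fun n => d (n + 1)))

theorem norm_affineTime_le (hτ : 0 < τ) (hN : N * τ = T) {d : ℕ → H} {C : ℝ}
    (hd : ∀ n ≤ N, ‖d n‖ ≤ C) {t : ℝ} (ht : t ∈ Ioo 0 T) : ‖affineTime τ d t‖ ≤ C := by
  have h1 := floor_div_lt hτ hN ht
  have h2 : 0 ≤ t / τ - (⌊t / τ⌋₊ : ℝ) := sub_nonneg.mpr (Nat.floor_le (div_nonneg ht.1.le hτ.le))
  have h3 : 0 ≤ 1 - (t / τ - (⌊t / τ⌋₊ : ℝ)) := by linarith [Nat.lt_floor_add_one (t / τ)]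
  refine (norm_add_le _ _).trans ?_
  rw [norm_smul, norm_smul, Real.norm_of_nonneg h2, Real.norm_of_nonneg h3]
  have h4 := mul_le_mul_of_nonneg_left (hd _ h1.le) h3
  have h5 := mul_le_mul_of_nonneg_left (hd _ (Nat.succ_le_of_lt h1)) h2
  linarith

theorem memLp_affineTime (hτ : 0 < τ) (hN : N * τ = T) {d : ℕ → H} {C : ℝ}
    (hd : ∀ n ≤ N, ‖d n‖ ≤ C) : MemLp (affineTime τ d) 2 (volume.restrict (Ioo 0 T)) :=
  MemLp.of_bound (stronglyMeasurable_affineTime τ d).aestronglyMeasurable C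
    ((ae_restrict_mem measurableSet_Ioo).mono fun _ ht => norm_affineTime_le hτ hN hd ht)

theorem memLp_stepTime (hτ : 0 < τ) (hN : N * τ = T) (G : ℕ → H) :
    MemLp (stepTime τ G) 2 (volume.restrict (Ioo 0 T)) :=
  MemLp.of_bound (stronglyMeasurable_stepTime τ G).aestronglyMeasurable
    (∑ n ∈ Finset.range N, ‖G n‖) ((ae_restrict_mem measurableSet_Ioo).mono fun _ ht =>
      Finset.single_le_sum (f := fun n => ‖G n‖) (fun _ _ => norm_nonneg _)
        (Finset.mem_range.mpr (floor_div_lt hτ hN ht)))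

theorem integral_norm_sq_le_of_bound {F : ℝ → H} (hT : 0 ≤ T) {C : ℝ}
    (hF : MemLp F 2 (volume.restrict (Ioo 0 T))) (h : ∀ t ∈ Ioo 0 T, ‖F t‖ ^ 2 ≤ C) :
    ∫ t in Ioo 0 T, ‖F t‖ ^ 2 ≤ T * C := by
  calc ∫ t in Ioo 0 T, ‖F t‖ ^ 2 ≤ ∫ _ in Ioo 0 T, C := by
        have hi := integrable_inner hF hF
        simp only [real_inner_self_eq_norm_sq] at hi
        exact setIntegral_mono_on hi (integrable_const C) measurableSet_Ioo h
    _ = T * C := by simp [hT]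

/-- The integral of a function given piecewise. -/
theorem integral_eq_sum_cells (hτ : 0 < τ) {f : ℝ → ℝ} {g : ℕ → ℝ → ℝ} (k : ℕ)
    (hg : ∀ n < k, IntervalIntegrable (g n) volume (n * τ) ((n + 1) * τ))
    (h : ∀ n < k, ∀ t ∈ Ico (n * τ) ((n + 1) * τ), f t = g n t) :
    ∫ t in 0..k * τ, f t = ∑ n ∈ Finset.range k, ∫ t in n * τ..(n + 1) * τ, g n t := by
  have hle : ∀ n : ℕ, (n : ℝ) * τ ≤ (n + 1) * τ := fun n => by nlinarith
  have h' : ∀ n < k, ∀ t ∈ Ioo ((n : ℝ) * τ) ((n + 1) * τ), f t = g n t :=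
    fun n hn t ht => h n hn t (Ioo_subset_Ico_self ht)
  have hf : ∀ n < k, IntervalIntegrable f volume ((n : ℕ) * τ) ((n + 1 : ℕ) * τ) := by
    intro n hn
    push_cast
    rw [intervalIntegrable_iff_integrableOn_Ioo_of_le (hle n)]
    exact ((intervalIntegrable_iff_integrableOn_Ioo_of_le (hle n)).mp (hg n hn)).congr_fun
      (fun t ht => (h' n hn t ht).symm) measurableSet_Ioo
  have := intervalIntegral.sum_integral_adjacent_intervals (a := fun n : ℕ => (n : ℝ) * τ) hf
  rw [Nat.cast_zero, zero_mul] at this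
  rw [← this]
  refine Finset.sum_congr rfl fun n hn => ?_
  push_cast
  rw [intervalIntegral.integral_of_le (hle n), intervalIntegral.integral_of_le (hle n),
    integral_Ioc_eq_integral_Ioo, integral_Ioc_eq_integral_Ioo]
  exact setIntegral_congr_fun measurableSet_Ioo fun t ht => h' n (Finset.mem_range.mp hn) t ht

theorem integral_inner_stepTime (hτ : 0 < τ) (G : ℕ → H) (k : ℕ) (e : H) :
    ∫ t in 0..k * τ, inner ℝ (stepTime τ G t) e = ∑ n ∈ Finset.range k, τ * inner ℝ (G n) e := by
  rw [integral_eq_sum_cells hτ (g := fun n _ => inner ℝ (G n) e) k (fun n _ => by simp)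
    fun n _ t ht => by rw [stepTime, floor_div_eq hτ ht]]
  refine Finset.sum_congr rfl fun n _ => ?_
  rw [intervalIntegral.integral_const, smul_eq_mul]
  ring

omit [InnerProductSpace ℝ H] in
theorem integral_norm_sq_stepTime (hτ : 0 < τ) (hN : N * τ = T) (G : ℕ → H) :
    ∫ t in Ioo 0 T, ‖stepTime τ G t‖ ^ 2 = ∑ n ∈ Finset.range N, τ * ‖G n‖ ^ 2 := by
  have h0 : 0 ≤ T := by rw [← hN]; positivity
  rw [← integral_Ioc_eq_integral_Ioo, ← intervalIntegral.integral_of_le h0, ← hN,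
    integral_eq_sum_cells hτ (g := fun n _ => ‖G n‖ ^ 2) N (fun n _ => by simp)
    fun n _ t ht => by rw [stepTime, floor_div_eq hτ ht]]
  refine Finset.sum_congr rfl fun n _ => ?_
  rw [intervalIntegral.integral_const, smul_eq_mul]
  ring

theorem affineTime_eq (hτ : 0 < τ) (d : ℕ → H) {n : ℕ} {t : ℝ}
    (ht : t ∈ Ico (n * τ) ((n + 1) * τ)) :
    affineTime τ d t = (1 - (t / τ - n)) • d n + (t / τ - n) • d (n + 1) := by
  rw [affineTime, floor_div_eq hτ ht]

theorem integral_cell_affine (hτ : 0 < τ) (n : ℕ) (u v : ℝ) :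
    ∫ t in n * τ..(n + 1) * τ, ((1 - (t / τ - n)) * u + (t / τ - n) * v) = τ * ((u + v) / 2) := by
  have h : ∀ t ∈ uIcc ((n : ℝ) * τ) ((n + 1) * τ), HasDerivAt
      (fun t => t * u + τ * ((t / τ - n) ^ 2 / 2) * (v - u))
      ((1 - (t / τ - n)) * u + (t / τ - n) * v) t := by
    intro t _
    have h1 : HasDerivAt (fun t : ℝ => t / τ - n) (1 / τ) t :=
      ((hasDerivAt_id t).div_const τ).sub_const _
    have h2 := ((hasDerivAt_id t).mul_const u).add
      ((((h1.pow 2).div_const 2).const_mul τ).mul_const (v - u))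
    convert! h2 using 1
    rw [Nat.add_one_sub_one, pow_one]
    field_simp
    push_cast
    ring
  rw [intervalIntegral.integral_eq_sub_of_hasDerivAt h
    (Continuous.intervalIntegrable (by fun_prop) _ _)]
  field_simp
  ring

/-- An affine function integrates by the trapezoidal rule, which explains the averages of
consecutive values. -/
theorem integral_inner_affineTime (hτ : 0 < τ) (d : ℕ → H) (k : ℕ) (e : H) :
    ∫ t in 0..k * τ, inner ℝ (affineTime τ d t) e =
      ∑ n ∈ Finset.range k, τ * ((inner ℝ (d n) e + inner ℝ (d (n + 1)) e) / 2) := by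
  rw [integral_eq_sum_cells hτ (g := fun n t => (1 - (t / τ - n)) * inner ℝ (d n) e +
      (t / τ - n) * inner ℝ (d (n + 1)) e) k
    (fun n _ => Continuous.intervalIntegrable (by fun_prop) _ _)
    fun n _ t ht => by
      rw [affineTime_eq hτ d ht, inner_add_left, real_inner_smul_left, real_inner_smul_left]]
  exact Finset.sum_congr rfl fun n _ => integral_cell_affine hτ n _ _

/-- Integration by parts in time against a piecewise affine function. -/
theorem integral_inner_affineTime_add (hτ : 0 < τ) (hN : N * τ = T) (d : ℕ → H) {P Pt : ℝ → H}
    (hPt : MemLp Pt 2 (volume.restrict (Ioo 0 T)))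
    (hP : ∀ e : H, ∀ t ∈ Icc 0 T, inner ℝ e (P t) = inner ℝ e (P 0) + ∫ s in 0..t, inner ℝ e (Pt s))
    (hPT : P T = 0) :
    (∫ t in 0..T, inner ℝ (affineTime τ d t) (Pt t)) =
      -inner ℝ (d 0) (P 0) -
        ∑ n ∈ Finset.range N, τ⁻¹ * ∫ t in n * τ..(n + 1) * τ, inner ℝ (d (n + 1) - d n) (P t) := by
  have hint : ∀ e : H, ∀ a b : ℝ, 0 ≤ a → a ≤ b → b ≤ T →
      IntervalIntegrable (fun t => inner ℝ e (Pt t)) volume a b := by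
    intro e a b ha hab hb
    have := intervalIntegrable_of_memLp (memLp_inner_const hPt e) ha hab hb
    simpa only [real_inner_comm] using this
  have hle : ∀ n : ℕ, (n : ℝ) * τ ≤ (n + 1) * τ := fun n => by nlinarith
  have hnT : ∀ n < N, ((n : ℝ) + 1) * τ ≤ T := fun n hn => by
    rw [← hN]
    have : (n : ℝ) + 1 ≤ N := by exact_mod_cast hn
    gcongr
  have h0n : ∀ n : ℕ, (0 : ℝ) ≤ n * τ := fun n => by positivity
  have hPcont : ∀ e : H, ∀ n < N, IntervalIntegrable (fun t => inner ℝ e (P t)) volume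
      (n * τ) ((n + 1) * τ) := by
    intro e n hn
    have hT0 : 0 ≤ T := (h0n n).trans ((hle n).trans (hnT n hn))
    have hc := (continuousOn_primitive_of_intervalIntegrable hT0
      (hint e 0 T le_rfl hT0 le_rfl)).const_add (inner ℝ e (P 0))
    refine ContinuousOn.intervalIntegrable ?_
    rw [uIcc_of_le (hle n)]
    exact ((hc.congr (hP e)).mono (Icc_subset_Icc (h0n n) (hnT n hn)))
  have hcell : ∀ n < N, ∫ t in n * τ..(n + 1) * τ, ((1 - (t / τ - n)) * inner ℝ (d n) (Pt t) +
      (t / τ - n) * inner ℝ (d (n + 1)) (Pt t)) =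
      (inner ℝ (d (n + 1)) (P ((n + 1 : ℕ) * τ)) - inner ℝ (d n) (P (n * τ))) -
        τ⁻¹ * ∫ t in n * τ..(n + 1) * τ, inner ℝ (d (n + 1) - d n) (P t) := by
    intro n hn
    have hp : ∀ e : H, ∀ x ∈ Icc ((n : ℝ) * τ) ((n + 1) * τ), inner ℝ e (P x) =
        inner ℝ e (P (n * τ)) + ∫ s in n * τ..x, inner ℝ e (Pt s) := by
      intro e x hx
      have hxT := hx.2.trans (hnT n hn)
      rw [hP e x ⟨(h0n n).trans hx.1, hxT⟩, hP e (n * τ) ⟨h0n n, hx.1.trans hxT⟩, add_assoc,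
        intervalIntegral.integral_add_adjacent_intervals (hint e _ _ le_rfl (h0n n)
          (hx.1.trans hxT)) (hint e _ _ (h0n n) hx.1 hxT)]
    have i1 := hint (d n) _ _ (h0n n) (hle n) (hnT n hn)
    have i2 := hint (d (n + 1)) _ _ (h0n n) (hle n) (hnT n hn)
    have h1 : ∀ t, HasDerivAt (fun t : ℝ => t / τ - n) (τ⁻¹) t := fun t => by
      have := ((hasDerivAt_id t).div_const τ).sub_const (n : ℝ)
      simpa using this
    have b1 := integral_mul_add_integral_deriv_mul (hle n) i1 (hp (d n))
      (fun t => (h1 t).const_sub 1) continuous_const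
    have b2 := integral_mul_add_integral_deriv_mul (hle n) i2 (hp (d (n + 1))) h1 continuous_const
    have c1 : ((n : ℝ) + 1) * τ / τ = n + 1 := by field_simp
    have c2 : (n : ℝ) * τ / τ = n := by field_simp
    rw [intervalIntegral.integral_const_mul, c1, c2] at b1 b2
    rw [intervalIntegral.integral_add
      (i1.continuousOn_mul (by fun_prop)) (i2.continuousOn_mul (by fun_prop))]
    simp only [inner_sub_left]
    rw [intervalIntegral.integral_sub (hPcont _ n hn) (hPcont _ n hn)]
    push_cast
    linear_combination b1 + b2
  rw [← hN, integral_eq_sum_cells hτ (g := fun n t => (1 - (t / τ - n)) * inner ℝ (d n) (Pt t) +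
      (t / τ - n) * inner ℝ (d (n + 1)) (Pt t)) N
    (fun n hn => by
      refine ((hint (d n) _ _ (h0n n) (hle n) (hnT n hn)).continuousOn_mul (by fun_prop)).add
        ((hint (d (n + 1)) _ _ (h0n n) (hle n) (hnT n hn)).continuousOn_mul (by fun_prop)))
    fun n _ t ht => by
      rw [affineTime_eq hτ d ht, inner_add_left, real_inner_smul_left, real_inner_smul_left],
    Finset.sum_congr rfl fun n hn => hcell n (Finset.mem_range.mp hn), Finset.sum_sub_distrib,
    Finset.sum_range_sub (fun n : ℕ => inner ℝ (d n) (P (n * τ))), hN, hPT]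
  simp

end Time

/-! ### Limits of time discretizations -/

section Limits

variable {H : Type*} [NormedAddCommGroup H] [InnerProductSpace ℝ H] {T : ℝ} {N : ℕ → ℕ} {τ : ℕ → ℝ}

theorem tendsto_sub_floor_mul (hτ : ∀ m, 0 < τ m) (hτ0 : Tendsto τ atTop (𝓝 0)) {t : ℝ}
    (ht : 0 ≤ t) : Tendsto (fun m => t - ⌊t / τ m⌋₊ * τ m) atTop (𝓝 0) :=
  squeeze_zero (fun m => sub_nonneg.mpr (floor_mul_le (hτ m) ht))
    (fun m => sub_floor_mul_le (hτ m) t) hτ0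

/-- Weak convergence gives the limit with the fixed endpoint `t`; the remaining window is shorter
than one time step. -/
theorem tendsto_integral_floor {F : ℕ → ℝ → H} {f : ℝ → H} (hτ : ∀ m, 0 < τ m)
    (hτ0 : Tendsto τ atTop (𝓝 0))
    (hF : ∀ m, MemLp (F m) 2 (volume.restrict (Ioo 0 T))) {C : ℝ} (hC : 0 ≤ C)
    (hFC : ∀ m, ∫ t in Ioo 0 T, ‖F m t‖ ^ 2 ≤ C ^ 2) (hf : WeakL2Tendsto T F f) {t : ℝ}
    (ht : t ∈ Icc 0 T) (e : H) :
    Tendsto (fun m => ∫ s in 0..⌊t / τ m⌋₊ * τ m, inner ℝ (F m s) e) atTop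
      (𝓝 (∫ s in 0..t, inner ℝ (f s) e)) := by
  have h1 := hf.integral_inner ht e
  have h2 : Tendsto (fun m => C * (√(t - ⌊t / τ m⌋₊ * τ m) * ‖e‖)) atTop (𝓝 0) := by
    have := ((tendsto_sub_floor_mul hτ hτ0 ht.1).sqrt.mul_const ‖e‖).const_mul C
    simpa using this
  have h3 : Tendsto (fun m => ∫ s in ⌊t / τ m⌋₊ * τ m..t, inner ℝ (F m s) e) atTop (𝓝 0) := by
    refine squeeze_zero_norm (fun m => ?_) h2
    exact abs_integral_inner_window_le (hF m) hC (hFC m)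
      (mul_nonneg (Nat.cast_nonneg _) (hτ m).le) (floor_mul_le (hτ m) ht.1) ht.2 e
  have h4 := h1.sub h3
  rw [sub_zero] at h4
  refine h4.congr fun m => ?_
  have h0 : 0 ≤ ⌊t / τ m⌋₊ * τ m := mul_nonneg (Nat.cast_nonneg _) (hτ m).le
  have h5 := floor_mul_le (hτ m) ht.1
  have hi := (memLp_inner_const (hF m) e)
  rw [sub_eq_iff_eq_add, intervalIntegral.integral_add_adjacent_intervals
    (intervalIntegrable_of_memLp hi le_rfl h0 (h5.trans ht.2))
    (intervalIntegrable_of_memLp hi h0 h5 ht.2)]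

variable (hτ : ∀ m, 0 < τ m) (hN : ∀ m, N m * τ m = T) (hτ0 : Tendsto τ atTop (𝓝 0))
include hτ hN hτ0

/-- The position sums `τ d (n + 1)` while the affine interpolation integrates to trapezoidal
averages; the two differ by the telescoped term `τ/2 (d k - d 0)`, which vanishes in the limit.
Convergence thus holds at every time, not only almost everywhere. -/
theorem tendsto_inner_position {d v : ℕ → ℕ → H} {C : ℝ} (hd : ∀ m, ∀ n ≤ N m, ‖d m n‖ ≤ C)
    (hv : ∀ m, ∀ n < N m, v m (n + 1) = v m n + τ m • d m (n + 1)) {X : ℝ → H}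
    (hX : WeakL2Tendsto T (fun m => affineTime (τ m) (d m)) X) (e : H) {u₀ : ℝ}
    (hu₀ : Tendsto (fun m => inner ℝ (v m 0) e) atTop (𝓝 u₀)) {t : ℝ} (ht : t ∈ Icc 0 T) :
    Tendsto (fun m => inner ℝ (v m ⌊t / τ m⌋₊) e) atTop
      (𝓝 (u₀ + ∫ s in 0..t, inner ℝ (X s) e)) := by
  have hC : 0 ≤ C := (norm_nonneg _).trans (hd 0 0 (Nat.zero_le _))
  have hT : 0 ≤ T := ht.1.trans ht.2
  have hsum : ∀ m, ∀ k ≤ N m, inner ℝ (v m k) e = inner ℝ (v m 0) e +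
      (∫ s in 0..k * τ m, inner ℝ (affineTime (τ m) (d m) s) e) +
        τ m / 2 * inner ℝ (d m k - d m 0) e := by
    intro m k hk
    rw [integral_inner_affineTime (hτ m)]
    induction k with
    | zero => simp
    | succ k ih =>
      rw [hv m k hk, inner_add_left, ih (by omega), Finset.sum_range_succ, real_inner_smul_left,
        inner_sub_left, inner_sub_left]
      ring
  have h1 := tendsto_integral_floor hτ hτ0 (fun m => memLp_affineTime (hτ m) (hN m) (hd m))
    (C := √(T * C ^ 2)) (Real.sqrt_nonneg _) (fun m => by
      rw [Real.sq_sqrt (by positivity)]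
      refine integral_norm_sq_le_of_bound hT (memLp_affineTime (hτ m) (hN m) (hd m)) fun t ht => ?_
      exact pow_le_pow_left₀ (norm_nonneg _) (norm_affineTime_le (hτ m) (hN m) (hd m) ht) 2) hX ht e
  have h2 : Tendsto (fun m => τ m / 2 * inner ℝ (d m ⌊t / τ m⌋₊ - d m 0) e) atTop (𝓝 0) := by
    have h3 : Tendsto (fun m => τ m * (C * ‖e‖)) atTop (𝓝 0) := by
      simpa using hτ0.mul_const (C * ‖e‖)
    refine squeeze_zero_norm (fun m => ?_) h3
    have h4 := abs_real_inner_le_norm (d m ⌊t / τ m⌋₊ - d m 0) e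
    have h5 : ‖d m ⌊t / τ m⌋₊ - d m 0‖ ≤ 2 * C := by
      have := norm_sub_le (d m ⌊t / τ m⌋₊) (d m 0)
      have := hd m _ (floor_div_le (hτ m) (hN m) ht.2)
      have := hd m 0 (Nat.zero_le _)
      linarith
    rw [Real.norm_eq_abs, abs_mul, abs_of_pos (half_pos (hτ m))]
    calc τ m / 2 * |inner ℝ (d m ⌊t / τ m⌋₊ - d m 0) e|
        ≤ τ m / 2 * (2 * C * ‖e‖) := by
          have := (hτ m).le
          gcongr
          exact h4.trans (by gcongr)
      _ = _ := by ring
  have h3 := (hu₀.add h1).add h2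
  rw [add_zero] at h3
  exact h3.congr fun m => (hsum m _ (floor_div_le (hτ m) (hN m) ht.2)).symm

/-- The integral over `(0, t)` has two limits: one by weak convergence, one by consistency and
dominated convergence. Their equality for all `t` identifies the integrands. -/
theorem ae_inner_eq_neg_of_consistent {Y v : ℕ → ℕ → H} {C : ℝ}
    (hY : ∀ m, ∀ n < N m, ‖Y m n‖ ≤ C) {y : ℝ → H}
    (hyL : MemLp y 2 (volume.restrict (Ioo 0 T)))
    (hy : WeakL2Tendsto T (fun m => stepTime (τ m) (Y m)) y) (hT : 0 < T) {e w : H} {f : ℝ → ℝ}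
    (hf : ContinuousOn f (Icc 0 T))
    (hvf : ∀ t ∈ Icc 0 T, Tendsto (fun m => inner ℝ (v m ⌊t / τ m⌋₊) w) atTop (𝓝 (f t)))
    {ε : ℕ → ℝ} (hε : Tendsto ε atTop (𝓝 0))
    (h : ∀ m n, n + 1 < N m → |inner ℝ (Y m (n + 1)) e + inner ℝ (v m (n + 1)) w| ≤ ε m) :
    ∀ᵐ t ∂(volume.restrict (Ioo 0 T)), inner ℝ (y t) e = -f t := by
  refine ae_eq_of_forall_integral_eq
    (intervalIntegrable_of_memLp (memLp_inner_const hyL e) le_rfl hT.le le_rfl)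
    (ContinuousOn.intervalIntegrable (by rw [uIcc_of_le hT.le]; exact hf.neg)) fun t ht => ?_
  refine tendsto_nhds_unique (hy.integral_inner ht e) ?_
  have hne : ∀ᵐ s ∂(volume : Measure ℝ), s ≠ T := by
    simp [ae_iff, measure_singleton]
  refine intervalIntegral.tendsto_integral_filter_of_dominated_convergence (fun _ => C * ‖e‖)
    (Eventually.of_forall fun m => ?_) (Eventually.of_forall fun m => ?_) (by simp) ?_
  · exact ((stronglyMeasurable_stepTime (τ m) fun n => inner ℝ (Y m n) e)).aestronglyMeasurable
  · filter_upwards [hne] with s hs hs'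
    rw [uIoc_of_le ht.1] at hs'
    have hsT : s ∈ Ioo 0 T := ⟨hs'.1, lt_of_le_of_ne (hs'.2.trans ht.2) hs⟩
    refine (abs_real_inner_le_norm _ _).trans ?_
    gcongr
    exact hY m _ (floor_div_lt (hτ m) (hN m) hsT)
  · filter_upwards [hne] with s hs hs'
    rw [uIoc_of_le ht.1] at hs'
    have hsT : s ∈ Ioo 0 T := ⟨hs'.1, lt_of_le_of_ne (hs'.2.trans ht.2) hs⟩
    have h1 : Tendsto (fun m => inner ℝ (Y m ⌊s / τ m⌋₊) e + inner ℝ (v m ⌊s / τ m⌋₊) w) atTop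
        (𝓝 0) := by
      refine squeeze_zero_norm' ?_ hε
      -- Consistency is assumed from the second step on; a positive time eventually lies beyond the
      -- first time cell.
      filter_upwards [hτ0.eventually (gt_mem_nhds hsT.1)] with m hm
      have h2 : 1 ≤ ⌊s / τ m⌋₊ := by
        rw [Nat.one_le_floor_iff, one_le_div (hτ m)]
        exact hm.le
      obtain ⟨n, hn⟩ : ∃ n, ⌊s / τ m⌋₊ = n + 1 := ⟨⌊s / τ m⌋₊ - 1, by omega⟩
      rw [hn]
      exact h m n (hn ▸ floor_div_lt (hτ m) (hN m) hsT)
    have h2 := h1.sub (hvf s (Ioo_subset_Icc_self hsT))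
    rw [zero_sub] at h2
    refine h2.congr fun m => ?_
    rw [add_sub_cancel_right, stepTime]

/-- The viscous flux is not bounded step by step, so consistency is available only for its time
sums. This suffices, because equality is read off from the primitives in time. -/
theorem ae_inner_eq_neg_of_sum_consistent {Q v : ℕ → ℕ → H} {C : ℝ} (hC : 0 ≤ C)
    (hQ : ∀ m, ∫ t in Ioo 0 T, ‖stepTime (τ m) (Q m) t‖ ^ 2 ≤ C ^ 2) {q X : ℝ → H}
    (hqL : MemLp q 2 (volume.restrict (Ioo 0 T)))
    (hq : WeakL2Tendsto T (fun m => stepTime (τ m) (Q m)) q)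
    (hXL : MemLp X 2 (volume.restrict (Ioo 0 T))) (hT : 0 < T) {e w : H} {u₀ : ℝ}
    (hu₀ : Tendsto (fun m => inner ℝ (v m 0) w) atTop (𝓝 u₀))
    (hvX : ∀ t ∈ Icc 0 T, Tendsto (fun m => inner ℝ (v m ⌊t / τ m⌋₊) w) atTop
      (𝓝 (u₀ + ∫ s in 0..t, inner ℝ (X s) w)))
    {ε : ℕ → ℝ} (hε : Tendsto ε atTop (𝓝 0))
    (h : ∀ m, ∀ k ≤ N m, |∑ n ∈ Finset.range k, τ m * inner ℝ (Q m n) e +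
      (inner ℝ (v m k) w - inner ℝ (v m 0) w)| ≤ ε m) :
    ∀ᵐ t ∂(volume.restrict (Ioo 0 T)), inner ℝ (q t) e = -inner ℝ (X t) w := by
  refine ae_eq_of_forall_integral_eq
    (intervalIntegrable_of_memLp (memLp_inner_const hqL e) le_rfl hT.le le_rfl)
    (intervalIntegrable_of_memLp (memLp_inner_const hXL w) le_rfl hT.le le_rfl).neg fun t ht => ?_
  refine tendsto_nhds_unique (tendsto_integral_floor hτ hτ0
    (fun m => memLp_stepTime (hτ m) (hN m) (Q m)) hC hQ hq ht e) ?_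
  have h1 : Tendsto (fun m => ∑ n ∈ Finset.range ⌊t / τ m⌋₊, τ m * inner ℝ (Q m n) e +
      (inner ℝ (v m ⌊t / τ m⌋₊) w - inner ℝ (v m 0) w)) atTop (𝓝 0) :=
    squeeze_zero_norm (fun m => h m _ (floor_div_le (hτ m) (hN m) ht.2)) hε
  have h2 := h1.sub ((hvX t ht).sub hu₀)
  rw [zero_sub, add_sub_cancel_left] at h2
  rw [intervalIntegral.integral_neg]
  refine h2.congr fun m => ?_
  rw [add_sub_cancel_right, integral_inner_stepTime (hτ m)]

omit hτ0 in
-- For each `m` the identity holds exactly, by integration by parts in time on every cell and the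
-- scheme inside the cell. It is linear in velocity and fluxes, so weak convergence against the
-- fixed test function passes to the limit.
theorem integral_inner_eq_of_scheme {d Y Q : ℕ → ℕ → H} {x y q : ℝ → H}
    (hx : WeakL2Tendsto T (fun m => affineTime (τ m) (d m)) x)
    (hy : WeakL2Tendsto T (fun m => stepTime (τ m) (Y m)) y)
    (hq : WeakL2Tendsto T (fun m => stepTime (τ m) (Q m)) q) (hT : 0 < T)
    {P Px Pt : ℝ → H} (hPx : MemLp Px 2 (volume.restrict (Ioo 0 T)))
    (hPt : MemLp Pt 2 (volume.restrict (Ioo 0 T)))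
    (hP : ∀ e : H, ∀ t ∈ Icc 0 T, inner ℝ e (P t) = inner ℝ e (P 0) + ∫ s in 0..t, inner ℝ e (Pt s))
    (hPT : P T = 0) {ψ : ℝ} (hψ : Tendsto (fun m => inner ℝ (d m 0) (P 0)) atTop (𝓝 ψ))
    (h : ∀ m, ∀ n < N m, ∀ᵐ t ∂(volume.restrict (Ioo 0 T)),
      inner ℝ (d m (n + 1) - d m n) (P t) = -τ m * inner ℝ (Y m n + Q m n) (Px t)) :
    ∫ t in Ioo 0 T, inner ℝ (x t) (Pt t) =
      -ψ + ((∫ t in Ioo 0 T, inner ℝ (y t) (Px t)) + ∫ t in Ioo 0 T, inner ℝ (q t) (Px t)) := by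
  have key : ∀ m, ∫ t in Ioo 0 T, inner ℝ (affineTime (τ m) (d m) t) (Pt t) =
      -inner ℝ (d m 0) (P 0) + ((∫ t in Ioo 0 T, inner ℝ (stepTime (τ m) (Y m) t) (Px t)) +
        ∫ t in Ioo 0 T, inner ℝ (stepTime (τ m) (Q m) t) (Px t)) := by
    intro m
    have hτm := hτ m
    have hle : ∀ n : ℕ, (n : ℝ) * τ m ≤ (n + 1) * τ m := fun n => by nlinarith
    have h0n : ∀ n : ℕ, (0 : ℝ) ≤ n * τ m := fun n => by positivity
    have hnT : ∀ n < N m, ((n : ℝ) + 1) * τ m ≤ T := fun n hn => by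
      rw [← hN m]
      have : (n : ℝ) + 1 ≤ N m := by exact_mod_cast hn
      gcongr
    rw [← integral_add (integrable_inner (memLp_stepTime hτm (hN m) (Y m)) hPx)
      (integrable_inner (memLp_stepTime hτm (hN m) (Q m)) hPx)]
    rw [← integral_Ioc_eq_integral_Ioo, ← integral_Ioc_eq_integral_Ioo,
      ← intervalIntegral.integral_of_le hT.le, ← intervalIntegral.integral_of_le hT.le,
      integral_inner_affineTime_add hτm (hN m) (d m) hPt hP hPT, ← hN m,
      integral_eq_sum_cells hτm (g := fun n t => inner ℝ (Y m n + Q m n) (Px t)) (N m)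
      (fun n hn => by
        have := intervalIntegrable_of_memLp (memLp_inner_const hPx (Y m n + Q m n)) (h0n n)
          (hle n) (hnT n hn)
        simpa only [real_inner_comm] using this)
      (fun n _ t ht => by rw [stepTime, stepTime, floor_div_eq hτm ht, inner_add_left]),
      sub_eq_add_neg, ← Finset.sum_neg_distrib]
    congr 1
    refine Finset.sum_congr rfl fun n hn => ?_
    have hn := Finset.mem_range.mp hn
    rw [neg_eq_iff_eq_neg, ← intervalIntegral.integral_neg,
      ← intervalIntegral.integral_const_mul]
    rw [intervalIntegral.integral_of_le (hle n), intervalIntegral.integral_of_le (hle n),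
      integral_Ioc_eq_integral_Ioo, integral_Ioc_eq_integral_Ioo]
    refine integral_congr_ae ?_
    filter_upwards [ae_restrict_of_ae_restrict_of_subset (Ioo_subset_Ioo (h0n n) (hnT n hn))
      (h m n hn)] with t ht
    rw [ht]
    field_simp
  refine tendsto_nhds_unique (hx Pt hPt) ?_
  exact (hψ.neg.add ((hy Px hPx).add (hq Px hPx))).congr fun m => (key m).symm

end Limits

/-- Exchange of quantifiers for a family of conditions depending continuously on a parameter in a
separable space. -/
theorem ae_forall_of_forall_ae {α E : Type*} [MeasurableSpace α] {μ : Measure α}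
    [TopologicalSpace E] [SecondCountableTopology E] (S : Set E) {F : α → E → ℝ}
    (hF : ∀ t, Continuous (F t)) (h : ∀ e ∈ S, ∀ᵐ t ∂μ, F t e = 0) :
    ∀ᵐ t ∂μ, ∀ e ∈ S, F t e = 0 := by
  obtain ⟨c, hc, hd⟩ := TopologicalSpace.exists_countable_dense S
  have h1 : ∀ᵐ t ∂μ, ∀ e ∈ c, F t (e : E) = 0 := (ae_ball_iff hc).mpr fun e _ => h e e.2
  filter_upwards [h1] with t ht e he
  have hcl : IsClosed {s : S | F t s = 0} :=
    isClosed_eq ((hF t).comp continuous_subtype_val) continuous_const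
  exact (hcl.closure_subset_iff.mpr ht) (hd ⟨e, he⟩)

/-! ### Identification of the limits: the space variable -/

/-- As the test functions need not vanish at `0` and `L`, the identity contains the boundary
conditions: `φ = 1` gives `∫ g = 0`, and primitives of compactly supported functions show that `f`
is the primitive of `g` vanishing at `0`. -/
theorem memH10_of_forall {L : ℝ} (hL : 0 < L) {f g : LineL2}
    (hf : ∀ᵐ x ∂(volume : Measure ℝ), x ∉ Ioo 0 L → f x = 0)
    (h : ∀ φ φ' : C(ℝ, ℝ), (∀ s, HasDerivAt φ (φ' s) s) → (∃ K, ∀ s, |φ' s| ≤ K) →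
      inner ℝ g (windowLp 0 L φ) = -inner ℝ f (windowLp 0 L φ')) : MemH10 L f g := by
  have h' : ∀ φ φ' : C(ℝ, ℝ), (∀ s, HasDerivAt φ (φ' s) s) → (∃ K, ∀ s, |φ' s| ≤ K) →
      ∫ s in 0..L, φ s * g s = -∫ s in 0..L, φ' s * f s := by
    intro φ φ' h1 h2
    have := h φ φ' h1 h2
    rwa [real_inner_comm, inner_windowLp hL.le, real_inner_comm, inner_windowLp hL.le] at this
  have hg0 : ∫ s in 0..L, g s = 0 := by
    have := h' 1 0 (fun s => hasDerivAt_const s 1) ⟨0, by simp⟩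
    simpa using this
  refine ⟨?_, hg0⟩
  set G : ℝ → ℝ := fun x => ∫ s in 0..x, g s with hG
  have hGc : Continuous G :=
    intervalIntegral.continuous_primitive (fun a b => LineL2.intervalIntegrable g a b) 0
  have key : ∀ᵐ x ∂(volume : Measure ℝ), x ∈ Ioo 0 L → f x - G x = 0 := by
    refine isOpen_Ioo.ae_eq_zero_of_integral_contDiff_smul_eq_zero ?_ fun ψ hψ hψc hψs => ?_
    · exact (((Lp.memLp f).locallyIntegrable (by norm_num)).sub
        hGc.locallyIntegrable).locallyIntegrableOn _
    have hψ0 : ∀ x ∉ Ioo 0 L, ψ x = 0 := fun x hx =>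
      image_eq_zero_of_notMem_tsupport fun hx' => hx (hψs hx')
    have e1 : ∫ x, ψ x • (f x - G x) = ∫ x in 0..L, ψ x * (f x - G x) := by
      rw [intervalIntegral.integral_of_le hL.le, integral_Ioc_eq_integral_Ioo,
        setIntegral_eq_integral_of_forall_compl_eq_zero fun x hx => by rw [hψ0 x hx, zero_mul]]
      rfl
    have hder : ∀ x, HasDerivAt (fun x => ∫ s in 0..x, ψ s) (ψ x) x := fun x =>
      intervalIntegral.integral_hasDerivAt_right (hψ.continuous.intervalIntegrable _ _)
        (hψ.continuous.stronglyMeasurableAtFilter _ _) hψ.continuous.continuousAt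
    have hcont : Continuous fun x => ∫ s in 0..x, ψ s :=
      continuous_iff_continuousAt.mpr fun x => (hder x).continuousAt
    obtain ⟨K, hK⟩ := hψc.exists_bound_of_continuous hψ.continuous
    -- The primitive of `ψ` need not be compactly supported, but its derivative is bounded; this is
    -- why the class of test functions is defined by a bound on the derivative.
    have e2 := h' ⟨_, hcont⟩ ⟨ψ, hψ.continuous⟩ hder ⟨K, hK⟩
    have e3 := integral_mul_add_integral_deriv_mul hL.le (LineL2.intervalIntegrable g 0 L)
      (p := G) (fun x _ => by simp [hG]) hder hψ.continuous
    have e4 : G L = 0 := hg0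
    have e5 : G 0 = 0 := by simp [hG]
    rw [e4, e5] at e3
    simp only [ContinuousMap.coe_mk] at e2
    simp only [e1, mul_sub]
    rw [intervalIntegral.integral_sub
      ((LineL2.intervalIntegrable f 0 L).continuousOn_mul hψ.continuous.continuousOn)
      (Continuous.intervalIntegrable (by fun_prop) _ _)]
    linarith
  filter_upwards [hf, key] with x h1 h2
  by_cases hx : x ∈ Ioo 0 L
  · rw [indicator_of_mem hx]; exact sub_eq_zero.mp (h2 hx)
  · rw [indicator_of_notMem hx, h1 hx]

theorem eq_zero_of_tsupport_subset_Ioo {a b : ℝ} {φ : ℝ → ℝ} (h : tsupport φ ⊆ Ioo a b) {x : ℝ}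
    (hx : x ∉ Ioo a b) : φ x = 0 := image_eq_zero_of_notMem_tsupport fun hx' => hx (h hx')

namespace MemH10

variable {L a b : ℝ} {f g : LineL2}

theorem isWeakDeriv (h : MemH10 L f g) (ha : 0 ≤ a) (hab : a ≤ b) (hb : b ≤ L) :
    IsWeakDeriv a b (restrictLp a b f) (restrictLp a b g) := by
  intro φ hφ _ hs
  rw [setIntegral_restrictLp, setIntegral_restrictLp, ← integral_Ioc_eq_integral_Ioo,
    ← integral_Ioc_eq_integral_Ioo, ← intervalIntegral.integral_of_le hab,
    ← intervalIntegral.integral_of_le hab]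
  have h1 := h.integral_mul_eq ha hab hb (deriv φ)
  have hII := LineL2.intervalIntegrable g
  have h2 := integral_mul_add_integral_deriv_mul hab (hII a b) (p := fun x => ∫ s in 0..x, g s)
    (fun x _ => (intervalIntegral.integral_add_adjacent_intervals (hII _ _) (hII _ _)).symm)
    (fun x => (hφ.differentiable (by simp) x).hasDerivAt) (hφ.continuous_deriv (by simp))
  rw [eq_zero_of_tsupport_subset_Ioo hs (x := a) (by simp),
    eq_zero_of_tsupport_subset_Ioo hs (x := b) (by simp)] at h2
  simp only [mul_comm (f _), mul_comm (g _)]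
  linarith

theorem hasTrace (h : MemH10 L f g) (ha : 0 ≤ a) (hb : b ≤ L) (y : ℝ) :
    HasTrace a b (restrictLp a b f) y (∫ s in 0..y, g s) := by
  refine ⟨fun x => ∫ s in 0..x, g s, (intervalIntegral.continuous_primitive
    (fun a b => LineL2.intervalIntegrable g a b) 0).continuousOn, ?_, rfl⟩
  filter_upwards [coeFn_restrictLp a b f, ae_restrict_of_ae h.ae_eq,
    ae_restrict_mem measurableSet_Ioo] with x h1 h2 h3
  rw [h1, h2, indicator_of_mem (Ioo_subset_Ioo ha hb h3)]

end MemH10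

namespace Problem

variable (D : Problem)

theorem hasGradient_split {f g : LineL2} (h : MemH10 D.L f g) :
    D.HasGradient (D.split f) (D.split g) :=
  ⟨h.isWeakDeriv le_rfl D.α_pos.le (D.α_lt_β.trans D.β_lt_L).le,
    h.isWeakDeriv D.α_pos.le D.α_lt_β.le D.β_lt_L.le,
    h.isWeakDeriv D.β_pos.le D.β_lt_L.le le_rfl⟩

theorem boundaryTransmission_split {f g : LineL2} (h : MemH10 D.L f g) :
    D.BoundaryTransmission (D.split f) := by
  have h1 := h.hasTrace (a := 0) (b := D.α) le_rfl (D.α_lt_β.trans D.β_lt_L).le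
  have h2 := h.hasTrace (a := D.α) (b := D.β) D.α_pos.le D.β_lt_L.le
  have h3 := h.hasTrace (a := D.β) (b := D.L) D.β_pos.le le_rfl
  refine ⟨?_, ⟨_, h1 _, h2 _⟩, ⟨_, h2 _, h3 _⟩, ?_⟩
  · have := h1 0
    rwa [intervalIntegral.integral_same] at this
  · have := h3 D.L
    rwa [h.integral_eq_zero] at this

end Problem

/-- Multiplication by the indicator function of `(a, b)`. -/
def cutLp (a b : ℝ) : LineL2 →L[ℝ] LineL2 := (extendLp a b).comp (restrictLp a b)

theorem coeFn_cutLp (a b : ℝ) (f : LineL2) : cutLp a b f =ᵐ[volume] (Ioo a b).indicator f := by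
  filter_upwards [coeFn_extendLp a b (restrictLp a b f),
    (ae_restrict_iff' measurableSet_Ioo).mp (coeFn_restrictLp a b f)] with x h1 h2
  refine h1.trans ?_
  by_cases hx : x ∈ Ioo a b
  · rw [indicator_of_mem hx, indicator_of_mem hx, h2 hx]
  · rw [indicator_of_notMem hx, indicator_of_notMem hx]

theorem inner_cutLp_left (a b : ℝ) (f g : LineL2) :
    inner ℝ (cutLp a b f) g = inner ℝ f (cutLp a b g) := by
  rw [cutLp, ContinuousLinearMap.comp_apply, ContinuousLinearMap.comp_apply, inner_extendLp,
    real_inner_comm, inner_extendLp, real_inner_comm]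

theorem cutLp_windowLp {a b c d : ℝ} (hca : c ≤ a) (hbd : b ≤ d) (φ : C(ℝ, ℝ)) :
    cutLp a b (windowLp c d φ) = windowLp a b φ := by
  apply Lp.ext
  filter_upwards [coeFn_cutLp a b (windowLp c d φ), coeFn_windowLp c d φ,
    coeFn_windowLp a b φ] with x h1 h2 h3
  rw [h1, h3]
  by_cases hx : x ∈ Ioo a b
  · rw [indicator_of_mem hx, indicator_of_mem hx, h2, indicator_of_mem (Ioo_subset_Ioo hca hbd hx)]
  · rw [indicator_of_notMem hx, indicator_of_notMem hx]

/-! ### Recognition of the elastic and viscous fluxes as derivatives. -/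

namespace Problem

variable (D : Problem)

/-- The division of the three components by the squares of the speeds. -/
def rescale : LineL2 →L[ℝ] D.L2Triple :=
  ((D.C₁ ^ 2)⁻¹ • restrictLp 0 D.α).prod
    (((D.C₂ ^ 2)⁻¹ • restrictLp D.α D.β).prod ((D.C₃ ^ 2)⁻¹ • restrictLp D.β D.L))

theorem rescale_apply (y : LineL2) : D.rescale y = ((D.C₁ ^ 2)⁻¹ • restrictLp 0 D.α y,
    (D.C₂ ^ 2)⁻¹ • restrictLp D.α D.β y, (D.C₃ ^ 2)⁻¹ • restrictLp D.β D.L y) := rfl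

theorem inner_glue_rescale (y : LineL2) (φ : C(ℝ, ℝ)) :
    inner ℝ (D.glue (D.rescale y)) (windowLp 0 D.L φ) = inner ℝ y (D.slowness φ) := by
  have e : D.glue (D.rescale y) = (D.C₁ ^ 2)⁻¹ • cutLp 0 D.α y +
      (D.C₂ ^ 2)⁻¹ • cutLp D.α D.β y + (D.C₃ ^ 2)⁻¹ • cutLp D.β D.L y := by
    rw [glue_apply, rescale_apply, map_smul, map_smul, map_smul]
    rfl
  rw [e, slowness, inner_add_left, inner_add_left, inner_add_right, inner_add_right]
  simp only [real_inner_smul_left, inner_smul_right, inner_cutLp_left]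
  rw [cutLp_windowLp le_rfl (D.α_lt_β.trans D.β_lt_L).le,
    cutLp_windowLp D.α_pos.le D.β_lt_L.le, cutLp_windowLp D.β_pos.le le_rfl]

theorem memH10_of_slowness {w y : LineL2}
    (hw : ∀ᵐ x ∂(volume : Measure ℝ), x ∉ Ioo 0 D.L → w x = 0)
    (h : ∀ φ φ' : C(ℝ, ℝ), (∀ s, HasDerivAt φ (φ' s) s) → (∃ K, ∀ s, |φ' s| ≤ K) →
      inner ℝ y (D.slowness φ) = -inner ℝ w (windowLp 0 D.L φ')) :
    MemH10 D.L w (D.glue (D.rescale y)) :=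
  memH10_of_forall D.L_pos hw fun φ φ' h1 h2 => by rw [inner_glue_rescale, h φ φ' h1 h2]

theorem integral_eq_integral_of_zero {a b L : ℝ} (ha : 0 ≤ a) (hab : a ≤ b) (hb : b ≤ L)
    {φ : ℝ → ℝ} (hφ : ∀ s ∉ Ioo a b, φ s = 0) (f : ℝ → ℝ) :
    ∫ s in 0..L, φ s * f s = ∫ s in Ioo a b, φ s * f s := by
  rw [intervalIntegral.integral_of_le (ha.trans (hab.trans hb)), integral_Ioc_eq_integral_Ioo]
  exact setIntegral_eq_of_subset_of_forall_sdiff_eq_zero measurableSet_Ioo (Ioo_subset_Ioo ha hb)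
    fun x hx => by rw [hφ x hx.2, zero_mul]

/-- The limit viscous flux is `δ` times the derivative of the limit velocity, in the interior of
`(α, β)` only; nothing is claimed about traces of the velocity. -/
theorem isWeakDeriv_of_viscous {x q : LineL2}
    (h : ∀ φ φ' : C(ℝ, ℝ), (∀ s, HasDerivAt φ (φ' s) s) → (∃ K, ∀ s, |φ' s| ≤ K) →
      (∀ s, φ s ≠ 0 → s ∈ Ioo D.α D.β) →
      inner ℝ q (D.δ⁻¹ • windowLp 0 D.L φ) = -inner ℝ x (windowLp 0 D.L φ')) :
    IsWeakDeriv D.α D.β (restrictLp D.α D.β x) (restrictLp D.α D.β (D.δ⁻¹ • q)) := by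
  intro φ hφ hc hs
  have hcd : Continuous (deriv φ) := hφ.continuous_deriv (by simp)
  obtain ⟨K, hK⟩ := hc.deriv.exists_bound_of_continuous hcd
  have h1 := h ⟨φ, hφ.continuous⟩ ⟨deriv φ, hcd⟩
    (fun s => (hφ.differentiable (by simp) s).hasDerivAt) ⟨K, hK⟩ fun s hs' => by
      by_contra hcon
      exact hs' (eq_zero_of_tsupport_subset_Ioo hs hcon)
  have hLp := D.L_pos.le
  rw [inner_smul_right, ← real_inner_smul_left, real_inner_comm, inner_windowLp hLp, real_inner_comm,
    inner_windowLp hLp] at h1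
  simp only [ContinuousMap.coe_mk] at h1
  rw [integral_eq_integral_of_zero D.α_pos.le D.α_lt_β.le D.β_lt_L.le
      (fun s hs' => eq_zero_of_tsupport_subset_Ioo hs hs'),
    integral_eq_integral_of_zero D.α_pos.le D.α_lt_β.le D.β_lt_L.le
      (fun s hs' => eq_zero_of_tsupport_subset_Ioo
        ((tsupport_deriv_subset (f := φ)).trans hs) hs')] at h1
  rw [setIntegral_restrictLp, setIntegral_restrictLp]
  simp only [mul_comm _ (φ _), mul_comm _ (deriv φ _)]
  linarith

end Problem

/-! ### Identification of the limits: the time variable -/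

section TimeDerivative

variable {E F : Type*} [NormedAddCommGroup E] [NormedSpace ℝ E] [NormedAddCommGroup F]
  [NormedSpace ℝ F] {T : ℝ}

theorem integrable_smul_of_contDiff {φ : ℝ → ℝ} (hφ : Continuous φ) (hc : HasCompactSupport φ)
    {U : ℝ → E} (hU : Integrable U (volume.restrict (Ioo 0 T))) :
    Integrable (fun t => φ t • U t) (volume.restrict (Ioo 0 T)) := by
  obtain ⟨K, hK⟩ := hc.exists_bound_of_continuous hφ
  exact hU.bdd_smul K hφ.aestronglyMeasurable (Eventually.of_forall hK)

theorem IsWeakTimeDeriv.clm_comp [CompleteSpace E] [CompleteSpace F] {U U' : ℝ → E}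
    (h : IsWeakTimeDeriv T U U')
    (hU : Integrable U (volume.restrict (Ioo 0 T)))
    (hU' : Integrable U' (volume.restrict (Ioo 0 T))) (A : E →L[ℝ] F) :
    IsWeakTimeDeriv T (fun t => A (U t)) fun t => A (U' t) := by
  intro φ hφ hc hs
  have h1 := congrArg A (h φ hφ hc hs)
  rw [map_neg, ← A.integral_comp_comm (integrable_smul_of_contDiff (hφ.continuous_deriv (by simp))
    hc.deriv hU), ← A.integral_comp_comm (integrable_smul_of_contDiff hφ.continuous hc hU')] at h1
  simpa only [map_smul] using h1

/-- Pairing with a fixed vector of `H` reduces the claim to scalar integration by parts. -/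
theorem isWeakTimeDeriv_of_primitive {H : Type*} [NormedAddCommGroup H] [InnerProductSpace ℝ H]
    [CompleteSpace H] (hT : 0 < T) {X W : ℝ → H} (hX : MemLp X 2 (volume.restrict (Ioo 0 T)))
    (hWi : Integrable W (volume.restrict (Ioo 0 T)))
    (hW : ∀ t ∈ Icc 0 T, W t = W 0 + ∫ s in 0..t, X s) : IsWeakTimeDeriv T W X := by
  intro φ hφ hc hs
  have hXi : Integrable X (volume.restrict (Ioo 0 T)) := hX.integrable (by norm_num)
  refine ext_inner_left ℝ fun e => ?_
  rw [inner_neg_right, ← integral_inner (integrable_smul_of_contDiff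
    (hφ.continuous_deriv (by simp)) hc.deriv hWi), ← integral_inner
    (integrable_smul_of_contDiff hφ.continuous hc hXi)]
  simp only [inner_smul_right]
  have h1 := integral_mul_add_integral_deriv_mul hT.le
    (q := fun t => inner ℝ e (X t)) (p := fun t => inner ℝ e (W t))
    (by
      have := intervalIntegrable_of_memLp (memLp_inner_const hX e) le_rfl hT.le le_rfl
      simpa only [real_inner_comm] using this)
    (fun t ht => by
      rw [hW t ht, inner_add_right, hW 0 ⟨le_rfl, hT.le⟩, intervalIntegral.integral_same, add_zero]
      congr 1
      exact ((innerSL ℝ e).intervalIntegral_comp_comm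
        (intervalIntegrable_of_memLp hX le_rfl ht.1 ht.2)).symm)
    (fun x => (hφ.differentiable (by simp) x).hasDerivAt) (hφ.continuous_deriv (by simp))
  rw [eq_zero_of_tsupport_subset_Ioo hs (x := 0) (by simp),
    eq_zero_of_tsupport_subset_Ioo hs (x := T) (by simp)] at h1
  rw [← integral_Ioc_eq_integral_Ioo, ← integral_Ioc_eq_integral_Ioo,
    ← intervalIntegral.integral_of_le hT.le, ← intervalIntegral.integral_of_le hT.le]
  linarith

/-- Used for test functions of the weak formulation: their continuous representative is the
primitive of the time derivative after any functional is applied, as the discrete integration by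
parts requires. -/
theorem IsWeakTimeDeriv.eq_add_integral [CompleteSpace E] (hT : 0 < T) {U U' : ℝ → E}
    (h : IsWeakTimeDeriv T U U') (hc : ContinuousOn U (Icc 0 T))
    (hU' : Integrable U' (volume.restrict (Ioo 0 T))) (A : E →L[ℝ] ℝ) :
    ∀ t ∈ Icc 0 T, A (U t) = A (U 0) + ∫ s in 0..t, A (U' s) := by
  have hU : Integrable U (volume.restrict (Ioo 0 T)) :=
    (hc.integrableOn_compact isCompact_Icc).mono_set Ioo_subset_Icc_self
  have h1 := h.clm_comp hU hU' A
  refine eq_add_integral_of_weakDeriv hT (A.continuous.comp_continuousOn hc) ?_ ?_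
  · rw [intervalIntegrable_iff_integrableOn_Ioo_of_le hT.le]
    exact A.integrable_comp hU'
  · intro φ hφ hcφ hs
    have := h1 φ hφ hcφ hs
    simpa only [smul_eq_mul, mul_comm] using this

end TimeDerivative

/-! ### Supports of the discrete functions -/

theorem ae_cutLp_eq (a b : ℝ) (g : LineL2) :
    ∀ᵐ x ∂(volume : Measure ℝ), x ∈ Ioo a b → cutLp a b g x = g x := by
  filter_upwards [coeFn_cutLp a b g] with x hx hx'
  rw [hx, indicator_of_mem hx']

namespace Mesh

variable (M : Mesh) (D : Problem)

theorem inner_step_cutLp (V : ℕ → ℝ) (g : LineL2) :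
    inner ℝ (M.step D V) (cutLp 0 D.L g) = inner ℝ (M.step D V) g := by
  have hm := (M.edge_strictMono D).monotone
  rw [inner_stepLp (M.edge_strictMono D), inner_stepLp (M.edge_strictMono D)]
  refine Finset.sum_congr rfl fun j hj => ?_
  rw [setIntegral_eq_of_ae (ae_cutLp_eq 0 D.L g) (by rw [← M.edge_zero D]; exact hm j.zero_le)
    (hm j.le_succ) (by rw [← M.edge_Nmax D]; exact hm (Finset.mem_range.mp hj))]

/-- The viscous flux vanishes at the edges `α` and `β`, so on every cell outside `(α, β)` both its
end values are zero. -/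
theorem inner_dampLp_cutLp (V : ℕ → ℝ) (g : LineL2) :
    inner ℝ (M.dampLp D V) (cutLp D.α D.β g) = inner ℝ (M.dampLp D V) g := by
  have hm := (M.edge_strictMono D).monotone
  rw [dampLp, LinearMap.comp_apply, inner_affineLp (M.edge_strictMono D),
    inner_affineLp (M.edge_strictMono D)]
  refine Finset.sum_congr rfl fun j _ => ?_
  by_cases hj : M.Nα ≤ j ∧ j < M.Nα + M.N
  · refine setIntegral_eq_of_ae ((ae_cutLp_eq D.α D.β g).mono fun x hx hx' => by rw [hx hx'])
      (by rw [← M.edge_Nα D]; exact hm hj.1) (hm j.le_succ)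
      (by rw [← M.edge_Nα_add_N D]; exact hm hj.2)
  · have h1 : M.dampFlux D V j = 0 := by
      rw [dampFlux_apply, viscosity, if_neg (by omega), zero_mul]
    have h2 : M.dampFlux D V (j + 1) = 0 := by
      rw [dampFlux_apply, viscosity, if_neg (by omega), zero_mul]
    simp [h1, h2]

theorem step_congr {V W : ℕ → ℝ} (h : ∀ i ∈ Finset.Icc 1 M.Nmax, V i = W i) :
    M.step D V = M.step D W := by
  rw [stepLp_apply, stepLp_apply]
  exact Finset.sum_congr rfl fun j hj => by
    rw [h (j + 1) (Finset.mem_Icc.mpr ⟨by omega, Finset.mem_range.mp hj⟩)]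

theorem norm_step_averages_le (g : LineL2) : ‖M.step D (M.averages D g)‖ ≤ ‖g‖ := by
  apply le_of_sq_le_sq _ (norm_nonneg _)
  rw [norm_step_sq]
  exact M.massForm_le_of_cellAvg D fun j hj => M.averages_succ D g hj

theorem step_cellMean (F : D.L2Triple) :
    M.step D (M.cellMean D F) = M.step D (M.averages D (D.glue F)) :=
  M.step_congr D fun i hi => by
    obtain ⟨j, rfl⟩ : ∃ j, i = j + 1 := ⟨i - 1, by have := Finset.mem_Icc.mp hi; omega⟩
    have hj : j < M.Nmax := (Finset.mem_Icc.mp hi).2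
    rw [M.cellMean_succ D F hj, M.averages_succ D _ hj]

theorem step_averages_sub (f g : LineL2) :
    M.step D (M.averages D f) - M.step D (M.averages D g) = M.step D (M.averages D (f - g)) := by
  rw [← map_sub]
  exact M.step_congr D fun i hi => by
    obtain ⟨j, rfl⟩ : ∃ j, i = j + 1 := ⟨i - 1, by have := Finset.mem_Icc.mp hi; omega⟩
    have hj : j < M.Nmax := (Finset.mem_Icc.mp hi).2
    rw [Pi.sub_apply, M.averages_succ D _ hj, M.averages_succ D _ hj, M.averages_succ D _ hj,
      cellAvg_sub]

end Mesh

/-! ### Convergence of the discrete data -/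

section Data

variable {D : Problem} {𝒯 : ℕ → Mesh} (hsize : Tendsto (fun m => (𝒯 m).size D) atTop (𝓝 0))
include hsize

theorem tendsto_inner_step_averages {p q : LineL2} (h : MemH10 D.L p q) (e : LineL2) :
    Tendsto (fun m => inner ℝ ((𝒯 m).step D ((𝒯 m).averages D p)) e) atTop (𝓝 (inner ℝ p e)) := by
  rw [tendsto_iff_norm_sub_tendsto_zero]
  have h1 : Tendsto (fun m => √((𝒯 m).size D) * ‖q‖ * ∫ s in 0..D.L, |e s|) atTop (𝓝 0) := by
    have := (hsize.sqrt.mul_const ‖q‖).mul_const (∫ s in 0..D.L, |e s|)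
    simpa using this
  refine squeeze_zero (fun _ => norm_nonneg _) (fun m => ?_) h1
  exact abs_inner_stepLp_cellAvg_sub_le ((𝒯 m).edge_strictMono D) _ ((𝒯 m).edge_zero D)
    ((𝒯 m).edge_Nmax D) (fun j hj => (𝒯 m).edge_succ_sub_le_size D hj) h
    (fun j hj => (𝒯 m).averages_succ D p hj) e

/-- Averaging is a contraction uniformly in the mesh, so convergence on `H¹₀` extends to its `L²`
closure. The initial velocity needs this extension because of its jumps. -/
theorem tendsto_inner_step_averages_of_approx {g : LineL2}
    (h : ∀ η : ℝ, 0 < η → ∃ p q : LineL2, MemH10 D.L p q ∧ ‖g - p‖ ≤ η) (e : LineL2) :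
    Tendsto (fun m => inner ℝ ((𝒯 m).step D ((𝒯 m).averages D g)) e) atTop (𝓝 (inner ℝ g e)) := by
  rw [Metric.tendsto_atTop]
  intro ε hε
  have he := norm_nonneg e
  obtain ⟨p, q, hpq, hη⟩ := h (ε / (4 * (‖e‖ + 1))) (by positivity)
  have hη' : ‖g - p‖ * ‖e‖ ≤ ε / 4 := by
    calc ‖g - p‖ * ‖e‖ ≤ ε / (4 * (‖e‖ + 1)) * (‖e‖ + 1) := by gcongr; linarith
      _ = ε / 4 := by field_simp
  obtain ⟨m₀, hm₀⟩ := (Metric.tendsto_atTop.mp (tendsto_inner_step_averages hsize hpq e)) (ε / 4)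
    (by positivity)
  refine ⟨m₀, fun m hm => ?_⟩
  have h1 := hm₀ m hm
  rw [Real.dist_eq] at h1 ⊢
  have h2 : |inner ℝ ((𝒯 m).step D ((𝒯 m).averages D g)) e -
      inner ℝ ((𝒯 m).step D ((𝒯 m).averages D p)) e| ≤ ε / 4 := by
    rw [← inner_sub_left, Mesh.step_averages_sub]
    exact (abs_real_inner_le_norm _ _).trans
      ((mul_le_mul_of_nonneg_right ((𝒯 m).norm_step_averages_le D _) he).trans hη')
  have h3 : |inner ℝ g e - inner ℝ p e| ≤ ε / 4 := by
    rw [← inner_sub_left]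
    exact (abs_real_inner_le_norm _ _).trans hη'
  rw [abs_lt] at h1 ⊢
  rw [abs_le] at h2 h3
  constructor <;> linarith

theorem tendsto_inner_step_cellMean {F : D.L2Triple} (hF : D.MemH1 F) (e : LineL2) :
    Tendsto (fun m => inner ℝ ((𝒯 m).step D ((𝒯 m).cellMean D F)) e) atTop
      (𝓝 (inner ℝ (D.glue F) e)) := by
  simp only [Mesh.step_cellMean]
  obtain ⟨G, hG⟩ := hF
  obtain ⟨K, hK, hnear⟩ := D.exists_memH10_near hG
  refine tendsto_inner_step_averages_of_approx hsize (fun η hη => ?_) e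
  have h1 : 0 < D.L - D.β := sub_pos.mpr D.β_lt_L
  set w := min (min D.α (D.L - D.β)) ((η / (K + 1)) ^ 2) with hw
  have hw0 : 0 < w := lt_min (lt_min D.α_pos h1) (by positivity)
  obtain ⟨p, q, hpq, -, hp, -⟩ := hnear w hw0 ((min_le_left _ _).trans (min_le_left _ _))
    ((min_le_left _ _).trans (min_le_right _ _))
  refine ⟨p, q, hpq, hp.trans ?_⟩
  have h2 : √w ≤ η / (K + 1) := by
    rw [Real.sqrt_le_left (by positivity)]
    exact min_le_right _ _
  calc K * √w ≤ (K + 1) * (η / (K + 1)) := by gcongr; linarith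
    _ = η := by field_simp

end Data

/-! ### Weak limits of the discrete solutions -/

/-- A sequence of discrete solutions whose velocities and fluxes converge weakly. -/
structure LimitData (D : Problem) (T : ℝ) (Φ Ψ : D.L2Triple) (𝒯 : ℕ → Mesh) (𝒩 : ℕ → ℕ)
    (U : ℕ → ℕ → ℕ → ℝ) (C : ℝ) (x y q : ℝ → LineL2) : Prop where
  T_pos : 0 < T
  pos : ∀ m, 0 < 𝒩 m
  isDiscreteSolution : ∀ m, (𝒯 m).IsDiscreteSolution D T (𝒩 m) Φ Ψ (U m)
  size_tendsto : Tendsto (fun m => (𝒯 m).size D) atTop (𝓝 0)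
  step_tendsto : Tendsto (fun m => T / (𝒩 m : ℝ)) atTop (𝓝 0)
  C_nonneg : 0 ≤ C
  bounds : ∀ m, EnergyBounds D (𝒯 m) (𝒩 m) (T / 𝒩 m) C ((𝒯 m).cellMean D Ψ) (U m)
  memLp_x : MemLp x 2 (volume.restrict (Ioo 0 T))
  memLp_y : MemLp y 2 (volume.restrict (Ioo 0 T))
  memLp_q : MemLp q 2 (volume.restrict (Ioo 0 T))
  tendsto_x : WeakL2Tendsto T (fun m => affineTime (T / 𝒩 m)
    ((𝒯 m).velLp D (T / 𝒩 m) ((𝒯 m).cellMean D Ψ) (U m))) x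
  tendsto_y : WeakL2Tendsto T (fun m => stepTime (T / 𝒩 m)
    ((𝒯 m).elasticLp D (T / 𝒩 m) ((𝒯 m).cellMean D Ψ) (U m))) y
  tendsto_q : WeakL2Tendsto T (fun m => stepTime (T / 𝒩 m)
    ((𝒯 m).viscousLp D (T / 𝒩 m) ((𝒯 m).cellMean D Ψ) (U m))) q

/-! ### Extraction of the convergent subsequence. -/

namespace EnergyBounds

variable {M : Mesh} {D : Problem} {N : ℕ} {τ C T : ℝ} {ψ : ℕ → ℝ} {U : ℕ → ℕ → ℝ}

theorem norm_velLp_le (h : EnergyBounds D M N τ C ψ U) (hτ : 0 < τ) {n : ℕ} (hn : n ≤ N) :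
    ‖M.velLp D τ ψ U n‖ ≤ √C := Real.le_sqrt_of_sq_le (h.norm_velLp_sq_le hτ hn)

theorem norm_elasticLp_le (h : EnergyBounds D M N τ C ψ U) {n : ℕ} (hn : n < N) :
    ‖M.elasticLp D τ ψ U n‖ ≤ √(D.maxSpeedSq * C) :=
  Real.le_sqrt_of_sq_le (h.norm_elasticLp_sq_le hn)

theorem integral_norm_sq_viscous_le (h : EnergyBounds D M N τ C ψ U) (hτ : 0 < τ) (hN : 0 < N)
    (hNτ : N * τ = T) (hC : 0 ≤ C) :
    ∫ t in Ioo 0 T, ‖stepTime τ (M.viscousLp D τ ψ U) t‖ ^ 2 ≤ √(D.δ * (C + C * T)) ^ 2 := by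
  have hδ := D.δ_pos
  have hτT : τ ≤ T := by
    rw [← hNτ]
    have : (1 : ℝ) ≤ N := by exact_mod_cast hN
    nlinarith
  have hT : 0 ≤ T := hτ.le.trans hτT
  rw [integral_norm_sq_stepTime hτ hNτ, Real.sq_sqrt (by positivity)]
  refine (h.sum_norm_viscousLp_sq_le hτ hN).trans ?_
  gcongr

end EnergyBounds

theorem exists_limitData {D : Problem} {T : ℝ} (hT : 0 < T) {Φ Ψ : D.L2Triple}
    (hΦ : D.MemH1L Φ) (hΨ : D.MemH1 Ψ) {𝒯 : ℕ → Mesh} {𝒩 : ℕ → ℕ} (h𝒩 : ∀ m, 0 < 𝒩 m)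
    {U : ℕ → ℕ → ℕ → ℝ} (hU : ∀ m, (𝒯 m).IsDiscreteSolution D T (𝒩 m) Φ Ψ (U m))
    (hsize : Tendsto (fun m => (𝒯 m).size D) atTop (𝓝 0))
    (hΔt : Tendsto (fun m => T / (𝒩 m : ℝ)) atTop (𝓝 0)) :
    ∃ σ : ℕ → ℕ, StrictMono σ ∧ ∃ C x y q, LimitData D T Φ Ψ (fun k => 𝒯 (σ k))
      (fun k => 𝒩 (σ k)) (fun k => U (σ k)) C x y q := by
  obtain ⟨C, hC, hbound⟩ := exists_energyBounds D hT hΦ hΨ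
  have hb := fun m => hbound (𝒯 m) (𝒩 m) (U m) (h𝒩 m) (hU m)
  have hNr : ∀ m, (0 : ℝ) < 𝒩 m := fun m => by exact_mod_cast h𝒩 m
  have hτ : ∀ m, 0 < T / (𝒩 m : ℝ) := fun m => div_pos hT (hNr m)
  have hN : ∀ m, 𝒩 m * (T / (𝒩 m : ℝ)) = T := fun m => mul_div_cancel₀ _ (hNr m).ne'
  have hdx := fun m => memLp_affineTime (hτ m) (hN m) fun n hn => (hb m).norm_velLp_le (hτ m) hn
  obtain ⟨σ₁, hσ₁, x, hx, hx'⟩ := exists_weakL2Tendsto hdx (Real.sqrt_nonneg (T * √C ^ 2))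
    fun m => by
      rw [Real.sq_sqrt (by positivity)]
      exact integral_norm_sq_le_of_bound hT.le (hdx m) fun t ht => pow_le_pow_left₀ (norm_nonneg _)
        (norm_affineTime_le (hτ m) (hN m) (fun n hn => (hb m).norm_velLp_le (hτ m) hn) ht) 2
  have hc := D.maxSpeedSq_pos
  have hdy := fun m => memLp_stepTime (hτ m) (hN m)
    ((𝒯 m).elasticLp D (T / 𝒩 m) ((𝒯 m).cellMean D Ψ) (U m))
  obtain ⟨σ₂, hσ₂, y, hy, hy'⟩ := exists_weakL2Tendsto (fun m => hdy (σ₁ m))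
    (Real.sqrt_nonneg (T * (D.maxSpeedSq * C))) fun m => by
      rw [Real.sq_sqrt (by positivity)]
      exact integral_norm_sq_le_of_bound hT.le (hdy (σ₁ m)) fun t ht =>
        (hb (σ₁ m)).norm_elasticLp_sq_le (floor_div_lt (hτ _) (hN _) ht)
  have hdq := fun m => memLp_stepTime (hτ m) (hN m)
    ((𝒯 m).viscousLp D (T / 𝒩 m) ((𝒯 m).cellMean D Ψ) (U m))
  obtain ⟨σ₃, hσ₃, q, hq, hq'⟩ := exists_weakL2Tendsto (fun m => hdq (σ₁ (σ₂ m)))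
    (Real.sqrt_nonneg (D.δ * (C + C * T))) fun m =>
      (hb _).integral_norm_sq_viscous_le (hτ _) (h𝒩 _) (hN _) hC
  have hσ : StrictMono fun k => σ₁ (σ₂ (σ₃ k)) := hσ₁.comp (hσ₂.comp hσ₃)
  refine ⟨fun k => σ₁ (σ₂ (σ₃ k)), hσ, C, x, y, q, ?_⟩
  exact {
    T_pos := hT
    pos := fun m => h𝒩 _
    isDiscreteSolution := fun m => hU _
    size_tendsto := hsize.comp hσ.tendsto_atTop
    step_tendsto := hΔt.comp hσ.tendsto_atTop
    C_nonneg := hC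
    bounds := fun m => hb _
    memLp_x := hx
    memLp_y := hy
    memLp_q := hq
    tendsto_x := hx'.comp (hσ₂.comp hσ₃)
    tendsto_y := hy'.comp hσ₃
    tendsto_q := hq' }

/-! ### Properties of the limits. -/

namespace LimitData

variable {D : Problem} {T : ℝ} {Φ Ψ : D.L2Triple} {𝒯 : ℕ → Mesh} {𝒩 : ℕ → ℕ}
  {U : ℕ → ℕ → ℕ → ℝ} {C : ℝ} {x y q : ℝ → LineL2}

theorem natCast_pos (h : LimitData D T Φ Ψ 𝒯 𝒩 U C x y q) (m : ℕ) : (0 : ℝ) < 𝒩 m := by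
  exact_mod_cast h.pos m

theorem τ_pos (h : LimitData D T Φ Ψ 𝒯 𝒩 U C x y q) (m : ℕ) : 0 < T / (𝒩 m : ℝ) :=
  div_pos h.T_pos (h.natCast_pos m)

theorem mul_τ (h : LimitData D T Φ Ψ 𝒯 𝒩 U C x y q) (m : ℕ) : 𝒩 m * (T / (𝒩 m : ℝ)) = T :=
  mul_div_cancel₀ _ (h.natCast_pos m).ne'

theorem τ_le (h : LimitData D T Φ Ψ 𝒯 𝒩 U C x y q) (m : ℕ) : T / (𝒩 m : ℝ) ≤ T :=
  div_le_self h.T_pos.le (by exact_mod_cast h.pos m)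

theorem step_succ (h : LimitData D T Φ Ψ 𝒯 𝒩 U C x y q) (m n : ℕ) :
    (𝒯 m).step D (U m (n + 1)) = (𝒯 m).step D (U m n) + (T / (𝒩 m : ℝ)) •
      (𝒯 m).velLp D (T / 𝒩 m) ((𝒯 m).cellMean D Ψ) (U m) (n + 1) := by
  rw [Mesh.velLp, ← map_smul, smul_velocity_succ _ _ (h.τ_pos m).ne', ← map_add]
  congr 1
  abel

theorem step_zero (h : LimitData D T Φ Ψ 𝒯 𝒩 U C x y q) (m : ℕ) :
    (𝒯 m).step D (U m 0) = (𝒯 m).step D ((𝒯 m).cellMean D Φ) :=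
  (𝒯 m).step_congr D (h.isDiscreteSolution m).init

theorem norm_step_le (h : LimitData D T Φ Ψ 𝒯 𝒩 U C x y q) (m : ℕ) {n : ℕ} (hn : n ≤ 𝒩 m) :
    ‖(𝒯 m).step D (U m n)‖ ≤ ‖D.glue Φ‖ + T * √C := by
  have key : ∀ k ≤ 𝒩 m, ‖(𝒯 m).step D (U m k)‖ ≤ ‖D.glue Φ‖ + k * (T / 𝒩 m) * √C := by
    intro k
    induction k with
    | zero =>
      intro _
      rw [h.step_zero, Mesh.step_cellMean]
      simpa using (𝒯 m).norm_step_averages_le D (D.glue Φ)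
    | succ k ih =>
      intro hk
      rw [h.step_succ]
      refine (norm_add_le _ _).trans ?_
      rw [norm_smul, Real.norm_of_nonneg (h.τ_pos m).le]
      have h1 := mul_le_mul_of_nonneg_left ((h.bounds m).norm_velLp_le (h.τ_pos m) hk)
        (h.τ_pos m).le
      have h2 := ih (by omega)
      push_cast
      linarith
  refine (key n hn).trans ?_
  have h1 : (n : ℝ) * (T / 𝒩 m) ≤ T := by
    calc (n : ℝ) * (T / 𝒩 m) ≤ 𝒩 m * (T / 𝒩 m) :=
          mul_le_mul_of_nonneg_right (by exact_mod_cast hn) (h.τ_pos m).le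
      _ = T := h.mul_τ m
  gcongr

/-- The limit of the discrete solutions. -/
def position (D : Problem) (Φ : D.L2Triple) (x : ℝ → LineL2) (t : ℝ) : LineL2 :=
  D.glue Φ + ∫ s in 0..t, x s

theorem tendsto_inner_step_zero (h : LimitData D T Φ Ψ 𝒯 𝒩 U C x y q) (hΦ : D.MemH1 Φ)
    (e : LineL2) :
    Tendsto (fun m => inner ℝ ((𝒯 m).step D (U m 0)) e) atTop (𝓝 (inner ℝ (D.glue Φ) e)) := by
  simp only [h.step_zero]
  exact tendsto_inner_step_cellMean h.size_tendsto hΦ e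

theorem inner_position (h : LimitData D T Φ Ψ 𝒯 𝒩 U C x y q) {t : ℝ} (ht : t ∈ Icc 0 T)
    (e : LineL2) :
    inner ℝ (position D Φ x t) e = inner ℝ (D.glue Φ) e + ∫ s in 0..t, inner ℝ (x s) e := by
  have h1 := (innerSL ℝ e).intervalIntegral_comp_comm
    (intervalIntegrable_of_memLp h.memLp_x le_rfl ht.1 ht.2)
  simp only [innerSL_apply_apply] at h1
  rw [position, inner_add_left, real_inner_comm e (∫ s in 0..t, x s), ← h1]
  simp only [real_inner_comm]

theorem tendsto_inner_step' (h : LimitData D T Φ Ψ 𝒯 𝒩 U C x y q) (hΦ : D.MemH1 Φ) (e : LineL2)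
    {t : ℝ} (ht : t ∈ Icc 0 T) :
    Tendsto (fun m => inner ℝ ((𝒯 m).step D (U m ⌊t / (T / (𝒩 m : ℝ))⌋₊)) e) atTop
      (𝓝 (inner ℝ (D.glue Φ) e + ∫ s in 0..t, inner ℝ (x s) e)) :=
  tendsto_inner_position h.τ_pos h.mul_τ h.step_tendsto
    (fun m _ hn => (h.bounds m).norm_velLp_le (h.τ_pos m) hn)
    (v := fun m n => (𝒯 m).step D (U m n)) (fun m n _ => h.step_succ m n) h.tendsto_x e
    (h.tendsto_inner_step_zero hΦ e) ht

theorem tendsto_inner_step (h : LimitData D T Φ Ψ 𝒯 𝒩 U C x y q) (hΦ : D.MemH1 Φ) (e : LineL2)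
    {t : ℝ} (ht : t ∈ Icc 0 T) :
    Tendsto (fun m => inner ℝ ((𝒯 m).step D (U m ⌊t / (T / (𝒩 m : ℝ))⌋₊)) e) atTop
      (𝓝 (inner ℝ (position D Φ x t) e)) := by
  rw [h.inner_position ht]
  exact h.tendsto_inner_step' hΦ e ht

theorem continuousOn_position (h : LimitData D T Φ Ψ 𝒯 𝒩 U C x y q) :
    ContinuousOn (position D Φ x) (Icc 0 T) := by
  have h1 := intervalIntegral.continuousOn_primitive_interval (a := 0) (b := T) (f := x)
    (μ := volume) (by
      rw [uIcc_of_le h.T_pos.le, integrableOn_Icc_iff_integrableOn_Ioo]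
      exact h.memLp_x.integrable (by norm_num))
  rw [uIcc_of_le h.T_pos.le] at h1
  exact continuousOn_const.add h1

/-- The discrete functions are unchanged by cutting to `(0, L)`; this passes to the weak limit. -/
theorem position_ae_eq_zero (h : LimitData D T Φ Ψ 𝒯 𝒩 U C x y q) (hΦ : D.MemH1 Φ) {t : ℝ}
    (ht : t ∈ Icc 0 T) :
    ∀ᵐ s ∂(volume : Measure ℝ), s ∉ Ioo 0 D.L → position D Φ x t s = 0 := by
  have h1 : position D Φ x t = cutLp 0 D.L (position D Φ x t) := by
    refine ext_inner_right ℝ fun e => ?_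
    rw [inner_cutLp_left]
    refine tendsto_nhds_unique (h.tendsto_inner_step hΦ e ht) ?_
    refine (h.tendsto_inner_step hΦ (cutLp 0 D.L e) ht).congr fun m => ?_
    exact (𝒯 m).inner_step_cutLp D _ e
  rw [h1]
  filter_upwards [coeFn_cutLp 0 D.L (position D Φ x t)] with s hs hs'
  rw [hs, indicator_of_notMem hs']

theorem ends_mem (h : LimitData D T Φ Ψ 𝒯 𝒩 U C x y q) (m : ℕ) : ∀ n ≤ 𝒩 m, U m n ∈ (𝒯 m).ends :=
  fun _ hn => (h.isDiscreteSolution m).mem_ends hn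

/-- The flux is evaluated on half of `U_{n+2} + U_n`, which differs from `U_{n+1}` by `τ/2` times a
difference of bounded velocities. Hence consistency of the flux with the position costs only one
extra term of order `τ`. -/
theorem ae_elastic (h : LimitData D T Φ Ψ 𝒯 𝒩 U C x y q) (hΦ : D.MemH1 Φ) {φ φ' : C(ℝ, ℝ)}
    (hφ : ∀ s, HasDerivAt φ (φ' s) s) {K : ℝ} (hK : ∀ s, |φ' s| ≤ K) :
    ∀ᵐ t ∂(volume.restrict (Ioo 0 T)),
      inner ℝ (y t) (D.slowness φ) = -inner ℝ (position D Φ x t) (windowLp 0 D.L φ') := by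
  obtain ⟨C₁, hC₁, hcons⟩ := Mesh.exists_consistency_stiffLp hφ hK D
  set e := D.slowness φ
  set w := windowLp 0 D.L φ'
  have hε : Tendsto (fun m => 2⁻¹ * (C₁ * (𝒯 m).size D * (1 + C)) +
      T / (𝒩 m : ℝ) * (√C * ‖w‖)) atTop (𝓝 0) := by
    have h1 := ((h.size_tendsto.const_mul C₁).mul_const (1 + C)).const_mul 2⁻¹
    have h2 := h.step_tendsto.mul_const (√C * ‖w‖)
    simpa using h1.add h2
  refine ae_inner_eq_neg_of_consistent h.τ_pos h.mul_τ h.step_tendsto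
    (fun m n hn => (h.bounds m).norm_elasticLp_le hn) h.memLp_y h.tendsto_y h.T_pos
    (v := fun m n => (𝒯 m).step D (U m n)) (h.continuousOn_position.inner continuousOn_const)
    (fun t ht => h.tendsto_inner_step hΦ w ht) hε fun m n hn => ?_
  set τ := T / (𝒩 m : ℝ) with hτ
  set ψ := (𝒯 m).cellMean D Ψ with hψ
  have hm := h.ends_mem m
  have h1 := hcons (𝒯 m) _ ((𝒯 m).stiffArg_mem_ends (τ := τ) ((𝒯 m).cellMean_mem_ends D Ψ) hm hn)
  have h2 := (h.bounds m).stiffForm_stiffArg_le hn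
  have h3 : |inner ℝ ((𝒯 m).stiffLp D (stiffArg τ ψ (U m) (n + 1))) e +
      inner ℝ ((𝒯 m).step D (stiffArg τ ψ (U m) (n + 1))) w| ≤ C₁ * (𝒯 m).size D * (1 + C) :=
    h1.trans (by have := (𝒯 m).size_pos D; gcongr)
  have h4 : (𝒯 m).step D (stiffArg τ ψ (U m) (n + 1)) = (2 : ℝ) • (𝒯 m).step D (U m (n + 1)) +
      τ • ((𝒯 m).velLp D τ ψ (U m) (n + 2) - (𝒯 m).velLp D τ ψ (U m) (n + 1)) := by
    have e1 : (𝒯 m).step D (U m (n + 2)) = (𝒯 m).step D (U m (n + 1)) +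
      τ • (𝒯 m).velLp D τ ψ (U m) (n + 2) := h.step_succ m (n + 1)
    have e2 : (𝒯 m).step D (U m (n + 1)) = (𝒯 m).step D (U m n) +
      τ • (𝒯 m).velLp D τ ψ (U m) (n + 1) := h.step_succ m n
    rw [stiffArg, map_add, e1, smul_sub, two_smul, eq_sub_of_add_eq e2.symm]
    abel
  have h5 : |inner ℝ ((𝒯 m).velLp D τ ψ (U m) (n + 2) - (𝒯 m).velLp D τ ψ (U m) (n + 1)) w| ≤
      2 * √C * ‖w‖ := by
    refine (abs_real_inner_le_norm _ _).trans ?_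
    have a1 := (h.bounds m).norm_velLp_le (h.τ_pos m) (n := n + 2) (by omega)
    have a2 := (h.bounds m).norm_velLp_le (h.τ_pos m) (n := n + 1) (by omega)
    gcongr
    refine (norm_sub_le _ _).trans ?_
    linarith
  rw [h4, inner_add_left, real_inner_smul_left, real_inner_smul_left] at h3
  rw [Mesh.elasticLp, real_inner_smul_left]
  have hτ0 : 0 < τ := h.τ_pos m
  have h6 : |τ * inner ℝ ((𝒯 m).velLp D τ ψ (U m) (n + 2) - (𝒯 m).velLp D τ ψ (U m) (n + 1)) w| ≤
      τ * (2 * √C * ‖w‖) := by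
    rw [abs_mul, abs_of_pos hτ0]
    exact mul_le_mul_of_nonneg_left h5 hτ0.le
  rw [abs_le] at h3 h6 ⊢
  constructor <;> linarith [h3.1, h3.2, h6.1, h6.2]

/-- Consistency is applied to `τ⁻¹` times the damping argument and multiplied by `τ`: the error is
the mesh size times `τ + τ⁻¹ a(·, ·)`, whose sum over the steps stays bounded by the dissipation
estimate. -/
theorem ae_viscous (h : LimitData D T Φ Ψ 𝒯 𝒩 U C x y q) (hΦ : D.MemH1 Φ) {φ φ' : C(ℝ, ℝ)}
    (hφ : ∀ s, HasDerivAt φ (φ' s) s) {K : ℝ} (hK : ∀ s, |φ' s| ≤ K)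
    (hsupp : ∀ s, φ s ≠ 0 → s ∈ Ioo D.α D.β) :
    ∀ᵐ t ∂(volume.restrict (Ioo 0 T)),
      inner ℝ (q t) (D.δ⁻¹ • windowLp 0 D.L φ) = -inner ℝ (x t) (windowLp 0 D.L φ') := by
  obtain ⟨C₁, hC₁, hcons⟩ := Mesh.exists_consistency_dampLp hφ hK D hsupp
  set e := D.δ⁻¹ • windowLp 0 D.L φ
  set w := windowLp 0 D.L φ'
  have hT := h.T_pos
  have hC := h.C_nonneg
  have hε : Tendsto (fun m => C₁ * (𝒯 m).size D * (T + (C + C * T)) +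
      T / (𝒩 m : ℝ) * (3 * √C * ‖w‖)) atTop (𝓝 0) := by
    have h1 := (h.size_tendsto.const_mul C₁).mul_const (T + (C + C * T))
    have h2 := h.step_tendsto.mul_const (3 * √C * ‖w‖)
    simpa using h1.add h2
  refine ae_inner_eq_neg_of_sum_consistent h.τ_pos h.mul_τ h.step_tendsto
    (C := √(D.δ * (C + C * T))) (Real.sqrt_nonneg _)
    (fun m => (h.bounds m).integral_norm_sq_viscous_le (h.τ_pos m) (h.pos m) (h.mul_τ m) hC)
    h.memLp_q h.tendsto_q h.memLp_x h.T_pos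
    (v := fun m n => (𝒯 m).step D (U m n)) (h.tendsto_inner_step_zero hΦ w)
    (fun t ht => h.tendsto_inner_step' hΦ w ht) hε fun m k hk => ?_
  have hτ0 := h.τ_pos m
  have hτT := h.τ_le m
  set τ := T / (𝒩 m : ℝ) with hτ
  set ψ := (𝒯 m).cellMean D Ψ with hψ
  have hsz := (𝒯 m).size_pos D
  have hm := h.ends_mem m
  have h1 : ∀ n < 𝒩 m, |2 * (τ * inner ℝ ((𝒯 m).viscousLp D τ ψ (U m) n) e) +
      inner ℝ ((𝒯 m).step D (dampArg τ ψ (U m) n)) w| ≤ C₁ * (𝒯 m).size D *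
        (τ + τ⁻¹ * (𝒯 m).dampForm D (dampArg τ ψ (U m) n) (dampArg τ ψ (U m) n)) := by
    intro n hn
    have h2 := hcons (𝒯 m) (τ⁻¹ • dampArg τ ψ (U m) n) ((𝒯 m).ends.smul_mem _
      ((𝒯 m).dampArg_mem_ends (τ := τ) ((𝒯 m).cellMean_mem_ends D Ψ) hm hn))
    simp only [map_smul, LinearMap.smul_apply, real_inner_smul_left, smul_eq_mul] at h2
    have h3 := mul_le_mul_of_nonneg_left h2 hτ0.le
    rw [← abs_of_pos hτ0, ← abs_mul, abs_of_pos hτ0] at h3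
    have e1 : τ * (τ⁻¹ * inner ℝ ((𝒯 m).dampLp D (dampArg τ ψ (U m) n)) e +
        τ⁻¹ * inner ℝ ((𝒯 m).step D (dampArg τ ψ (U m) n)) w) =
        2 * (τ * inner ℝ ((𝒯 m).viscousLp D τ ψ (U m) n) e) +
          inner ℝ ((𝒯 m).step D (dampArg τ ψ (U m) n)) w := by
      rw [Mesh.viscousLp, real_inner_smul_left]
      field_simp
    rw [e1] at h3
    refine h3.trans (le_of_eq ?_)
    field_simp
  have h2 : |2 * ∑ n ∈ Finset.range k, τ * inner ℝ ((𝒯 m).viscousLp D τ ψ (U m) n) e +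
      inner ℝ ((𝒯 m).step D (∑ n ∈ Finset.range k, dampArg τ ψ (U m) n)) w| ≤
      C₁ * (𝒯 m).size D * (T + (C + C * T)) := by
    rw [map_sum, sum_inner, Finset.mul_sum, ← Finset.sum_add_distrib]
    refine (Finset.abs_sum_le_sum_abs _ _).trans ?_
    calc _ ≤ ∑ n ∈ Finset.range k, C₁ * (𝒯 m).size D *
          (τ + τ⁻¹ * (𝒯 m).dampForm D (dampArg τ ψ (U m) n) (dampArg τ ψ (U m) n)) :=
          Finset.sum_le_sum fun n hn => h1 n ((Finset.mem_range.mp hn).trans_le hk)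
      _ ≤ ∑ n ∈ Finset.range (𝒩 m), C₁ * (𝒯 m).size D *
          (τ + τ⁻¹ * (𝒯 m).dampForm D (dampArg τ ψ (U m) n) (dampArg τ ψ (U m) n)) := by
          refine Finset.sum_le_sum_of_subset_of_nonneg (Finset.range_mono hk) fun n _ _ => ?_
          have := ((𝒯 m).isSymmNonneg_dampForm D).nonneg (dampArg τ ψ (U m) n)
          positivity
      _ = C₁ * (𝒯 m).size D * (T + τ⁻¹ * ∑ n ∈ Finset.range (𝒩 m),
            (𝒯 m).dampForm D (dampArg τ ψ (U m) n) (dampArg τ ψ (U m) n)) := by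
          rw [← Finset.mul_sum, Finset.sum_add_distrib, ← Finset.mul_sum, Finset.sum_const,
            Finset.card_range, nsmul_eq_mul, hτ, h.mul_τ]
      _ ≤ C₁ * (𝒯 m).size D * (T + (C + C * T)) := by
          gcongr
          rw [inv_mul_le_iff₀ hτ0]
          refine ((h.bounds m).sum_dampForm_dampArg_le (h.pos m)).trans ?_
          rw [← hτ]
          nlinarith [mul_le_mul_of_nonneg_left hτT (mul_nonneg hC hτ0.le)]
  -- The two-step differences telescope to twice the displacement, up to `τ` times the three
  -- velocities with indices `0`, `1` and `k`; hence the constant `3`.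
  have h3 : |inner ℝ ((𝒯 m).step D (∑ n ∈ Finset.range k, dampArg τ ψ (U m) n)) w -
      2 * (inner ℝ ((𝒯 m).step D (U m k)) w - inner ℝ ((𝒯 m).step D (U m 0)) w)| ≤
      τ * (3 * √C * ‖w‖) := by
    cases k with
    | zero => simp; positivity
    | succ k =>
      have a0 := (h.bounds m).norm_velLp_le hτ0 (Nat.zero_le _)
      have a1 := (h.bounds m).norm_velLp_le hτ0 (n := 1) (h.pos m)
      have a2 := (h.bounds m).norm_velLp_le hτ0 (n := k + 1) hk
      have e1 := h.step_succ m 0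
      have e2 := h.step_succ m k
      have e3 : (𝒯 m).step D (τ • ψ) = τ • (𝒯 m).velLp D τ ψ (U m) 0 := by
        rw [map_smul]; rfl
      have e4 : (𝒯 m).step D (∑ n ∈ Finset.range (k + 1), dampArg τ ψ (U m) n) -
          (2 : ℝ) • ((𝒯 m).step D (U m (k + 1)) - (𝒯 m).step D (U m 0)) =
          τ • ((𝒯 m).velLp D τ ψ (U m) 0 - (𝒯 m).velLp D τ ψ (U m) (k + 1) -
            (𝒯 m).velLp D τ ψ (U m) 1) := by
        rw [sum_dampArg, map_add, map_sub, map_sub, map_add, e3]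
        rw [zero_add] at e1
        rw [e1, e2, two_smul]
        simp only [smul_sub]
        abel
      rw [← inner_sub_left, ← real_inner_smul_left, ← inner_sub_left, e4, real_inner_smul_left,
        abs_mul, abs_of_pos hτ0]
      refine mul_le_mul_of_nonneg_left ?_ hτ0.le
      refine (abs_real_inner_le_norm _ _).trans ?_
      gcongr
      refine (norm_sub_le _ _).trans ?_
      have := norm_sub_le ((𝒯 m).velLp D τ ψ (U m) 0) ((𝒯 m).velLp D τ ψ (U m) (k + 1))
      linarith
  have h4 : 0 ≤ C₁ * (𝒯 m).size D * (T + (C + C * T)) := by positivity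
  have h5 : 0 ≤ τ * (3 * √C * ‖w‖) := by positivity
  rw [abs_le] at h2 h3 ⊢
  constructor <;> linarith [h2.1, h2.2, h3.1, h3.2]

/-- For each test function the relation holds outside a null set depending on it. Separability of
`L² × L²` allows one null set for all pairs at once. -/
theorem ae_memH10 (h : LimitData D T Φ Ψ 𝒯 𝒩 U C x y q) (hΦ : D.MemH1 Φ) :
    ∀ᵐ t ∂(volume.restrict (Ioo 0 T)),
      MemH10 D.L (position D Φ x t) (D.glue (D.rescale (y t))) := by
  set S : Set (LineL2 × LineL2) := {p | ∃ φ φ' : C(ℝ, ℝ), (∀ s, HasDerivAt φ (φ' s) s) ∧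
    (∃ K, ∀ s, |φ' s| ≤ K) ∧ p = (D.slowness φ, windowLp 0 D.L φ')}
  have h1 := ae_forall_of_forall_ae (μ := volume.restrict (Ioo 0 T)) S
    (F := fun t p => inner ℝ (y t) p.1 + inner ℝ (position D Φ x t) p.2)
    (fun t => by fun_prop) (by
      rintro _ ⟨φ, φ', hφ, ⟨K, hK⟩, rfl⟩
      filter_upwards [h.ae_elastic hΦ hφ hK] with t ht
      rw [ht]; ring)
  filter_upwards [h1, ae_restrict_mem measurableSet_Ioo] with t ht htT
  refine D.memH10_of_slowness (h.position_ae_eq_zero hΦ (Ioo_subset_Icc_self htT)) ?_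
  intro φ φ' hφ hK
  have := ht _ ⟨φ, φ', hφ, hK, rfl⟩
  simp only at this
  linarith

theorem ae_isWeakDeriv (h : LimitData D T Φ Ψ 𝒯 𝒩 U C x y q) (hΦ : D.MemH1 Φ) :
    ∀ᵐ t ∂(volume.restrict (Ioo 0 T)),
      IsWeakDeriv D.α D.β (restrictLp D.α D.β (x t)) (restrictLp D.α D.β (D.δ⁻¹ • q t)) := by
  set S : Set (LineL2 × LineL2) := {p | ∃ φ φ' : C(ℝ, ℝ), (∀ s, HasDerivAt φ (φ' s) s) ∧
    (∃ K, ∀ s, |φ' s| ≤ K) ∧ (∀ s, φ s ≠ 0 → s ∈ Ioo D.α D.β) ∧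
    p = (D.δ⁻¹ • windowLp 0 D.L φ, windowLp 0 D.L φ')}
  have h1 := ae_forall_of_forall_ae (μ := volume.restrict (Ioo 0 T)) S
    (F := fun t p => inner ℝ (q t) p.1 + inner ℝ (x t) p.2)
    (fun t => by fun_prop) (by
      rintro _ ⟨φ, φ', hφ, ⟨K, hK⟩, hs, rfl⟩
      filter_upwards [h.ae_viscous hΦ hφ hK hs] with t ht
      rw [ht]; ring)
  filter_upwards [h1] with t ht
  refine D.isWeakDeriv_of_viscous fun φ φ' hφ hK hs => ?_
  have := ht _ ⟨φ, φ', hφ, hK, hs, rfl⟩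
  simp only at this
  linarith

/-- The limit viscous flux pairs only with what happens on `(α, β)`, so its contribution to the weak
equation is the damping term of the middle component. -/
theorem integral_viscous_cutLp (h : LimitData D T Φ Ψ 𝒯 𝒩 U C x y q) {g : ℝ → LineL2}
    (hg : MemLp g 2 (volume.restrict (Ioo 0 T))) :
    ∫ t in Ioo 0 T, inner ℝ (q t) (g t) = ∫ t in Ioo 0 T, inner ℝ (q t) (cutLp D.α D.β (g t)) := by
  refine tendsto_nhds_unique (h.tendsto_q g hg) ?_
  refine (h.tendsto_q _ ((cutLp D.α D.β).comp_memLp' hg)).congr fun m => ?_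
  refine integral_congr_ae (Eventually.of_forall fun t => ?_)
  simp only [stepTime, Mesh.viscousLp, Function.comp_apply, real_inner_smul_left,
    Mesh.inner_dampLp_cutLp]

theorem integral_eq (h : LimitData D T Φ Ψ 𝒯 𝒩 U C x y q) (hΨ : D.MemH1 Ψ)
    {P Px Pt : ℝ → D.L2Triple} (hP : D.InEnergySpace T P Px Pt) (hPT : P T = 0) :
    ∫ t in Ioo 0 T, inner ℝ (x t) (D.glue (Pt t)) = -inner ℝ (D.glue Ψ) (D.glue (P 0)) +
      ((∫ t in Ioo 0 T, inner ℝ (y t) (D.glue (Px t))) +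
        ∫ t in Ioo 0 T, inner ℝ (q t) (D.glue (Px t))) := by
  refine integral_inner_eq_of_scheme (P := fun t => D.glue (P t)) h.τ_pos h.mul_τ h.tendsto_x
    h.tendsto_y h.tendsto_q h.T_pos (D.glue.comp_memLp' hP.memLp_grad)
    (D.glue.comp_memLp' hP.memLp_time)
    (fun e => hP.time.eq_add_integral h.T_pos hP.continuousOn
      (hP.memLp_time.integrable (by norm_num)) ((innerSL ℝ e).comp D.glue)) (by simp [hPT])
    (tendsto_inner_step_cellMean h.size_tendsto hΨ _) fun m n hn => ?_
  filter_upwards [hP.memH1L, hP.grad] with t h1 h2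
  exact (h.isDiscreteSolution m).inner_velLp_sub (h.τ_pos m) rfl hn (D.memH10_glue h2 h1.2)

theorem isWeakSolution (h : LimitData D T Φ Ψ 𝒯 𝒩 U C x y q) (hΦ : D.MemH1 Φ) (hΨ : D.MemH1 Ψ) :
    D.IsWeakSolution T Φ Ψ fun t => D.split (position D Φ x t) := by
  have hT := h.T_pos
  have hpos0 : position D Φ x 0 = D.glue Φ := by simp [position]
  have hWc := h.continuousOn_position
  obtain ⟨B, hB⟩ := isCompact_Icc.exists_bound_of_continuousOn hWc
  have hWL : MemLp (position D Φ x) 2 (volume.restrict (Ioo 0 T)) :=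
    MemLp.of_bound ((hWc.mono Ioo_subset_Icc_self).aestronglyMeasurable measurableSet_Ioo) B
      ((ae_restrict_mem measurableSet_Ioo).mono fun t ht => hB t (Ioo_subset_Icc_self ht))
  have hgrad : ∀ᵐ t ∂(volume.restrict (Ioo 0 T)),
      D.HasGradient (D.split (position D Φ x t)) (D.rescale (y t)) ∧
      D.BoundaryTransmission (D.split (position D Φ x t)) := by
    filter_upwards [h.ae_memH10 hΦ] with t ht
    have := D.hasGradient_split ht
    rw [D.split_glue] at this
    exact ⟨this, D.boundaryTransmission_split ht⟩
  refine ⟨fun t => D.rescale (y t), fun t => D.split (x t),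
    fun t => restrictLp D.α D.β (D.δ⁻¹ • q t), ⟨?_, ?_, ?_, ?_, ?_, ?_, ?_⟩, ?_, ?_, ?_, ?_⟩
  · exact D.split.continuous.comp_continuousOn hWc
  · exact D.split.comp_memLp' hWL
  · exact D.rescale.comp_memLp' h.memLp_y
  · exact D.split.comp_memLp' h.memLp_x
  · exact hgrad.mono fun t ht => ⟨⟨_, ht.1⟩, ht.2⟩
  · exact hgrad.mono fun t ht => ht.1
  · exact (isWeakTimeDeriv_of_primitive hT h.memLp_x (hWL.integrable (by norm_num))
      fun t _ => by rw [hpos0]; rfl).clm_comp (hWL.integrable (by norm_num))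
      (h.memLp_x.integrable (by norm_num)) D.split
  · exact (restrictLp D.α D.β).comp_memLp' (h.memLp_q.const_smul D.δ⁻¹)
  · exact h.ae_isWeakDeriv hΦ
  · change D.split (position D Φ x 0) = Φ
    rw [hpos0, D.split_glue]
  · intro P Px Pt hP hPT
    have key := h.integral_eq hΨ hP hPT
    have hPx := D.glue.comp_memLp' hP.memLp_grad
    have hcut := h.integral_viscous_cutLp hPx
    simp only [Function.comp_apply] at hcut
    rw [hcut] at key
    have hΨs : D.split (D.glue Ψ) = Ψ := D.split_glue Ψ
    rw [D.split_apply] at hΨs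
    have e0 : inner ℝ (D.glue Ψ) (D.glue (P 0)) =
        inner ℝ Ψ.1 (P 0).1 + inner ℝ Ψ.2.1 (P 0).2.1 + inner ℝ Ψ.2.2 (P 0).2.2 := by
      rw [D.inner_glue]
      conv_rhs => rw [← hΨs]
    let π₁ : D.L2Triple →L[ℝ] L2 0 D.α := ContinuousLinearMap.fst ℝ _ _
    let π₂ : D.L2Triple →L[ℝ] L2 D.α D.β :=
      (ContinuousLinearMap.fst ℝ _ _).comp (ContinuousLinearMap.snd ℝ _ _)
    let π₃ : D.L2Triple →L[ℝ] L2 D.β D.L :=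
      (ContinuousLinearMap.snd ℝ _ _).comp (ContinuousLinearMap.snd ℝ _ _)
    have i1 : ∀ {F G : ℝ → D.L2Triple}, MemLp F 2 (volume.restrict (Ioo 0 T)) →
        MemLp G 2 (volume.restrict (Ioo 0 T)) →
        Integrable (fun t => inner ℝ (F t).1 (G t).1) (volume.restrict (Ioo 0 T)) :=
      fun hF hG => integrable_inner (π₁.comp_memLp' hF) (π₁.comp_memLp' hG)
    have i2 : ∀ {F G : ℝ → D.L2Triple}, MemLp F 2 (volume.restrict (Ioo 0 T)) →
        MemLp G 2 (volume.restrict (Ioo 0 T)) →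
        Integrable (fun t => inner ℝ (F t).2.1 (G t).2.1) (volume.restrict (Ioo 0 T)) :=
      fun hF hG => integrable_inner (π₂.comp_memLp' hF) (π₂.comp_memLp' hG)
    have i3 : ∀ {F G : ℝ → D.L2Triple}, MemLp F 2 (volume.restrict (Ioo 0 T)) →
        MemLp G 2 (volume.restrict (Ioo 0 T)) →
        Integrable (fun t => inner ℝ (F t).2.2 (G t).2.2) (volume.restrict (Ioo 0 T)) :=
      fun hF hG => integrable_inner (π₃.comp_memLp' hF) (π₃.comp_memLp' hG)
    have expand : ∀ {f : ℝ → LineL2} {G : ℝ → D.L2Triple}, MemLp f 2 (volume.restrict (Ioo 0 T)) →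
        MemLp G 2 (volume.restrict (Ioo 0 T)) →
        ∫ t in Ioo 0 T, inner ℝ (f t) (D.glue (G t)) =
          (∫ t in Ioo 0 T, inner ℝ (D.split (f t)).1 (G t).1) +
          (∫ t in Ioo 0 T, inner ℝ (D.split (f t)).2.1 (G t).2.1) +
          ∫ t in Ioo 0 T, inner ℝ (D.split (f t)).2.2 (G t).2.2 := by
      intro f G hf hG
      have hs : MemLp (fun t => D.split (f t)) 2 (volume.restrict (Ioo 0 T)) :=
        D.split.comp_memLp' hf
      have h12 : Integrable (fun t => inner ℝ (D.split (f t)).1 (G t).1 +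
          inner ℝ (D.split (f t)).2.1 (G t).2.1) (volume.restrict (Ioo 0 T)) :=
        (i1 hs hG).add (i2 hs hG)
      rw [← integral_add (i1 hs hG) (i2 hs hG), ← integral_add h12 (i3 hs hG)]
      simp only [D.inner_glue]
      rfl
    rw [expand h.memLp_x hP.memLp_time, expand h.memLp_y hP.memLp_grad, e0] at key
    have c1 := D.C₁_pos.ne'
    have c2 := D.C₂_pos.ne'
    have c3 := D.C₃_pos.ne'
    have cδ := D.δ_pos.ne'
    have f1 : D.C₁ ^ 2 * (∫ t in Ioo 0 T, inner ℝ (D.rescale (y t)).1 (Px t).1) =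
        ∫ t in Ioo 0 T, inner ℝ (D.split (y t)).1 (Px t).1 := by
      rw [← integral_const_mul]
      refine integral_congr_ae (Eventually.of_forall fun t => ?_)
      simp only [D.rescale_apply, D.split_apply, real_inner_smul_left]
      field_simp
    have f2 : D.C₂ ^ 2 * (∫ t in Ioo 0 T, inner ℝ (D.rescale (y t)).2.1 (Px t).2.1) =
        ∫ t in Ioo 0 T, inner ℝ (D.split (y t)).2.1 (Px t).2.1 := by
      rw [← integral_const_mul]
      refine integral_congr_ae (Eventually.of_forall fun t => ?_)
      simp only [D.rescale_apply, D.split_apply, real_inner_smul_left]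
      field_simp
    have f3 : D.C₃ ^ 2 * (∫ t in Ioo 0 T, inner ℝ (D.rescale (y t)).2.2 (Px t).2.2) =
        ∫ t in Ioo 0 T, inner ℝ (D.split (y t)).2.2 (Px t).2.2 := by
      rw [← integral_const_mul]
      refine integral_congr_ae (Eventually.of_forall fun t => ?_)
      simp only [D.rescale_apply, D.split_apply, real_inner_smul_left]
      field_simp
    -- Here `v_{tx} = δ⁻¹ q` on `(α, β)`, and the cut function restricts to the middle component of
    -- the test gradient.
    have f4 : D.δ * (∫ t in Ioo 0 T, inner ℝ (restrictLp D.α D.β (D.δ⁻¹ • q t)) (Px t).2.1) =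
        ∫ t in Ioo 0 T, inner ℝ (q t) (cutLp D.α D.β (D.glue (Px t))) := by
      rw [← integral_const_mul]
      refine integral_congr_ae (Eventually.of_forall fun t => ?_)
      have hs := D.split_glue (Px t)
      rw [D.split_apply] at hs
      have hs2 : restrictLp D.α D.β (D.glue (Px t)) = (Px t).2.1 := congrArg (fun z => z.2.1) hs
      simp only [map_smul, real_inner_smul_left, cutLp,
        ContinuousLinearMap.comp_apply, inner_extendLp, hs2]
      field_simp
    rw [f1, f2, f3, f4]
    linarith

end LimitData

/-! ### Weak-* convergence -/

namespace Mesh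

variable (M : Mesh) (D : Problem)

theorem coeFn_step (V : ℕ → ℝ) : M.step D V =ᵐ[volume]
    fun s => ∑ i ∈ Finset.Icc 1 M.Nmax, (M.cell D i).indicator 1 s * V i := by
  have h1 : ∀ᵐ s ∂(volume : Measure ℝ), ∀ j, (V (j + 1) •
      windowLp (M.edge D j) (M.edge D (j + 1)) 1 : LineL2) s =
      (M.cell D (j + 1)).indicator 1 s * V (j + 1) := by
    rw [ae_all_iff]
    intro j
    filter_upwards [Lp.coeFn_smul (V (j + 1)) (windowLp (M.edge D j) (M.edge D (j + 1)) 1),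
      coeFn_windowLp (M.edge D j) (M.edge D (j + 1)) 1] with s h1 h2
    rw [h1, Pi.smul_apply, h2, smul_eq_mul, mul_comm]
    rfl
  rw [step, stepLp_apply]
  filter_upwards [Lp.coeFn_fun_finsetSum (Finset.range M.Nmax) (fun j => V (j + 1) •
    windowLp (M.edge D j) (M.edge D (j + 1)) 1), h1] with s hs h1
  rw [hs]
  simp only [h1]
  rw [Finset.range_eq_Ico, Finset.sum_Ico_add' (fun i => (M.cell D i).indicator 1 s * V i) 0 M.Nmax 1]
  rfl

theorem reconstruction_eq {T : ℝ} {N : ℕ} (U : ℕ → ℕ → ℝ) (hτ : 0 < T / (N : ℝ))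
    (hN : N * (T / (N : ℝ)) = T) {t : ℝ} (ht : t ∈ Ioo 0 T) (s : ℝ) :
    M.reconstruction D T N U t s =
      ∑ i ∈ Finset.Icc 1 M.Nmax, (M.cell D i).indicator 1 s * U ⌊t / (T / (N : ℝ))⌋₊ i := by
  have hn := floor_div_lt hτ hN ht
  rw [reconstruction, Finset.sum_eq_single ⌊t / (T / (N : ℝ))⌋₊]
  · refine Finset.sum_congr rfl fun i _ => ?_
    rw [indicator_of_mem, Pi.one_apply, one_mul]
    refine ⟨floor_mul_le hτ ht.1.le, ?_⟩
    have := Nat.lt_floor_add_one (t / (T / (N : ℝ)))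
    rwa [div_lt_iff₀ hτ] at this
  · intro n _ hne
    refine Finset.sum_eq_zero fun i _ => ?_
    rw [indicator_of_notMem, zero_mul, zero_mul]
    exact fun h => hne (floor_div_eq hτ h).symm
  · exact fun h => absurd (Finset.mem_range.mpr hn) h

end Mesh

namespace LimitData

variable {D : Problem} {T : ℝ} {Φ Ψ : D.L2Triple} {𝒯 : ℕ → Mesh} {𝒩 : ℕ → ℕ}
  {U : ℕ → ℕ → ℕ → ℝ} {C : ℝ} {x y q : ℝ → LineL2}

/-- For fixed `t` the reconstruction is the step function at the preceding time node, which
converges weakly in space for every `t` and is uniformly bounded; dominated convergence in time then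
covers every `g ∈ L¹(0, T; L²)`. -/
theorem weakStarTendsto (h : LimitData D T Φ Ψ 𝒯 𝒩 U C x y q) (hΦ : D.MemH1 Φ) (a b : ℝ) :
    WeakStarTendsto T a b (fun m => (𝒯 m).reconstruction D T (𝒩 m) (U m))
      fun t => restrictLp a b (position D Φ x t) := by
  have hWc := h.continuousOn_position
  constructor
  · have hc : ContinuousOn (fun t => restrictLp a b (position D Φ x t)) (Icc 0 T) :=
      (restrictLp a b).continuous.comp_continuousOn hWc
    obtain ⟨B, hB⟩ := isCompact_Icc.exists_bound_of_continuousOn hc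
    exact MemLp.of_bound ((hc.mono Ioo_subset_Icc_self).aestronglyMeasurable measurableSet_Ioo) B
      ((ae_restrict_mem measurableSet_Ioo).mono fun t ht => hB t (Ioo_subset_Icc_self ht))
  · intro g hg
    have hgm : Integrable (fun t => extendLp a b (g t)) (volume.restrict (Ioo 0 T)) :=
      (extendLp a b).integrable_comp hg
    have e1 : ∫ t in Ioo 0 T, ∫ s in Ioo a b, restrictLp a b (position D Φ x t) s * g t s =
        ∫ t in Ioo 0 T, inner ℝ (position D Φ x t) (extendLp a b (g t)) := by
      refine integral_congr_ae (Eventually.of_forall fun t => ?_)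
      simp only
      rw [setIntegral_restrictLp, integral_Ioo_mul_eq_inner a b _ (position D Φ x t)
        (ae_eq_refl _), inner_extendLp]
    have e2 : ∀ m, ∫ t in Ioo 0 T, ∫ s in Ioo a b,
        (𝒯 m).reconstruction D T (𝒩 m) (U m) t s * g t s =
        ∫ t in Ioo 0 T, inner ℝ (stepTime (T / (𝒩 m : ℝ)) (fun n => (𝒯 m).step D (U m n)) t)
          (extendLp a b (g t)) := by
      intro m
      refine setIntegral_congr_fun measurableSet_Ioo fun t ht => ?_
      rw [integral_Ioo_mul_eq_inner a b _ ((𝒯 m).step D (U m ⌊t / (T / (𝒩 m : ℝ))⌋₊)),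
        inner_extendLp, stepTime]
      filter_upwards [(𝒯 m).coeFn_step D (U m ⌊t / (T / (𝒩 m : ℝ))⌋₊)] with s hs
      rw [hs, (𝒯 m).reconstruction_eq D (U m) (h.τ_pos m) (h.mul_τ m) ht]
    simp only [e1, e2]
    refine tendsto_integral_of_dominated_convergence
      (fun t => (‖D.glue Φ‖ + T * √C) * ‖extendLp a b (g t)‖) (fun m => ?_)
      (hgm.norm.const_mul _) (fun m => ?_) ?_
    · exact (stronglyMeasurable_stepTime _ _).aestronglyMeasurable.inner hgm.aestronglyMeasurable
    · filter_upwards [ae_restrict_mem measurableSet_Ioo] with t ht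
      refine (abs_real_inner_le_norm _ _).trans ?_
      gcongr
      exact h.norm_step_le m (floor_div_lt (h.τ_pos m) (h.mul_τ m) ht).le
    · filter_upwards [ae_restrict_mem measurableSet_Ioo] with t ht
      exact h.tendsto_inner_step hΦ _ (Ioo_subset_Icc_self ht)

end LimitData

end KelvinVoigt

end

/-! ### The convergence theorem. -/

theorem mainTheorem5 (D : KelvinVoigt.Problem) (T : ℝ) (hT : 0 < T)
    (Φ Ψ : D.L2Triple) (hΦ : D.MemH1L Φ) (hΨ : D.MemH1 Ψ)
    (𝒯 : ℕ → KelvinVoigt.Mesh) (𝒩 : ℕ → ℕ) (h𝒩 : ∀ m, 0 < 𝒩 m)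
    (U : ℕ → ℕ → ℕ → ℝ)
    (hU : ∀ m, (𝒯 m).IsDiscreteSolution D T (𝒩 m) Φ Ψ (U m))
    (hsize : Tendsto (fun m => (𝒯 m).size D) atTop (𝓝 0))
    (hΔt : Tendsto (fun m => T / (𝒩 m : ℝ)) atTop (𝓝 0)) :
    ∃ σ : ℕ → ℕ, StrictMono σ ∧
      ∃ W : ℝ → D.L2Triple, D.IsWeakSolution T Φ Ψ W ∧
        KelvinVoigt.WeakStarTendsto T 0 D.α
          (fun k => (𝒯 (σ k)).reconstruction D T (𝒩 (σ k)) (U (σ k))) (fun t => (W t).1) ∧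
        KelvinVoigt.WeakStarTendsto T D.α D.β
          (fun k => (𝒯 (σ k)).reconstruction D T (𝒩 (σ k)) (U (σ k))) (fun t => (W t).2.1) ∧
        KelvinVoigt.WeakStarTendsto T D.β D.L
          (fun k => (𝒯 (σ k)).reconstruction D T (𝒩 (σ k)) (U (σ k))) (fun t => (W t).2.2) := by
  obtain ⟨σ, hσ, C, x, y, q, h⟩ :=
    KelvinVoigt.exists_limitData hT hΦ hΨ h𝒩 hU hsize hΔt
  exact ⟨σ, hσ, fun t => D.split (KelvinVoigt.LimitData.position D Φ x t),
    h.isWeakSolution hΦ.1 hΨ, h.weakStarTendsto hΦ.1 0 D.α, h.weakStarTendsto hΦ.1 D.α D.β,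
    h.weakStarTendsto hΦ.1 D.β D.L⟩
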